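/- Let $F$ be a field of characteristic $0$ and let $t\in F$. For finite sets $U,V$, a partition diagram from $U$ to $V$ is a set partition of $U\sqcup V$; elements of $U$ are drawn as top vertices, elements of $V$ as bottom vertices. Let $\mathrm{Rep}_0(S_t)$ be the $F$-linear category whose objects are finite sets (we write $[n]=\{1,\dots,n\}$) and whose morphisms $U\to V$ are formal $F$-linear combinations of partition diagrams from $U$ to $V$. Diagrams are composed by vertical concatenation: the middle row is removed, and every block lying entirely in the middle row is replaced by a factor $t$. The tensor product is disjoint union of sets and horizontal juxtaposition of diagrams, the symmetric braiding $c_{U,V}$ is the diagram of the bijection $U\sqcup V\to V\sqcup U$, and every object $U$ is its own dual, where the evaluation $U\otimes U\to\mathbf 1$ and the coevaluation $\mathbf 1\to U\otimes U$ are the diagrams whose blocks are the pairs formed by the two copies of each $u\in U$. Deligne's category $\mathrm{Rep}(S_t)$ is the Karoubi (idempotent) envelope of the additive envelope of $\mathrm{Rep}_0(S_t)$, with the induced tensor product, symmetric braiding $c$ and duals $V\mapsto V^*$ (evaluation $\mathrm{ev}_V:V^*\otimes V\to\mathbf 1$, coevaluation $\mathrm{coev}_V:\mathbf 1\to V\otimes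 V^*$), and with twist $\theta=\mathrm{id}$; it is a ribbon category. Put $$\mathrm{coev}'_V=(\mathrm{id}_{V^*}\otimes\theta_V)\,c_{V,V^*}\,\mathrm{coev}_V,\qquad \mathrm{ev}'_V=\mathrm{ev}_V\,c_{V,V^*}\,(\theta_V\otimes \mathrm{id}_{V^*}),$$ and for $f\in\mathrm{End}(V\otimes W)$ define the partial traces $$\mathrm{tr}_L(f)=(\mathrm{ev}_V\otimes\mathrm{id}_W)(\mathrm{id}_{V^*}\otimes f)(\mathrm{coev}'_V\otimes\mathrm{id}_W)\in\mathrm{End}(W),\qquad \mathrm{tr}_R(f)=(\mathrm{id}_V\otimes\mathrm{ev}'_W)(f\otimes\mathrm{id}_{W^*})(\mathrm{id}_V\otimes\mathrm{coev}_W)\in\mathrm{End}(V).$$ An ambidextrous trace on an object $J$ is an $F$-linear map $\tau:\mathrm{End}(J)\to F$ with $\tau(\mathrm{tr}_L(h))=\tau(\mathrm{tr}_R(h))$ for all $h\in\mathrm{End}(J\otimes J)$. Let $n>0$. Identify a permutation $\sigma$ of $[n]$ with the diagram whose blocks are the pairs consisting of the top vertex $i$ and the bottom vertex $\sigma(i)$.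 Let $s_n=\frac1{n!}\sum_{\sigma\in S_n}\mathrm{sgn}(\sigma)\,\sigma$, which is an idempotent in $\mathrm{End}([n])$, let $x_n\in\mathrm{End}([n])$ be the diagram obtained from the identity diagram by removing the edge between the top and bottom vertices labelled $n$, and let $M_n=([n],s_n)$, the object of $\mathrm{Rep}(S_t)$ which is the image of $s_n$. **Theorem.** For every $t\in F$ and every $n>0$, the elements $s_n$ and $s_nx_ns_n$ form a basis of $\mathrm{End}(M_n)$, and the linear functional $\mathsf t_n:\mathrm{End}(M_n)\to F$ determined by $\mathsf t_n(s_n)=\mathsf t_n(s_nx_ns_n)=1$ is a nonzero ambidextrous trace on $M_n$; that is, $\mathsf t_n\neq0$ and $\mathsf t_n(\mathrm{tr}_L(h))=\mathsf t_n(\mathrm{tr}_R(h))$ for all $h\in\mathrm{End}(M_n\otimes M_n)$. -/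

import Mathlib

set_option linter.unusedSectionVars false

open CategoryTheory MonoidalCategory

noncomputable section

namespace Deligne

/-! ### Partition diagrams

A partition diagram from `U` to `V` is a set partition (an equivalence relation) of the disjoint
union `U ⊕ V`; elements of `U` are the top vertices, elements of `V` the bottom vertices. -/

/-- Stacking of two partition diagrams, `π` on top of `μ`: the finest partition of the three rows
`U`, `V`, `W` of vertices which is coarser than `π` on the upper two rows and than `μ` on the
lower two. -/
def stack {U V W : Type} (π : Setoid (U ⊕ V)) (μ : Setoid (V ⊕ W)) : Setoid (U ⊕ (V ⊕ W)) :=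
  π.map (Sum.map id Sum.inl) ⊔ μ.map Sum.inr

/-- Vertical concatenation: the middle row of the stack is removed. -/
def concat {U V W : Type} (π : Setoid (U ⊕ V)) (μ : Setoid (V ⊕ W)) : Setoid (U ⊕ W) :=
  (stack π μ).comap (Sum.map id Sum.inr)

/-- The number of blocks of the stack which lie entirely in the middle row. -/
def loops {U V W : Type} (π : Setoid (U ⊕ V)) (μ : Setoid (V ⊕ W)) : ℕ :=
  Nat.card {c : Quotient (stack π μ) //
    ∀ x : U ⊕ W, (Quotient.mk (stack π μ) (Sum.map id Sum.inr x)) ≠ c}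

/-- Horizontal concatenation: the blocks are those of `π` together with those of `μ`. -/
def juxt {U V U' V' : Type} (π : Setoid (U ⊕ V)) (μ : Setoid (U' ⊕ V')) :
    Setoid ((U ⊕ U') ⊕ (V ⊕ V')) :=
  Setoid.ker (Sum.elim
    (Sum.map (fun u => Quotient.mk π (Sum.inl u)) (fun u => Quotient.mk μ (Sum.inl u)))
    (Sum.map (fun v => Quotient.mk π (Sum.inr v)) (fun v => Quotient.mk μ (Sum.inr v))))

/-- The diagram of a bijection: its blocks are the pairs `{u, e u}`. -/
def bijDiagram {U V : Type} (e : U ≃ V) : Setoid (U ⊕ V) :=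
  Setoid.ker (Sum.elim e id)

/-- The diagram obtained from that of a bijection by removing all edges adjacent to the top
vertices in `I`: the vertices `u` and `e u` with `u ∈ I` become singletons. -/
def bijDiagramRemove {U V : Type} (e : U ≃ V) (I : Set U) : Setoid (U ⊕ V) :=
  open scoped Classical in
  Setoid.ker (Sum.elim (fun u => if u ∈ I then Sum.inl u else Sum.inr (e u)) Sum.inr :
    U ⊕ V → U ⊕ V)

/-- The diagram from the empty row to `U ⊕ U` with blocks the pairs `{inl u, inr u}`. -/
def cupDiagram (U : Type) : Setoid (Empty ⊕ (U ⊕ U)) :=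
  Setoid.ker (Sum.elim Empty.elim (Sum.elim id id))

/-- The diagram from `U ⊕ U` to the empty row with blocks the pairs `{inl u, inr u}`. -/
def capDiagram (U : Type) : Setoid ((U ⊕ U) ⊕ Empty) :=
  Setoid.ker (Sum.elim (Sum.elim id id) Empty.elim)

/-- A labelling of the vertices by elements of `T` is compatible with a diagram if it is constant
on blocks. -/
def Compat {U V T : Type} (π : Setoid (U ⊕ V)) (u : U → T) (v : V → T) : Prop :=
  π ≤ Setoid.ker (Sum.elim u v)

theorem stack_le {U V W : Type} {π : Setoid (U ⊕ V)} {μ : Setoid (V ⊕ W)}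
    {s : Setoid (U ⊕ (V ⊕ W))} :
    stack π μ ≤ s ↔ π ≤ s.comap (Sum.map id Sum.inl) ∧ μ ≤ s.comap Sum.inr := by
  unfold stack
  rw [sup_le_iff]
  refine and_congr ?_ ?_
  · constructor
    · intro h x y hxy
      exact h (Relation.EqvGen.rel _ _ ⟨x, y, hxy, rfl, rfl⟩)
    · intro h
      refine Setoid.eqvGen_le ?_
      rintro _ _ ⟨x, y, hxy, rfl, rfl⟩
      exact h hxy
  · constructor
    · intro h x y hxy
      exact h (Relation.EqvGen.rel _ _ ⟨x, y, hxy, rfl, rfl⟩)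
    · intro h
      refine Setoid.eqvGen_le ?_
      rintro _ _ ⟨x, y, hxy, rfl, rfl⟩
      exact h hxy

theorem stack_le_ker {U V W T : Type} {π : Setoid (U ⊕ V)} {μ : Setoid (V ⊕ W)}
    (u : U → T) (v : V → T) (w : W → T) :
    stack π μ ≤ Setoid.ker (Sum.elim u (Sum.elim v w)) ↔ Compat π u v ∧ Compat μ v w := by
  rw [stack_le]
  refine and_congr ?_ ?_
  · have : (Setoid.ker (Sum.elim u (Sum.elim v w))).comap (Sum.map id Sum.inl) =
      Setoid.ker (Sum.elim u v) := by
      ext x y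
      rcases x with x | x <;> rcases y with y | y <;> rfl
    rw [this]; rfl
  · exact Iff.rfl

theorem card_compat {U V W : Type} [Finite U] [Finite V] [Finite W]
    (π : Setoid (U ⊕ V)) (μ : Setoid (V ⊕ W)) {T : Type} [Finite T] (u : U → T) (w : W → T) :
    Nat.card {v : V → T // Compat π u v ∧ Compat μ v w} =
      open scoped Classical in if Compat (concat π μ) u w then Nat.card T ^ loops π μ else 0 := by
  classical
  set J := stack π μ with hJ
  have key : ∀ (v : V → T) (hv : Compat π u v ∧ Compat μ v w),
      J ≤ Setoid.ker (Sum.elim u (Sum.elim v w)) := fun v hv => (stack_le_ker u v w).2 hv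
  split_ifs with h
  · unfold loops
    rw [← Nat.card_fun]
    have h' : ∀ x y : U ⊕ W, (Quotient.mk J (Sum.map id Sum.inr x)) =
        (Quotient.mk J (Sum.map id Sum.inr y)) → Sum.elim u w x = Sum.elim u w y := by
      intro x y hxy
      have h2 : concat π μ x y := Quotient.exact (s := J) hxy
      exact h h2
    let g : ({c : Quotient J // ∀ x : U ⊕ W,
        (Quotient.mk J (Sum.map id Sum.inr x)) ≠ c} → T) → Quotient J → T := fun f c =>
      if hc : ∃ x : U ⊕ W, (Quotient.mk J (Sum.map id Sum.inr x)) = c then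
        Sum.elim u w hc.choose else f ⟨c, fun x hx => hc ⟨x, hx⟩⟩
    have hg : ∀ f x, g f (Quotient.mk J (Sum.map id Sum.inr x)) = Sum.elim u w x := by
      intro f x
      have hc : ∃ y : U ⊕ W, (Quotient.mk J (Sum.map id Sum.inr y)) =
        Quotient.mk J (Sum.map id Sum.inr x) := ⟨x, rfl⟩
      simp only [g, dif_pos hc]
      exact h' _ _ hc.choose_spec
    have hg' : ∀ f c, g f c.1 = f c := by
      intro f c
      have hc : ¬ ∃ y : U ⊕ W, (Quotient.mk J (Sum.map id Sum.inr y)) = c.1 := by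
        rintro ⟨y, hy⟩
        exact c.2 y hy
      simp only [g, dif_neg hc]
    have hgu : ∀ f a, g f (Quotient.mk J (Sum.inl a)) = u a := fun f a => hg f (Sum.inl a)
    have hgw : ∀ f a, g f (Quotient.mk J (Sum.inr (Sum.inr a))) = w a := fun f a => hg f (Sum.inr a)
    have hel : ∀ f, Sum.elim u (Sum.elim (fun v => g f (Quotient.mk J (Sum.inr (Sum.inl v)))) w) =
        fun x => g f (Quotient.mk J x) := by
      intro f
      funext x
      rcases x with x | x | x
      · exact (hgu f x).symm
      · rfl
      · exact (hgw f x).symm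
    refine Nat.card_congr
      { toFun := fun v c => Quotient.lift (Sum.elim u (Sum.elim v.1 w)) (key v.1 v.2) c.1
        invFun := fun f => ⟨fun v => g f (Quotient.mk J (Sum.inr (Sum.inl v))), ?_⟩
        left_inv := ?_
        right_inv := ?_ }
    · rw [← stack_le_ker, hel]
      intro x y hxy
      exact congrArg (g f) (Quotient.sound hxy)
    · rintro ⟨v, hv⟩
      apply Subtype.ext
      funext a
      have hF : ∀ F : {c : Quotient J // ∀ x : U ⊕ W,
          (Quotient.mk J (Sum.map id Sum.inr x)) ≠ c} → T,
          (∀ c, F c = Quotient.lift (Sum.elim u (Sum.elim v w)) (key v hv) c.1) →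
          g F (Quotient.mk J (Sum.inr (Sum.inl a))) = v a := by
        intro F hF
        by_cases hc : ∃ x : U ⊕ W, (Quotient.mk J (Sum.map id Sum.inr x)) =
            Quotient.mk J (Sum.inr (Sum.inl a))
        · obtain ⟨x, hx⟩ := hc
          rw [← hx, hg]
          have := key v hv (Quotient.exact hx)
          rcases x with x | x <;> exact this
        · exact (hg' F ⟨_, fun x hx => hc ⟨x, hx⟩⟩).trans (hF _)
      exact hF _ fun c => rfl
    · intro f
      funext c
      dsimp only
      rw [← hg' f c]
      obtain ⟨c, hc⟩ := c
      induction c using Quotient.inductionOn with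
      | h x => exact congrFun (hel f) x
  · rw [Nat.card_eq_zero]
    left
    constructor
    rintro ⟨v, hv⟩
    apply h
    intro x y hxy
    have := key v hv hxy
    rcases x with x | x <;> rcases y with y | y <;> exact this

/-- A weighted diagram is determined by its numbers of compatible labellings. -/
theorem eq_of_count {U V : Type} [Finite U] [Finite V] {π π' : Setoid (U ⊕ V)} {k k' : ℕ}
    (h : ∀ (T : Type) [Finite T] (u : U → T) (v : V → T),
      (open scoped Classical in if Compat π u v then Nat.card T ^ k else 0) =
      (open scoped Classical in if Compat π' u v then Nat.card T ^ k' else 0)) :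
    k = k' ∧ π = π' := by
  classical
  have hle : ∀ {π π' : Setoid (U ⊕ V)} {k k' : ℕ} (h : ∀ (T : Type) [Finite T] (u : U → T)
      (v : V → T), (if Compat π u v then Nat.card T ^ k else 0) =
      (if Compat π' u v then Nat.card T ^ k' else 0)), π' ≤ π := by
    intro π π' k k' h
    have := h (Option (Quotient π)) (fun a => some (Quotient.mk _ (Sum.inl a)))
      (fun a => some (Quotient.mk _ (Sum.inr a)))
    have hel : Sum.elim (fun a => some (Quotient.mk π (Sum.inl a)))
      (fun a => some (Quotient.mk π (Sum.inr a))) = fun x => some (Quotient.mk π x) := by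
      funext x
      rcases x with x | x <;> rfl
    have hpos : 0 < Nat.card (Option (Quotient π)) := Nat.card_pos
    rw [if_pos] at this
    · by_cases hc : Compat π' (fun a => some (Quotient.mk π (Sum.inl a)))
        (fun a => some (Quotient.mk π (Sum.inr a)))
      · intro x y hxy
        have h2 := hc hxy
        rw [Setoid.ker_def, hel] at h2
        exact Quotient.exact (Option.some_injective _ h2)
      · rw [if_neg hc] at this
        exact absurd this (pow_pos hpos k).ne'
    · intro x y hxy
      rw [Setoid.ker_def, hel]
      exact congrArg some (Quotient.sound hxy)
  refine ⟨?_, le_antisymm (hle fun T _ u v => (h T u v).symm) (hle h)⟩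
  have := h Bool (fun _ => true) (fun _ => true)
  have hcon : ∀ ρ : Setoid (U ⊕ V), Compat ρ (fun _ => true) (fun _ => true) := by
    intro ρ x y _
    rw [Setoid.ker_def]
    rcases x with x | x <;> rcases y with y | y <;> rfl
  rw [if_pos (hcon _), if_pos (hcon _)] at this
  exact Nat.pow_right_injective (by simp) this

theorem eq_of_le_iff {U V : Type} {π π' : Setoid (U ⊕ V)}
    (h : ∀ (T : Type) (u : U → T) (v : V → T), Compat π u v ↔ Compat π' u v) : π = π' := by
  have hle : ∀ {π π' : Setoid (U ⊕ V)} (h : ∀ (T : Type) (u : U → T) (v : V → T),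
      Compat π u v ↔ Compat π' u v), π' ≤ π := by
    intro π π' h
    have hel : Sum.elim (fun a => Quotient.mk π (Sum.inl a)) (fun a => Quotient.mk π (Sum.inr a)) =
        Quotient.mk π := by
      funext x
      rcases x with x | x <;> rfl
    have := (h _ (fun a => Quotient.mk π (Sum.inl a)) (fun a => Quotient.mk π (Sum.inr a))).1 (by
      rw [Compat, hel]
      intro x y hxy
      exact Quotient.sound hxy)
    rw [Compat, hel] at this
    intro x y hxy
    exact Quotient.exact (this hxy)
  exact le_antisymm (hle fun T u v => (h T u v).symm) (hle h)

theorem compat_juxt {U V U' V' T : Type} (π : Setoid (U ⊕ V)) (μ : Setoid (U' ⊕ V'))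
    (u : U ⊕ U' → T) (v : V ⊕ V' → T) :
    Compat (juxt π μ) u v ↔
      Compat π (u ∘ Sum.inl) (v ∘ Sum.inl) ∧ Compat μ (u ∘ Sum.inr) (v ∘ Sum.inr) := by
  constructor
  · intro h
    constructor
    · intro x y hxy
      have := @h (Sum.map Sum.inl Sum.inl x) (Sum.map Sum.inl Sum.inl y) (by
        rcases x with x | x <;> rcases y with y | y <;>
          exact congrArg Sum.inl (Quotient.sound hxy))
      rcases x with x | x <;> rcases y with y | y <;> exact this
    · intro x y hxy
      have := @h (Sum.map Sum.inr Sum.inr x) (Sum.map Sum.inr Sum.inr y) (by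
        rcases x with x | x <;> rcases y with y | y <;>
          exact congrArg Sum.inr (Quotient.sound hxy))
      rcases x with x | x <;> rcases y with y | y <;> exact this
  · rintro ⟨h1, h2⟩ x y hxy
    rcases x with (x | x) | (x | x) <;> rcases y with (y | y) | (y | y) <;>
      first
      | exact h1 (Quotient.exact (Sum.inl_injective hxy))
      | exact h2 (Quotient.exact (Sum.inr_injective hxy))
      | exact absurd hxy Sum.inl_ne_inr
      | exact absurd hxy Sum.inr_ne_inl

theorem compat_ker {U V X T : Type} (f : U ⊕ V → X) (u : U → T) (v : V → T) :
    Compat (Setoid.ker f) u v ↔ ∀ x y, f x = f y → Sum.elim u v x = Sum.elim u v y := by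
  constructor
  · intro h x y hxy
    exact h hxy
  · intro h x y hxy
    exact h x y hxy

theorem compat_bij {U V T : Type} (e : U ≃ V) (u : U → T) (v : V → T) :
    Compat (bijDiagram e) u v ↔ u = v ∘ e := by
  rw [bijDiagram, compat_ker]
  constructor
  · intro h
    funext a
    exact h (Sum.inl a) (Sum.inr (e a)) rfl
  · rintro rfl x y hxy
    rcases x with x | x <;> rcases y with y | y <;> exact congrArg v hxy

theorem compat_comap_left {U V W T : Type} (e : U ≃ V) (μ : Setoid (V ⊕ W)) (u : U → T)
    (w : W → T) : Compat (μ.comap (Sum.map e id)) u w ↔ Compat μ (u ∘ e.symm) w := by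
  constructor
  · intro h x y hxy
    have := @h (Sum.map e.symm id x) (Sum.map e.symm id y) (by
      rcases x with x | x <;> rcases y with y | y <;> simpa [Setoid.comap_rel] using hxy)
    rcases x with x | x <;> rcases y with y | y <;> exact this
  · intro h x y hxy
    have := h hxy
    rcases x with x | x <;> rcases y with y | y <;> simpa [Setoid.ker_def] using this

theorem compat_comap_right {U V W T : Type} (π : Setoid (U ⊕ V)) (e : V ≃ W) (u : U → T)
    (w : W → T) : Compat (π.comap (Sum.map id e.symm)) u w ↔ Compat π u (w ∘ e) := by
  constructor
  · intro h x y hxy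
    have := @h (Sum.map id e x) (Sum.map id e y) (by
      rcases x with x | x <;> rcases y with y | y <;> simpa [Setoid.comap_rel] using hxy)
    rcases x with x | x <;> rcases y with y | y <;> exact this
  · intro h x y hxy
    have := h hxy
    rcases x with x | x <;> rcases y with y | y <;> simpa [Setoid.ker_def] using this

theorem compat_cup {U T : Type} (u : Empty → T) (v : U ⊕ U → T) :
    Compat (cupDiagram U) u v ↔ v ∘ Sum.inl = v ∘ Sum.inr := by
  rw [cupDiagram, compat_ker]
  constructor
  · intro h
    funext a
    exact h (Sum.inr (Sum.inl a)) (Sum.inr (Sum.inr a)) rfl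
  · intro h x y hxy
    have h' : ∀ a, v (Sum.inl a) = v (Sum.inr a) := congrFun h
    rcases x with x | x | x <;> rcases y with y | y | y <;>
      first
      | exact x.elim
      | exact y.elim
      | (cases (show x = y from hxy); simp [h'])

theorem compat_cap {U T : Type} (u : U ⊕ U → T) (v : Empty → T) :
    Compat (capDiagram U) u v ↔ u ∘ Sum.inl = u ∘ Sum.inr := by
  rw [capDiagram, compat_ker]
  constructor
  · intro h
    funext a
    exact h (Sum.inl (Sum.inl a)) (Sum.inl (Sum.inr a)) rfl
  · intro h x y hxy
    have h' : ∀ a, u (Sum.inl a) = u (Sum.inr a) := congrFun h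
    rcases x with (x | x) | x <;> rcases y with (y | y) | y <;>
      first
      | exact x.elim
      | exact y.elim
      | (cases (show x = y from hxy); simp [h'])

/-- Criterion for computing a vertical concatenation. -/
theorem concat_of_count {U V W : Type} [Finite U] [Finite V] [Finite W]
    {π : Setoid (U ⊕ V)} {μ : Setoid (V ⊕ W)} {ν : Setoid (U ⊕ W)} {k : ℕ}
    (h : ∀ (T : Type) [Finite T] (u : U → T) (w : W → T),
      Nat.card {v : V → T // Compat π u v ∧ Compat μ v w} =
      (open scoped Classical in if Compat ν u w then Nat.card T ^ k else 0)) :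
    loops π μ = k ∧ concat π μ = ν :=
  eq_of_count fun T _ u w => by rw [← card_compat, h]

theorem count_unique {α : Type} {p : α → Prop} {q : Prop} {a : α} (k : ℕ)
    (h : ∀ x, p x ↔ x = a ∧ q) :
    Nat.card {x // p x} = open scoped Classical in if q then k ^ 0 else 0 := by
  split_ifs with hq
  · rw [pow_zero, Nat.card_eq_one_iff_unique]
    exact ⟨⟨fun x y => Subtype.ext (((h _).1 x.2).1.trans ((h _).1 y.2).1.symm)⟩,
      ⟨⟨a, (h a).2 ⟨rfl, hq⟩⟩⟩⟩
  · rw [Nat.card_eq_zero]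
    exact Or.inl ⟨fun x => hq ((h _).1 x.2).2⟩

theorem bij_concat {U V W : Type} [Finite U] [Finite V] [Finite W] (e : U ≃ V)
    (μ : Setoid (V ⊕ W)) : loops (bijDiagram e) μ = 0 ∧
      concat (bijDiagram e) μ = μ.comap (Sum.map e id) := by
  refine concat_of_count fun T _ u w => ?_
  refine (count_unique (a := u ∘ e.symm) _ fun v => ?_)
  rw [compat_bij, compat_comap_left]
  constructor
  · rintro ⟨rfl, h⟩
    have : (v ∘ e) ∘ e.symm = v := by funext; simp
    rw [this]
    exact ⟨rfl, h⟩
  · rintro ⟨rfl, h⟩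
    exact ⟨by funext; simp, h⟩

theorem concat_bij {U V W : Type} [Finite U] [Finite V] [Finite W] (π : Setoid (U ⊕ V))
    (e : V ≃ W) : loops π (bijDiagram e) = 0 ∧
      concat π (bijDiagram e) = π.comap (Sum.map id e.symm) := by
  refine concat_of_count fun T _ u w => ?_
  refine (count_unique (a := w ∘ e) _ fun v => ?_)
  rw [compat_bij, compat_comap_right]
  constructor
  · rintro ⟨h, rfl⟩
    exact ⟨rfl, h⟩
  · rintro ⟨rfl, h⟩
    exact ⟨h, rfl⟩

theorem concat_assoc {U V W X : Type} [Finite U] [Finite V] [Finite W] [Finite X]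
    (π : Setoid (U ⊕ V)) (μ : Setoid (V ⊕ W)) (ν : Setoid (W ⊕ X)) :
    loops π μ + loops (concat π μ) ν = loops μ ν + loops π (concat μ ν) ∧
      concat (concat π μ) ν = concat π (concat μ ν) := by
  classical
  refine eq_of_count fun T _ u x => ?_
  have := Fintype.ofFinite T
  have := Fintype.ofFinite V
  have := Fintype.ofFinite W
  have e1 : ∀ (p q : Prop) [Decidable p] [Decidable q] (m n : ℕ),
      (if p ∧ q then m * n else 0) = (if p then m else 0) * (if q then n else 0) := by
    intro p q _ _ m n
    by_cases hp : p <;> by_cases hq : q <;> simp [hp, hq]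
  have h1 : (if Compat (concat (concat π μ) ν) u x then
      Nat.card T ^ (loops π μ + loops (concat π μ) ν) else 0) =
      ∑ w : W → T, ∑ v : V → T, (if Compat π u v ∧ Compat μ v w ∧ Compat ν w x then 1 else 0) := by
    have hs : ∀ w : W → T, (∑ v : V → T,
        (if Compat π u v ∧ Compat μ v w ∧ Compat ν w x then 1 else 0)) =
        Nat.card T ^ loops π μ * (if Compat (concat π μ) u w ∧ Compat ν w x then 1 else 0) := by
      intro w
      have := card_compat π μ u w
      rw [Nat.card_eq_fintype_card, Fintype.card_subtype, Finset.card_filter] at this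
      by_cases hx : Compat ν w x
      · simp only [hx, and_true, this]
        simp
      · simp [hx]
    rw [Finset.sum_congr rfl fun w _ => hs w, ← Finset.mul_sum, ← Finset.card_filter,
      ← Fintype.card_subtype, ← Nat.card_eq_fintype_card, card_compat, pow_add]
    simp
  have h2 : (if Compat (concat π (concat μ ν)) u x then
      Nat.card T ^ (loops μ ν + loops π (concat μ ν)) else 0) =
      ∑ v : V → T, ∑ w : W → T, (if Compat π u v ∧ Compat μ v w ∧ Compat ν w x then 1 else 0) := by
    have hs : ∀ v : V → T, (∑ w : W → T,
        (if Compat π u v ∧ Compat μ v w ∧ Compat ν w x then 1 else 0)) =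
        Nat.card T ^ loops μ ν * (if Compat π u v ∧ Compat (concat μ ν) v x then 1 else 0) := by
      intro v
      have := card_compat μ ν v x
      rw [Nat.card_eq_fintype_card, Fintype.card_subtype, Finset.card_filter] at this
      by_cases hx : Compat π u v
      · simp only [hx, true_and, this]
        simp
      · simp [hx]
    rw [Finset.sum_congr rfl fun w _ => hs w, ← Finset.mul_sum, ← Finset.card_filter,
      ← Fintype.card_subtype, ← Nat.card_eq_fintype_card, card_compat, pow_add]
    simp
  rw [h1, h2, Finset.sum_comm]

theorem juxt_concat {U V W U' V' W' : Type} [Finite U] [Finite V] [Finite W] [Finite U']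
    [Finite V'] [Finite W'] (π : Setoid (U ⊕ V)) (μ : Setoid (V ⊕ W)) (π' : Setoid (U' ⊕ V'))
    (μ' : Setoid (V' ⊕ W')) :
    loops (juxt π π') (juxt μ μ') = loops π μ + loops π' μ' ∧
      concat (juxt π π') (juxt μ μ') = juxt (concat π μ) (concat π' μ') := by
  classical
  refine concat_of_count fun T _ u w => ?_
  simp only [compat_juxt]
  rw [show (if Compat (concat π μ) (u ∘ Sum.inl) (w ∘ Sum.inl) ∧
      Compat (concat π' μ') (u ∘ Sum.inr) (w ∘ Sum.inr) then
      Nat.card T ^ (loops π μ + loops π' μ') else 0) =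
      (if Compat (concat π μ) (u ∘ Sum.inl) (w ∘ Sum.inl) then Nat.card T ^ loops π μ else 0) *
      (if Compat (concat π' μ') (u ∘ Sum.inr) (w ∘ Sum.inr) then Nat.card T ^ loops π' μ' else 0)
      by rw [pow_add]; split_ifs <;> simp_all, ← card_compat, ← card_compat, ← Nat.card_prod]
  refine Nat.card_congr
    { toFun := fun v => ⟨⟨v.1 ∘ Sum.inl, v.2.1.1, v.2.2.1⟩, ⟨v.1 ∘ Sum.inr, v.2.1.2, v.2.2.2⟩⟩
      invFun := fun v => ⟨Sum.elim v.1.1 v.2.1, ⟨v.1.2.1, v.2.2.1⟩, ⟨v.1.2.2, v.2.2.2⟩⟩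
      left_inv := fun v => Subtype.ext (Sum.elim_comp_inl_inr v.1)
      right_inv := fun v => rfl }

theorem juxt_bij {U V U' V' : Type} (e : U ≃ V) (e' : U' ≃ V') :
    juxt (bijDiagram e) (bijDiagram e') = bijDiagram (e.sumCongr e') := by
  have hq : ∀ x y, (Quotient.mk (bijDiagram e) x = Quotient.mk (bijDiagram e) y) ↔
      Sum.elim e id x = Sum.elim e id y := fun x y => Quotient.eq
  have hq' : ∀ x y, (Quotient.mk (bijDiagram e') x = Quotient.mk (bijDiagram e') y) ↔
      Sum.elim e' id x = Sum.elim e' id y := fun x y => Quotient.eq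
  ext x y
  rw [juxt, bijDiagram.eq_1 (e.sumCongr e'), Setoid.ker_def, Setoid.ker_def]
  rcases x with (x | x) | (x | x) <;> rcases y with (y | y) | (y | y) <;> simp [hq, hq']

theorem juxt_assoc {U V U' V' U'' V'' : Type} (π : Setoid (U ⊕ V)) (μ : Setoid (U' ⊕ V'))
    (ν : Setoid (U'' ⊕ V'')) :
    (juxt (juxt π μ) ν).comap (Sum.map id (Equiv.sumAssoc V V' V'').symm) =
      (juxt π (juxt μ ν)).comap (Sum.map (Equiv.sumAssoc U U' U'') id) := by
  refine eq_of_le_iff fun T u v => ?_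
  rw [compat_comap_left, compat_comap_right, compat_juxt, compat_juxt, compat_juxt, compat_juxt,
    and_assoc]
  rfl

theorem juxt_comm {U V U' V' : Type} (π : Setoid (U ⊕ V)) (μ : Setoid (U' ⊕ V')) :
    (juxt π μ).comap (Sum.map id (Equiv.sumComm V V').symm) =
      (juxt μ π).comap (Sum.map (Equiv.sumComm U U') id) := by
  refine eq_of_le_iff fun T u v => ?_
  rw [compat_comap_left, compat_comap_right, compat_juxt, compat_juxt, and_comm]
  rfl

theorem juxt_empty_left {U V : Type} (ρ : Setoid (Empty ⊕ Empty)) (π : Setoid (U ⊕ V)) :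
    (juxt ρ π).comap (Sum.map id (Equiv.emptySum Empty V).symm) =
      π.comap (Sum.map (Equiv.emptySum Empty U) id) := by
  refine eq_of_le_iff fun T u v => ?_
  rw [compat_comap_left, compat_comap_right, compat_juxt]
  refine ⟨fun h => h.2, fun h => ⟨?_, h⟩⟩
  rintro (x | x) <;> exact x.elim

theorem juxt_empty_right {U V : Type} (ρ : Setoid (Empty ⊕ Empty)) (π : Setoid (U ⊕ V)) :
    (juxt π ρ).comap (Sum.map id (Equiv.sumEmpty V Empty).symm) =
      π.comap (Sum.map (Equiv.sumEmpty U Empty) id) := by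
  refine eq_of_le_iff fun T u v => ?_
  rw [compat_comap_left, compat_comap_right, compat_juxt]
  refine ⟨fun h => h.1, fun h => ⟨h, ?_⟩⟩
  rintro (x | x) <;> exact x.elim

/-- The two zigzag identities for the cup and cap diagrams. -/
theorem zigzag_left (U : Type) [Finite U] :
    loops (juxt (bijDiagram (Equiv.refl U)) (cupDiagram U))
      ((juxt (capDiagram U) (bijDiagram (Equiv.refl U))).comap
        (Sum.map (Equiv.sumAssoc U U U).symm id)) = 0 ∧
    concat (juxt (bijDiagram (Equiv.refl U)) (cupDiagram U))
      ((juxt (capDiagram U) (bijDiagram (Equiv.refl U))).comap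
        (Sum.map (Equiv.sumAssoc U U U).symm id)) =
      bijDiagram ((Equiv.sumEmpty U Empty).trans (Equiv.emptySum Empty U).symm) := by
  refine concat_of_count fun T _ u w => ?_
  refine count_unique (a := Sum.elim (u ∘ Sum.inl) (Sum.elim (u ∘ Sum.inl) (u ∘ Sum.inl))) _
    fun v => ?_
  rw [compat_comap_left, compat_juxt, compat_juxt, compat_bij, compat_bij, compat_bij, compat_cup,
    compat_cap]
  simp only [funext_iff, Function.comp_apply, Sum.forall, Equiv.refl_apply, Equiv.symm_symm,
    Equiv.sumAssoc_apply_inl_inl, Equiv.sumAssoc_apply_inl_inr, Equiv.sumAssoc_apply_inr,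
    Sum.elim_inl, Sum.elim_inr, Equiv.trans_apply, Equiv.sumEmpty_apply_inl,
    Equiv.emptySum_symm_apply, IsEmpty.forall_iff, and_true]
  grind

theorem zigzag_right (U : Type) [Finite U] :
    loops (juxt (cupDiagram U) (bijDiagram (Equiv.refl U)))
      ((juxt (bijDiagram (Equiv.refl U)) (capDiagram U)).comap
        (Sum.map (Equiv.sumAssoc U U U) id)) = 0 ∧
    concat (juxt (cupDiagram U) (bijDiagram (Equiv.refl U)))
      ((juxt (bijDiagram (Equiv.refl U)) (capDiagram U)).comap
        (Sum.map (Equiv.sumAssoc U U U) id)) =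
      bijDiagram ((Equiv.emptySum Empty U).trans (Equiv.sumEmpty U Empty).symm) := by
  refine concat_of_count fun T _ u w => ?_
  refine count_unique (a := Sum.elim (Sum.elim (u ∘ Sum.inr) (u ∘ Sum.inr)) (u ∘ Sum.inr)) _
    fun v => ?_
  rw [compat_comap_left, compat_juxt, compat_juxt, compat_bij, compat_bij, compat_bij, compat_cup,
    compat_cap]
  simp only [funext_iff, Function.comp_apply, Sum.forall, Equiv.refl_apply,
    Equiv.sumAssoc_symm_apply_inl, Equiv.sumAssoc_symm_apply_inr_inl,
    Equiv.sumAssoc_symm_apply_inr_inr,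
    Sum.elim_inl, Sum.elim_inr, Equiv.trans_apply, Equiv.emptySum_apply_inr,
    Equiv.sumEmpty_symm_apply, IsEmpty.forall_iff, true_and]
  grind

/-! ### The skeletal category of partition diagrams -/

universe u

/-- Bilinear extension of a product of basis elements `(a, b) ↦ c a b • φ a b`. -/
def bilinExt {F : Type u} [Field F] {A B C : Type} (φ : A → B → C) (c : A → B → F)
    (f : A →₀ F) (g : B →₀ F) : C →₀ F :=
  f.sum fun a x => g.sum fun b y => Finsupp.single (φ a b) (x * y * c a b)

section bilinExt

variable {F : Type u} [Field F] {A B C : Type} (φ : A → B → C) (c : A → B → F)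

theorem bilinExt_single (a : A) (b : B) (x y : F) :
    bilinExt φ c (Finsupp.single a x) (Finsupp.single b y) =
      Finsupp.single (φ a b) (x * y * c a b) := by
  simp [bilinExt]

theorem bilinExt_zero_left (g : B →₀ F) : bilinExt φ c 0 g = 0 := by
  simp [bilinExt]

theorem bilinExt_zero_right (f : A →₀ F) : bilinExt φ c f 0 = 0 := by
  simp [bilinExt]

theorem bilinExt_add_left (f f' : A →₀ F) (g : B →₀ F) :
    bilinExt φ c (f + f') g = bilinExt φ c f g + bilinExt φ c f' g := by
  unfold bilinExt
  refine Finsupp.sum_add_index' (by simp) fun a x x' => ?_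
  rw [← Finsupp.sum_add]
  simp [add_mul]

theorem bilinExt_add_right (f : A →₀ F) (g g' : B →₀ F) :
    bilinExt φ c f (g + g') = bilinExt φ c f g + bilinExt φ c f g' := by
  unfold bilinExt
  rw [← Finsupp.sum_add]
  refine Finsupp.sum_congr fun a _ => ?_
  exact Finsupp.sum_add_index' (by simp) fun b y y' => by simp [mul_add, add_mul]

theorem bilinExt_smul_left (r : F) (f : A →₀ F) (g : B →₀ F) :
    bilinExt φ c (r • f) g = r • bilinExt φ c f g := by
  induction f using Finsupp.induction_linear with
  | zero => simp [bilinExt_zero_left]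
  | add f f' h h' => rw [smul_add, bilinExt_add_left, h, h', bilinExt_add_left, smul_add]
  | single a x =>
    induction g using Finsupp.induction_linear with
    | zero => simp [bilinExt_zero_right]
    | add f f' h h' => rw [bilinExt_add_right, h, h', bilinExt_add_right, smul_add]
    | single b y =>
      rw [Finsupp.smul_single, bilinExt_single, bilinExt_single, Finsupp.smul_single]
      simp only [smul_eq_mul, mul_assoc]

theorem bilinExt_smul_right (r : F) (f : A →₀ F) (g : B →₀ F) :
    bilinExt φ c f (r • g) = r • bilinExt φ c f g := by
  induction f using Finsupp.induction_linear with
  | zero => simp [bilinExt_zero_left]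
  | add f f' h h' => rw [bilinExt_add_left, h, h', bilinExt_add_left, smul_add]
  | single a x =>
    induction g using Finsupp.induction_linear with
    | zero => simp [bilinExt_zero_right]
    | add f f' h h' => rw [smul_add, bilinExt_add_right, h, h', bilinExt_add_right, smul_add]
    | single b y =>
      rw [Finsupp.smul_single, bilinExt_single, bilinExt_single, Finsupp.smul_single]
      simp only [smul_eq_mul, mul_assoc, mul_left_comm]

end bilinExt

end Deligne

namespace Deligne

universe u

/-- The objects of the skeleton `Rep₀(S_t)`: finite sets. The finite set `{1, …, n}` is the object
usually written `[n]`. -/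
structure Rep0 (F : Type u) [Field F] (t : F) where
  carrier : Type
  [finite : Finite carrier]

attribute [instance] Rep0.finite

variable {F : Type u} [Field F] {t : F}

namespace Rep0

/-- Morphisms `U ⟶ V` are formal `F`-linear combinations of partition diagrams. Concatenating
vertically, each block in the middle row contributes a factor `t`. -/
instance : Category.{u} (Rep0 F t) where
  Hom U V := Setoid (U.carrier ⊕ V.carrier) →₀ F
  id U := Finsupp.single (bijDiagram (Equiv.refl U.carrier)) 1
  comp f g := bilinExt concat (fun π μ => t ^ loops π μ) f g
  id_comp {U V} f := by
    induction f using Finsupp.induction_linear with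
    | zero => exact bilinExt_zero_right _ _ _
    | add f f' h h' => rw [bilinExt_add_right, h, h']
    | single π a =>
      rw [bilinExt_single, (bij_concat _ _).1, (bij_concat _ _).2]
      have : π.comap (Sum.map (Equiv.refl U.carrier) id) = π := by
        ext x y; simp [Setoid.comap_rel]
      rw [this]
      simp
  comp_id {U V} f := by
    induction f using Finsupp.induction_linear with
    | zero => exact bilinExt_zero_left _ _ _
    | add f f' h h' => rw [bilinExt_add_left, h, h']
    | single π a =>
      rw [bilinExt_single, (concat_bij _ _).1, (concat_bij _ _).2]
      have : π.comap (Sum.map id (Equiv.refl V.carrier).symm) = π := by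
        ext x y; simp [Setoid.comap_rel]
      rw [this]
      simp
  assoc f g h := by
    induction f using Finsupp.induction_linear with
    | zero => simp only [bilinExt_zero_left]
    | add f f' h h' => simp only [bilinExt_add_left, h, h']
    | single π a =>
      induction g using Finsupp.induction_linear with
      | zero => simp only [bilinExt_zero_left, bilinExt_zero_right]
      | add f f' h h' => simp only [bilinExt_add_left, bilinExt_add_right, h, h']
      | single μ b =>
        induction h using Finsupp.induction_linear with
        | zero => simp only [bilinExt_zero_right]
        | add f f' h h' => simp only [bilinExt_add_right, h, h']
        | single ν c =>
          simp only [bilinExt_single]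
          rw [(concat_assoc π μ ν).2]
          congr 1
          have := congrArg (t ^ ·) (concat_assoc π μ ν).1
          simp only [pow_add] at this
          linear_combination a * b * c * this

instance : Preadditive (Rep0 F t) where
  homGroup U V := inferInstanceAs (AddCommGroup (Setoid (U.carrier ⊕ V.carrier) →₀ F))
  add_comp _ _ _ f f' g := bilinExt_add_left _ _ f f' g
  comp_add _ _ _ f g g' := bilinExt_add_right _ _ f g g'

instance : Linear F (Rep0 F t) where
  homModule U V := inferInstanceAs (Module F (Setoid (U.carrier ⊕ V.carrier) →₀ F))
  smul_comp _ _ _ r f g := bilinExt_smul_left _ _ r f g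
  comp_smul _ _ _ f r g := bilinExt_smul_right _ _ r f g

/-- A scalar multiple of a partition diagram, as a morphism. -/
def diag {U V : Rep0 F t} (π : Setoid (U.carrier ⊕ V.carrier)) (a : F) : U ⟶ V :=
  Finsupp.single π a

/-- The morphism given by the diagram of a bijection. -/
def bij {U V : Rep0 F t} (e : U.carrier ≃ V.carrier) : U ⟶ V := diag (bijDiagram e) 1

theorem hom_induction {U V : Rep0 F t} {p : (U ⟶ V) → Prop} (f : U ⟶ V) (zero : p 0)
    (add : ∀ f g, p f → p g → p (f + g)) (single : ∀ π a, p (diag π a)) : p f :=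
  Finsupp.induction_linear f zero add single

theorem diag_comp {U V W : Rep0 F t} (π : Setoid (U.carrier ⊕ V.carrier))
    (μ : Setoid (V.carrier ⊕ W.carrier)) (a b : F) :
    (diag π a : U ⟶ V) ≫ (diag μ b : V ⟶ W) = diag (concat π μ) (a * b * t ^ loops π μ) :=
  bilinExt_single _ _ _ _ _ _

theorem bij_comp_diag {U V W : Rep0 F t} (e : U.carrier ≃ V.carrier)
    (μ : Setoid (V.carrier ⊕ W.carrier)) (b : F) :
    (bij e : U ⟶ V) ≫ (diag μ b : V ⟶ W) = diag (μ.comap (Sum.map e id)) b := by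
  rw [bij, diag_comp, (bij_concat _ _).1, (bij_concat _ _).2]
  simp

theorem diag_comp_bij {U V W : Rep0 F t} (π : Setoid (U.carrier ⊕ V.carrier))
    (e : V.carrier ≃ W.carrier) (a : F) :
    (diag π a : U ⟶ V) ≫ (bij e : V ⟶ W) = diag (π.comap (Sum.map id e.symm)) a := by
  rw [bij, diag_comp, (concat_bij _ _).1, (concat_bij _ _).2]
  simp

theorem bij_comp_bij {U V W : Rep0 F t} (e : U.carrier ≃ V.carrier) (e' : V.carrier ≃ W.carrier) :
    (bij e : U ⟶ V) ≫ (bij e' : V ⟶ W) = bij (e.trans e') := by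
  conv_lhs => rhs; rw [bij]
  rw [bij_comp_diag, bij]
  congr 1
  ext x y
  rw [Setoid.comap_rel, bijDiagram, bijDiagram, Setoid.ker_def, Setoid.ker_def]
  rcases x with x | x <;> rcases y with y | y <;> rfl

theorem bij_refl {U : Rep0 F t} : bij (Equiv.refl U.carrier) = 𝟙 U := rfl

/-- The isomorphism given by a bijection. -/
def bijIso {U V : Rep0 F t} (e : U.carrier ≃ V.carrier) : U ≅ V where
  hom := bij e
  inv := bij e.symm
  hom_inv_id := by rw [bij_comp_bij, Equiv.self_trans_symm, bij_refl]
  inv_hom_id := by rw [bij_comp_bij, Equiv.symm_trans_self, bij_refl]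

/-- Tensor product of objects: disjoint union. -/
abbrev tensor (U V : Rep0 F t) : Rep0 F t := ⟨U.carrier ⊕ V.carrier⟩

/-- Tensor product of morphisms: bilinear extension of horizontal concatenation. -/
def tensorMap {U V U' V' : Rep0 F t} (f : U ⟶ V) (g : U' ⟶ V') : tensor U U' ⟶ tensor V V' :=
  bilinExt juxt (fun _ _ => 1) f g

section tensorMap

variable {U V U' V' : Rep0 F t}

theorem tensorMap_diag (π : Setoid (U.carrier ⊕ V.carrier)) (μ : Setoid (U'.carrier ⊕ V'.carrier))
    (a b : F) : tensorMap (diag π a) (diag μ b) = diag (juxt π μ) (a * b) := by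
  refine (bilinExt_single _ _ _ _ _ _).trans ?_
  rw [mul_one]; rfl

theorem tensorMap_add_left (f f' : U ⟶ V) (g : U' ⟶ V') :
    tensorMap (f + f') g = tensorMap f g + tensorMap f' g := bilinExt_add_left _ _ f f' g

theorem tensorMap_add_right (f : U ⟶ V) (g g' : U' ⟶ V') :
    tensorMap f (g + g') = tensorMap f g + tensorMap f g' := bilinExt_add_right _ _ f g g'

theorem tensorMap_zero_left (g : U' ⟶ V') : tensorMap (0 : U ⟶ V) g = 0 :=
  bilinExt_zero_left _ _ g

theorem tensorMap_zero_right (f : U ⟶ V) : tensorMap f (0 : U' ⟶ V') = 0 :=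
  bilinExt_zero_right _ _ f

theorem tensorMap_bij (e : U.carrier ≃ V.carrier) (e' : U'.carrier ≃ V'.carrier) :
    tensorMap (bij e) (bij e') = bij (e.sumCongr e') := by
  rw [bij, bij, tensorMap_diag, juxt_bij, mul_one]; rfl

end tensorMap

theorem tensorMap_comp {U V W U' V' W' : Rep0 F t} (f : U ⟶ V) (f' : U' ⟶ V') (g : V ⟶ W)
    (g' : V' ⟶ W') : tensorMap f f' ≫ tensorMap g g' = tensorMap (f ≫ g) (f' ≫ g') := by
  induction f using hom_induction with
  | zero => simp only [tensorMap_zero_left, Limits.zero_comp]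
  | add f₁ f₂ h₁ h₂ => simp only [tensorMap_add_left, Preadditive.add_comp, h₁, h₂]
  | single π a =>
  induction f' using hom_induction with
  | zero => simp only [tensorMap_zero_right, Limits.zero_comp]
  | add f₁ f₂ h₁ h₂ => simp only [tensorMap_add_right, Preadditive.add_comp, h₁, h₂]
  | single π' a' =>
  induction g using hom_induction with
  | zero => simp only [tensorMap_zero_left, Limits.comp_zero]
  | add f₁ f₂ h₁ h₂ => simp only [tensorMap_add_left, Preadditive.comp_add, h₁, h₂]
  | single μ b =>
  induction g' using hom_induction with
  | zero => simp only [tensorMap_zero_right, Limits.comp_zero]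
  | add f₁ f₂ h₁ h₂ => simp only [tensorMap_add_right, Preadditive.comp_add, h₁, h₂]
  | single μ' b' =>
    rw [tensorMap_diag, tensorMap_diag, diag_comp, diag_comp, diag_comp, tensorMap_diag,
      (juxt_concat _ _ _ _).1, (juxt_concat _ _ _ _).2]
    congr 1
    rw [pow_add]
    ring

/-- The empty row of vertices. -/
abbrev unit : Rep0 F t := ⟨Empty⟩

/-- The associativity constraint. -/
abbrev assocIso (U V W : Rep0 F t) : tensor (tensor U V) W ≅ tensor U (tensor V W) :=
  bijIso (Equiv.sumAssoc U.carrier V.carrier W.carrier)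

/-- The left unit constraint. -/
abbrev leftIso (U : Rep0 F t) : tensor unit U ≅ U := bijIso (Equiv.emptySum Empty U.carrier)

/-- The right unit constraint. -/
abbrev rightIso (U : Rep0 F t) : tensor U unit ≅ U := bijIso (Equiv.sumEmpty U.carrier Empty)

/-- The braiding: the two groups of vertices are interchanged. -/
abbrev swapIso (U V : Rep0 F t) : tensor U V ≅ tensor V U :=
  bijIso (Equiv.sumComm U.carrier V.carrier)

/-- Coevaluation: the diagram with blocks the pairs of corresponding vertices. -/
def coev (U : Rep0 F t) : unit ⟶ tensor U U := diag (cupDiagram U.carrier) 1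

/-- Evaluation: the diagram with blocks the pairs of corresponding vertices. -/
def ev (U : Rep0 F t) : tensor U U ⟶ unit := diag (capDiagram U.carrier) 1

theorem assoc_nat {U V U' V' U'' V'' : Rep0 F t} (f₁ : U ⟶ V) (f₂ : U' ⟶ V') (f₃ : U'' ⟶ V'') :
    tensorMap (tensorMap f₁ f₂) f₃ ≫ (assocIso V V' V'').hom =
      (assocIso U U' U'').hom ≫ tensorMap f₁ (tensorMap f₂ f₃) := by
  dsimp only [assocIso, bijIso]
  induction f₁ using hom_induction with
  | zero => simp only [tensorMap_zero_left, Limits.zero_comp, Limits.comp_zero]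
  | add f₁ f₂ h₁ h₂ =>
    simp only [tensorMap_add_left, Preadditive.add_comp, Preadditive.comp_add, h₁, h₂]
  | single π a =>
  induction f₂ using hom_induction with
  | zero => simp only [tensorMap_zero_left, tensorMap_zero_right, Limits.zero_comp,
      Limits.comp_zero]
  | add f₁ f₂ h₁ h₂ => simp only [tensorMap_add_left, tensorMap_add_right, Preadditive.add_comp,
      Preadditive.comp_add, h₁, h₂]
  | single π a =>
  induction f₃ using hom_induction with
  | zero => simp only [tensorMap_zero_right, Limits.zero_comp, Limits.comp_zero]
  | add f₁ f₂ h₁ h₂ =>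
    simp only [tensorMap_add_right, Preadditive.add_comp, Preadditive.comp_add, h₁, h₂]
  | single π a =>
    simp only [tensorMap_diag]
    rw [diag_comp_bij, bij_comp_diag, mul_assoc]
    congr 1
    refine juxt_assoc _ _ _

theorem left_nat {U V : Rep0 F t} (f : U ⟶ V) :
    tensorMap (𝟙 unit) f ≫ (leftIso V).hom = (leftIso U).hom ≫ f := by
  dsimp only [leftIso, bijIso]
  induction f using hom_induction with
  | zero => simp only [tensorMap_zero_right, Limits.zero_comp, Limits.comp_zero]
  | add f₁ f₂ h₁ h₂ =>
    simp only [tensorMap_add_right, Preadditive.add_comp, Preadditive.comp_add, h₁, h₂]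
  | single π a =>
    rw [← bij_refl, bij, tensorMap_diag, diag_comp_bij, bij_comp_diag, one_mul]
    congr 1
    exact juxt_empty_left _ _

theorem right_nat {U V : Rep0 F t} (f : U ⟶ V) :
    tensorMap f (𝟙 unit) ≫ (rightIso V).hom = (rightIso U).hom ≫ f := by
  dsimp only [rightIso, bijIso]
  induction f using hom_induction with
  | zero => simp only [tensorMap_zero_left, Limits.zero_comp, Limits.comp_zero]
  | add f₁ f₂ h₁ h₂ =>
    simp only [tensorMap_add_left, Preadditive.add_comp, Preadditive.comp_add, h₁, h₂]
  | single π a =>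
    rw [← bij_refl, bij, tensorMap_diag, diag_comp_bij, bij_comp_diag, mul_one]
    congr 1
    exact juxt_empty_right _ _

theorem swap_nat {U V U' V' : Rep0 F t} (f : U ⟶ V) (f' : U' ⟶ V') :
    tensorMap f f' ≫ (swapIso V V').hom = (swapIso U U').hom ≫ tensorMap f' f := by
  dsimp only [swapIso, bijIso]
  induction f using hom_induction with
  | zero => simp only [tensorMap_zero_left, tensorMap_zero_right, Limits.zero_comp,
      Limits.comp_zero]
  | add f₁ f₂ h₁ h₂ => simp only [tensorMap_add_left, tensorMap_add_right, Preadditive.add_comp,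
      Preadditive.comp_add, h₁, h₂]
  | single π a =>
  induction f' using hom_induction with
  | zero => simp only [tensorMap_zero_left, tensorMap_zero_right, Limits.zero_comp,
      Limits.comp_zero]
  | add f₁ f₂ h₁ h₂ => simp only [tensorMap_add_left, tensorMap_add_right, Preadditive.add_comp,
      Preadditive.comp_add, h₁, h₂]
  | single μ b =>
    rw [tensorMap_diag, diag_comp_bij, tensorMap_diag, bij_comp_diag, mul_comm]
    congr 1
    exact juxt_comm _ _

theorem id_tensor_id (U V : Rep0 F t) : tensorMap (𝟙 U) (𝟙 V) = 𝟙 (tensor U V) := by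
  rw [← bij_refl, ← bij_refl, tensorMap_bij, Equiv.sumCongr_refl, ← bij_refl]

theorem pentagon_eq (W X Y Z : Rep0 F t) :
    tensorMap (assocIso W X Y).hom (𝟙 Z) ≫ (assocIso W (tensor X Y) Z).hom ≫
      tensorMap (𝟙 W) (assocIso X Y Z).hom =
    (assocIso (tensor W X) Y Z).hom ≫ (assocIso W X (tensor Y Z)).hom := by
  rw [← bij_refl, ← bij_refl]
  dsimp only [assocIso, bijIso]
  simp only [tensorMap_bij, bij_comp_bij]
  congr 1
  ext x
  rcases x with ((x | x) | x) | x <;> rfl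

theorem triangle_eq (X Y : Rep0 F t) :
    (assocIso X unit Y).hom ≫ tensorMap (𝟙 X) (leftIso Y).hom =
      tensorMap (rightIso X).hom (𝟙 Y) := by
  rw [← bij_refl, ← bij_refl]
  dsimp only [assocIso, leftIso, rightIso, bijIso]
  simp only [tensorMap_bij, bij_comp_bij]
  congr 1
  ext x
  rcases x with (x | x) | x
  · rfl
  · exact x.elim
  · rfl

theorem hexagon_eq (X Y Z : Rep0 F t) :
    (assocIso X Y Z).hom ≫ (swapIso X (tensor Y Z)).hom ≫ (assocIso Y Z X).hom =
      tensorMap (swapIso X Y).hom (𝟙 Z) ≫ (assocIso Y X Z).hom ≫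
        tensorMap (𝟙 Y) (swapIso X Z).hom := by
  rw [← bij_refl, ← bij_refl]
  dsimp only [assocIso, swapIso, bijIso]
  simp only [tensorMap_bij, bij_comp_bij]
  congr 1
  ext x
  rcases x with (x | x) | x <;> rfl

theorem hexagon_eq' (X Y Z : Rep0 F t) :
    (assocIso X Y Z).inv ≫ (swapIso (tensor X Y) Z).hom ≫ (assocIso Z X Y).inv =
      tensorMap (𝟙 X) (swapIso Y Z).hom ≫ (assocIso X Z Y).inv ≫
        tensorMap (swapIso X Z).hom (𝟙 Y) := by
  rw [← bij_refl, ← bij_refl]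
  dsimp only [assocIso, swapIso, bijIso]
  simp only [tensorMap_bij, bij_comp_bij]
  congr 1
  ext x
  rcases x with x | (x | x) <;> rfl

theorem swap_swap (X Y : Rep0 F t) : (swapIso X Y).hom ≫ (swapIso Y X).hom = 𝟙 (tensor X Y) := by
  dsimp only [swapIso, bijIso]
  rw [bij_comp_bij, ← bij_refl]
  congr 1
  ext x
  rcases x with x | x <;> rfl

theorem snake_left (U : Rep0 F t) :
    tensorMap (𝟙 U) (coev U) ≫ (assocIso U U U).inv ≫ tensorMap (ev U) (𝟙 U) =
      (rightIso U).hom ≫ (leftIso U).inv := by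
  rw [← bij_refl]
  dsimp only [assocIso, leftIso, rightIso, bijIso]
  rw [bij_comp_bij, bij, coev, ev, tensorMap_diag, tensorMap_diag, bij_comp_diag, diag_comp]
  rw [(zigzag_left U.carrier).1, (zigzag_left U.carrier).2]
  simp [bij]

theorem snake_right (U : Rep0 F t) :
    tensorMap (coev U) (𝟙 U) ≫ (assocIso U U U).hom ≫ tensorMap (𝟙 U) (ev U) =
      (leftIso U).hom ≫ (rightIso U).inv := by
  rw [← bij_refl]
  dsimp only [assocIso, leftIso, rightIso, bijIso]
  rw [bij_comp_bij, bij, coev, ev, tensorMap_diag, tensorMap_diag, bij_comp_diag, diag_comp]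
  rw [(zigzag_right U.carrier).1, (zigzag_right U.carrier).2]
  simp [bij]

instance : MonoidalCategoryStruct (Rep0 F t) where
  tensorObj := tensor
  tensorUnit := unit
  tensorHom f g := tensorMap f g
  whiskerLeft U _ _ g := tensorMap (𝟙 U) g
  whiskerRight f U := tensorMap f (𝟙 U)
  associator U V W := assocIso U V W
  leftUnitor U := leftIso U
  rightUnitor U := rightIso U

instance : MonoidalCategory (Rep0 F t) := .ofTensorHom
  (id_tensorHom_id := id_tensor_id)
  (id_tensorHom := fun _ _ _ _ => rfl)
  (tensorHom_id := fun _ _ => rfl)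
  (tensorHom_comp_tensorHom := tensorMap_comp)
  (associator_naturality := assoc_nat)
  (leftUnitor_naturality := left_nat)
  (rightUnitor_naturality := right_nat)
  (pentagon := pentagon_eq)
  (triangle := triangle_eq)

instance : MonoidalPreadditive (Rep0 F t) where
  whiskerLeft_zero := tensorMap_zero_right _
  zero_whiskerRight := tensorMap_zero_left _
  whiskerLeft_add f g := tensorMap_add_right _ f g
  add_whiskerRight f g := tensorMap_add_left f g _

instance : SymmetricCategory (Rep0 F t) where
  braiding U V := swapIso U V
  braiding_naturality_right U _ _ f := swap_nat (𝟙 U) f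
  braiding_naturality_left f U := swap_nat f (𝟙 U)
  hexagon_forward := hexagon_eq
  hexagon_reverse := hexagon_eq'
  symmetry := swap_swap

/-- Every object is its own dual. -/
instance exactPairing (U : Rep0 F t) : ExactPairing U U where
  coevaluation' := coev U
  evaluation' := ev U
  coevaluation_evaluation' := snake_left U
  evaluation_coevaluation' := snake_right U

instance : RightRigidCategory (Rep0 F t) where
  rightDual U := { rightDual := U, exact := exactPairing U }

end Rep0

end Deligne

namespace Deligne

/-! ### Tensor structure on the additive envelope -/

universe v₁ u₁

variable {C : Type u₁} [Category.{v₁} C] [Preadditive C]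

instance matLinear {F : Type*} [Field F] [Linear F C] : Linear F (Mat_ C) where
  homModule M N := inferInstanceAs (Module F (∀ (i : M.ι) (j : N.ι), M.X i ⟶ N.X j))
  smul_comp M N K r f g := by
    apply Mat_.hom_ext
    intro i k
    change ∑ j, (r • f i j) ≫ g j k = r • ∑ j, f i j ≫ g j k
    simp only [Linear.smul_comp, Finset.smul_sum]
  comp_smul M N K f r g := by
    apply Mat_.hom_ext
    intro i k
    change ∑ j, f i j ≫ (r • g j k) = r • ∑ j, f i j ≫ g j k
    simp only [Linear.comp_smul, Finset.smul_sum]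

namespace MatTensor

/-- The entries of a matrix. -/
def ent {M N : Mat_ C} (f : M ⟶ N) (i : M.ι) (j : N.ι) : M.X i ⟶ N.X j := f i j

/-- The matrix with given entries. -/
def ofEnt {M N : Mat_ C} (f : ∀ i j, M.X i ⟶ N.X j) : M ⟶ N := f

theorem ent_ofEnt {M N : Mat_ C} (f : ∀ i j, M.X i ⟶ N.X j) (i : M.ι) (j : N.ι) :
    ent (ofEnt f) i j = f i j := rfl

theorem ent_ext {M N : Mat_ C} {f g : M ⟶ N} (h : ∀ i j, ent f i j = ent g i j) : f = g :=
  Mat_.hom_ext f g h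

theorem ent_comp {M N K : Mat_ C} (f : M ⟶ N) (g : N ⟶ K) (i : M.ι) (k : K.ι) :
    ent (f ≫ g) i k = ∑ j, ent f i j ≫ ent g j k := rfl

theorem ent_id_self (M : Mat_ C) (i : M.ι) : ent (𝟙 M) i i = 𝟙 (M.X i) := Mat_.id_apply_self M i

theorem ent_id_ne (M : Mat_ C) {i j : M.ι} (h : i ≠ j) : ent (𝟙 M) i j = 0 :=
  Mat_.id_apply_of_ne M i j h

open scoped Classical in
/-- The matrix with entries `φ i` in the positions `(i, e i)`. -/
def diagHom {M N : Mat_ C} (e : M.ι → N.ι) (φ : ∀ i, M.X i ⟶ N.X (e i)) : M ⟶ N :=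
  ofEnt fun i j => if h : e i = j then φ i ≫ eqToHom (congrArg N.X h) else 0

theorem diagHom_self {M N : Mat_ C} (e : M.ι → N.ι) (φ : ∀ i, M.X i ⟶ N.X (e i)) (i : M.ι) :
    ent (diagHom e φ) i (e i) = φ i := by
  rw [diagHom, ent_ofEnt, dif_pos rfl, eqToHom_refl, Category.comp_id]

theorem diagHom_ne {M N : Mat_ C} (e : M.ι → N.ι) (φ : ∀ i, M.X i ⟶ N.X (e i)) {i : M.ι}
    {j : N.ι} (h : e i ≠ j) : ent (diagHom e φ) i j = 0 := dif_neg h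

theorem diagHom_comp_apply {M N K : Mat_ C} (e : M.ι → N.ι) (φ : ∀ i, M.X i ⟶ N.X (e i))
    (f : N ⟶ K) (i : M.ι) (k : K.ι) : ent (diagHom e φ ≫ f) i k = φ i ≫ ent f (e i) k := by
  rw [ent_comp, Finset.sum_eq_single (e i)]
  · rw [diagHom_self]
  · intro j _ hj
    rw [diagHom_ne e φ (Ne.symm hj), Limits.zero_comp]
  · intro h
    exact absurd (Finset.mem_univ _) h

theorem comp_diagHom_apply {M N K : Mat_ C} (f : M ⟶ N) (e : N.ι → K.ι) (he : e.Injective)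
    (φ : ∀ i, N.X i ⟶ K.X (e i)) (i : M.ι) (k : N.ι) :
    ent (f ≫ diagHom e φ) i (e k) = ent f i k ≫ φ k := by
  rw [ent_comp, Finset.sum_eq_single k]
  · rw [diagHom_self]
  · intro j _ hj
    rw [diagHom_ne e φ (fun h => hj (he h)), Limits.comp_zero]
  · intro h
    exact absurd (Finset.mem_univ _) h

theorem diagHom_comp {M N K : Mat_ C} (e : M.ι → N.ι) (φ : ∀ i, M.X i ⟶ N.X (e i))
    (e' : N.ι → K.ι) (φ' : ∀ i, N.X i ⟶ K.X (e' i)) :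
    diagHom e φ ≫ diagHom e' φ' = diagHom (fun i => e' (e i)) (fun i => φ i ≫ φ' (e i)) := by
  apply ent_ext
  intro i k
  rw [diagHom_comp_apply]
  by_cases h : e' (e i) = k
  · subst h
    rw [diagHom_self]
    exact (diagHom_self (fun i => e' (e i)) (fun i => φ i ≫ φ' (e i)) i).symm
  · rw [diagHom_ne _ _ h, Limits.comp_zero]
    exact (diagHom_ne (fun i => e' (e i)) (fun i => φ i ≫ φ' (e i)) h).symm

theorem diagHom_id (M : Mat_ C) : diagHom (fun i => i) (fun i => 𝟙 (M.X i)) = 𝟙 M := by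
  apply ent_ext
  intro i j
  by_cases h : i = j
  · subst h
    rw [ent_id_self]
    exact diagHom_self (fun i => i) (fun i => 𝟙 (M.X i)) i
  · rw [ent_id_ne _ h]
    exact diagHom_ne (fun i => i) (fun i => 𝟙 (M.X i)) h

theorem diagHom_congr {M N : Mat_ C} (e : M.ι → N.ι) {φ φ' : ∀ i, M.X i ⟶ N.X (e i)}
    (h : ∀ i, φ i = φ' i) : diagHom e φ = diagHom e φ' := by
  rw [funext h]

variable [MonoidalCategory C]

/-- Tensor product of tuples. -/
abbrev tensor (M N : Mat_ C) : Mat_ C := ⟨M.ι × N.ι, fun p => M.X p.1 ⊗ N.X p.2⟩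

/-- The unit: the one-term tuple of the unit. -/
abbrev unit : Mat_ C := ⟨PUnit, fun _ => 𝟙_ C⟩

/-- Tensor product (Kronecker product) of matrices. -/
def tensorMap {M N M' N' : Mat_ C} (f : M ⟶ N) (g : M' ⟶ N') : tensor M M' ⟶ tensor N N' :=
  ofEnt fun p q => ent f p.1 q.1 ⊗ₘ ent g p.2 q.2

theorem tensorMap_apply {M N M' N' : Mat_ C} (f : M ⟶ N) (g : M' ⟶ N') (i j i' j') :
    ent (tensorMap f g) (i, i') (j, j') = ent f i j ⊗ₘ ent g i' j' := rfl

/-- The associativity constraint. -/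
def assocHom (M N K : Mat_ C) : tensor (tensor M N) K ⟶ tensor M (tensor N K) :=
  diagHom (M := tensor (tensor M N) K) (N := tensor M (tensor N K))
    (fun p => (p.1.1, (p.1.2, p.2))) fun p => (α_ (M.X p.1.1) (N.X p.1.2) (K.X p.2)).hom

/-- The inverse of the associativity constraint. -/
def assocInv (M N K : Mat_ C) : tensor M (tensor N K) ⟶ tensor (tensor M N) K :=
  diagHom (M := tensor M (tensor N K)) (N := tensor (tensor M N) K)
    (fun p => ((p.1, p.2.1), p.2.2)) fun p => (α_ (M.X p.1) (N.X p.2.1) (K.X p.2.2)).inv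

/-- The left unit constraint. -/
def leftHom (M : Mat_ C) : tensor unit M ⟶ M :=
  diagHom (M := tensor unit M) (fun p => p.2) fun p => (λ_ (M.X p.2)).hom

/-- The inverse of the left unit constraint. -/
def leftInv (M : Mat_ C) : M ⟶ tensor unit M :=
  diagHom (N := tensor unit M) (fun i => (PUnit.unit, i)) fun i => (λ_ (M.X i)).inv

/-- The right unit constraint. -/
def rightHom (M : Mat_ C) : tensor M unit ⟶ M :=
  diagHom (M := tensor M unit) (fun p => p.1) fun p => (ρ_ (M.X p.1)).hom

/-- The inverse of the right unit constraint. -/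
def rightInv (M : Mat_ C) : M ⟶ tensor M unit :=
  diagHom (N := tensor M unit) (fun i => (i, PUnit.unit)) fun i => (ρ_ (M.X i)).inv

/-- The associativity constraint. -/
def assocIso (M N K : Mat_ C) : tensor (tensor M N) K ≅ tensor M (tensor N K) where
  hom := assocHom M N K
  inv := assocInv M N K
  hom_inv_id := by
    rw [assocHom, assocInv, diagHom_comp, ← diagHom_id]
    exact diagHom_congr (M := tensor (tensor M N) K) (N := tensor (tensor M N) K) (fun p => p)
      fun p => Iso.hom_inv_id _
  inv_hom_id := by
    rw [assocHom, assocInv, diagHom_comp, ← diagHom_id]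
    exact diagHom_congr (M := tensor M (tensor N K)) (N := tensor M (tensor N K)) (fun p => p)
      fun p => Iso.inv_hom_id _

/-- The left unit constraint. -/
def leftIso (M : Mat_ C) : tensor unit M ≅ M where
  hom := leftHom M
  inv := leftInv M
  hom_inv_id := by
    rw [leftHom, leftInv, diagHom_comp, ← diagHom_id]
    exact diagHom_congr (M := tensor unit M) (N := tensor unit M) (fun p => p)
      fun p => Iso.hom_inv_id _
  inv_hom_id := by
    rw [leftHom, leftInv, diagHom_comp, ← diagHom_id]
    exact diagHom_congr (M := M) (N := M) (fun p => p) fun p => Iso.inv_hom_id _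

/-- The right unit constraint. -/
def rightIso (M : Mat_ C) : tensor M unit ≅ M where
  hom := rightHom M
  inv := rightInv M
  hom_inv_id := by
    rw [rightHom, rightInv, diagHom_comp, ← diagHom_id]
    exact diagHom_congr (M := tensor M unit) (N := tensor M unit) (fun p => p)
      fun p => Iso.hom_inv_id _
  inv_hom_id := by
    rw [rightHom, rightInv, diagHom_comp, ← diagHom_id]
    exact diagHom_congr (M := M) (N := M) (fun p => p) fun p => Iso.inv_hom_id _

theorem assoc_nat {U V U' V' U'' V'' : Mat_ C} (f₁ : U ⟶ V) (f₂ : U' ⟶ V') (f₃ : U'' ⟶ V'') :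
    tensorMap (tensorMap f₁ f₂) f₃ ≫ (assocIso V V' V'').hom =
      (assocIso U U' U'').hom ≫ tensorMap f₁ (tensorMap f₂ f₃) := by
  apply ent_ext
  rintro ⟨⟨i, i'⟩, i''⟩ ⟨j, ⟨j', j''⟩⟩
  refine (comp_diagHom_apply (M := tensor (tensor U U') U'') (N := tensor (tensor V V') V'') (K := tensor V (tensor V' V''))
    _ _ ?_ _ ((i, i'), i'') ((j, j'), j'')).trans
    (Eq.trans ?_ (diagHom_comp_apply _ _ _ _ _).symm)
  · rintro ⟨⟨a, b⟩, c⟩ ⟨⟨a', b'⟩, c'⟩ h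
    cases h
    rfl
  · exact associator_naturality (ent f₁ i j) (ent f₂ i' j') (ent f₃ i'' j'')

theorem left_nat {U V : Mat_ C} (f : U ⟶ V) :
    tensorMap (𝟙 unit) f ≫ (leftIso V).hom = (leftIso U).hom ≫ f := by
  apply ent_ext
  rintro ⟨⟨⟩, i⟩ j
  refine (comp_diagHom_apply (M := tensor unit U) (N := tensor unit V) _ _ ?_ _ (PUnit.unit, i) (PUnit.unit, j)).trans
    (Eq.trans ?_ (diagHom_comp_apply _ _ _ _ _).symm)
  · rintro ⟨⟨⟩, a⟩ ⟨⟨⟩, b⟩ h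
    cases h
    rfl
  · rw [tensorMap_apply, ent_id_self, id_tensorHom]
    exact leftUnitor_naturality (ent f i j)

theorem right_nat {U V : Mat_ C} (f : U ⟶ V) :
    tensorMap f (𝟙 unit) ≫ (rightIso V).hom = (rightIso U).hom ≫ f := by
  apply ent_ext
  rintro ⟨i, ⟨⟩⟩ j
  refine (comp_diagHom_apply (M := tensor U unit) (N := tensor V unit) _ _ ?_ _ (i, PUnit.unit) (j, PUnit.unit)).trans
    (Eq.trans ?_ (diagHom_comp_apply _ _ _ _ _).symm)
  · rintro ⟨a, ⟨⟩⟩ ⟨b, ⟨⟩⟩ h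
    cases h
    rfl
  · rw [tensorMap_apply, ent_id_self, tensorHom_id]
    exact rightUnitor_naturality (ent f i j)

variable [MonoidalPreadditive C]

theorem tensorMap_diagHom {M N M' N' : Mat_ C} (e : M.ι → N.ι) (φ : ∀ i, M.X i ⟶ N.X (e i))
    (e' : M'.ι → N'.ι) (φ' : ∀ i, M'.X i ⟶ N'.X (e' i)) :
    tensorMap (diagHom e φ) (diagHom e' φ') =
      diagHom (M := tensor M M') (N := tensor N N') (fun p => (e p.1, e' p.2))
        (fun p => φ p.1 ⊗ₘ φ' p.2) := by
  apply ent_ext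
  rintro ⟨i, i'⟩ ⟨k, k'⟩
  rw [tensorMap_apply]
  by_cases h : e i = k
  · subst h
    by_cases h' : e' i' = k'
    · subst h'
      rw [diagHom_self, diagHom_self]
      exact (diagHom_self (M := tensor M M') (N := tensor N N') (fun p => (e p.1, e' p.2))
        (fun p => φ p.1 ⊗ₘ φ' p.2) (i, i')).symm
    · rw [diagHom_ne _ _ h', MonoidalPreadditive.tensor_zero]
      exact (diagHom_ne (M := tensor M M') (N := tensor N N') (fun p => (e p.1, e' p.2))
        (fun p => φ p.1 ⊗ₘ φ' p.2) (i := (i, i')) (j := (e i, k'))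
        (fun hh => h' (congrArg Prod.snd hh))).symm
  · rw [diagHom_ne _ _ h, MonoidalPreadditive.zero_tensor]
    exact (diagHom_ne (M := tensor M M') (N := tensor N N') (fun p => (e p.1, e' p.2))
      (fun p => φ p.1 ⊗ₘ φ' p.2) (i := (i, i')) (j := (k, k'))
      (fun hh => h (congrArg Prod.fst hh))).symm

theorem tensorMap_id (M N : Mat_ C) : tensorMap (𝟙 M) (𝟙 N) = 𝟙 (tensor M N) := by
  rw [← diagHom_id, ← diagHom_id, tensorMap_diagHom, ← diagHom_id]
  exact diagHom_congr (M := tensor M N) (N := tensor M N) (fun p => p) fun p => id_tensorHom_id _ _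

theorem tensorMap_comp {M N K M' N' K' : Mat_ C} (f : M ⟶ N) (f' : M' ⟶ N') (g : N ⟶ K)
    (g' : N' ⟶ K') : tensorMap f f' ≫ tensorMap g g' = tensorMap (f ≫ g) (f' ≫ g') := by
  apply ent_ext
  rintro ⟨i, i'⟩ ⟨k, k'⟩
  rw [tensorMap_apply, ent_comp, ent_comp, ent_comp, sum_tensor]
  refine (Fintype.sum_prod_type _).trans (Finset.sum_congr rfl fun j _ => ?_)
  rw [tensor_sum]
  refine Finset.sum_congr rfl fun j' _ => ?_
  rw [tensorMap_apply, tensorMap_apply, tensorHom_comp_tensorHom]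

theorem pentagon_eq (W X Y Z : Mat_ C) :
    tensorMap (assocIso W X Y).hom (𝟙 Z) ≫ (assocIso W (tensor X Y) Z).hom ≫
      tensorMap (𝟙 W) (assocIso X Y Z).hom =
    (assocIso (tensor W X) Y Z).hom ≫ (assocIso W X (tensor Y Z)).hom := by
  dsimp only [assocIso]
  rw [← diagHom_id, ← diagHom_id, assocHom, assocHom, assocHom, assocHom, assocHom,
    tensorMap_diagHom, tensorMap_diagHom, diagHom_comp, diagHom_comp, diagHom_comp]
  refine diagHom_congr (M := tensor (tensor (tensor W X) Y) Z)
    (N := tensor W (tensor X (tensor Y Z))) (fun p => (p.1.1.1, (p.1.1.2, (p.1.2, p.2)))) fun p => ?_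
  have := pentagon (W.X p.1.1.1) (X.X p.1.1.2) (Y.X p.1.2) (Z.X p.2)
  rw [← tensorHom_id, ← id_tensorHom] at this
  exact this

theorem triangle_eq (X Y : Mat_ C) :
    (assocIso X unit Y).hom ≫ tensorMap (𝟙 X) (leftIso Y).hom =
      tensorMap (rightIso X).hom (𝟙 Y) := by
  dsimp only [assocIso, leftIso, rightIso]
  rw [← diagHom_id, ← diagHom_id, assocHom, leftHom, rightHom,
    tensorMap_diagHom, tensorMap_diagHom, diagHom_comp]
  refine diagHom_congr (M := tensor (tensor X unit) Y)
    (N := tensor X Y) (fun p => (p.1.1, p.2)) fun p => ?_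
  have := triangle (X.X p.1.1) (Y.X p.2)
  rw [← tensorHom_id, ← id_tensorHom] at this
  exact this

instance : MonoidalCategoryStruct (Mat_ C) where
  tensorObj := tensor
  tensorUnit := unit
  tensorHom f g := tensorMap f g
  whiskerLeft U _ _ g := tensorMap (𝟙 U) g
  whiskerRight f U := tensorMap f (𝟙 U)
  associator U V W := assocIso U V W
  leftUnitor U := leftIso U
  rightUnitor U := rightIso U

instance : MonoidalCategory (Mat_ C) := .ofTensorHom
  (id_tensorHom_id := tensorMap_id)
  (id_tensorHom := fun _ _ _ _ => rfl)
  (tensorHom_id := fun _ _ => rfl)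
  (tensorHom_comp_tensorHom := tensorMap_comp)
  (associator_naturality := assoc_nat)
  (leftUnitor_naturality := left_nat)
  (rightUnitor_naturality := right_nat)
  (pentagon := pentagon_eq)
  (triangle := triangle_eq)

section Symmetric

variable [SymmetricCategory C]

/-- The braiding, as a matrix. -/
def swapHom (M N : Mat_ C) : tensor M N ⟶ tensor N M :=
  diagHom (M := tensor M N) (N := tensor N M) (fun p => (p.2, p.1))
    fun p => (β_ (M.X p.1) (N.X p.2)).hom

theorem swap_swap (M N : Mat_ C) : swapHom M N ≫ swapHom N M = 𝟙 (tensor M N) := by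
  rw [swapHom, swapHom, diagHom_comp, ← diagHom_id]
  exact diagHom_congr (M := tensor M N) (N := tensor M N) (fun p => p)
    fun p => SymmetricCategory.symmetry _ _

/-- The braiding. -/
def swapIso (M N : Mat_ C) : tensor M N ≅ tensor N M where
  hom := swapHom M N
  inv := swapHom N M
  hom_inv_id := swap_swap M N
  inv_hom_id := swap_swap N M

theorem swap_nat {U V U' V' : Mat_ C} (f : U ⟶ V) (f' : U' ⟶ V') :
    tensorMap f f' ≫ (swapIso V V').hom = (swapIso U U').hom ≫ tensorMap f' f := by
  apply ent_ext
  rintro ⟨i, i'⟩ ⟨j', j⟩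
  refine (comp_diagHom_apply (M := tensor U U') (N := tensor V V') (K := tensor V' V) _ _ ?_ _ (i, i') (j, j')).trans
    (Eq.trans ?_ (diagHom_comp_apply _ _ _ _ _).symm)
  · rintro ⟨a, b⟩ ⟨a', b'⟩ h
    cases h
    rfl
  · exact BraidedCategory.braiding_naturality (ent f i j) (ent f' i' j')

theorem hexagon_eq (X Y Z : Mat_ C) :
    (assocIso X Y Z).hom ≫ (swapIso X (tensor Y Z)).hom ≫ (assocIso Y Z X).hom =
      tensorMap (swapIso X Y).hom (𝟙 Z) ≫ (assocIso Y X Z).hom ≫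
        tensorMap (𝟙 Y) (swapIso X Z).hom := by
  dsimp only [assocIso, swapIso]
  rw [← diagHom_id, ← diagHom_id, assocHom, assocHom, assocHom, swapHom, swapHom, swapHom,
    tensorMap_diagHom, tensorMap_diagHom, diagHom_comp, diagHom_comp, diagHom_comp, diagHom_comp]
  refine diagHom_congr (M := tensor (tensor X Y) Z)
    (N := tensor Y (tensor Z X)) (fun p => (p.1.2, (p.2, p.1.1))) fun p => ?_
  have := BraidedCategory.hexagon_forward (X.X p.1.1) (Y.X p.1.2) (Z.X p.2)
  rw [← tensorHom_id, ← id_tensorHom] at this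
  exact this

theorem hexagon_eq' (X Y Z : Mat_ C) :
    (assocIso X Y Z).inv ≫ (swapIso (tensor X Y) Z).hom ≫ (assocIso Z X Y).inv =
      tensorMap (𝟙 X) (swapIso Y Z).hom ≫ (assocIso X Z Y).inv ≫
        tensorMap (swapIso X Z).hom (𝟙 Y) := by
  dsimp only [assocIso, swapIso]
  rw [← diagHom_id, ← diagHom_id, assocInv, assocInv, assocInv, swapHom, swapHom, swapHom,
    tensorMap_diagHom, tensorMap_diagHom, diagHom_comp, diagHom_comp, diagHom_comp, diagHom_comp]
  refine diagHom_congr (M := tensor X (tensor Y Z))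
    (N := tensor (tensor Z X) Y) (fun p => ((p.2.2, p.1), p.2.1)) fun p => ?_
  have := BraidedCategory.hexagon_reverse (X.X p.1) (Y.X p.2.1) (Z.X p.2.2)
  rw [← tensorHom_id, ← id_tensorHom] at this
  exact this

instance : SymmetricCategory (Mat_ C) where
  braiding U V := swapIso U V
  braiding_naturality_right U _ _ f := swap_nat (𝟙 U) f
  braiding_naturality_left f U := swap_nat f (𝟙 U)
  hexagon_forward := hexagon_eq
  hexagon_reverse := hexagon_eq'
  symmetry := swap_swap

end Symmetric

section Dual

variable [RightRigidCategory C]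

/-- The dual of a tuple: the tuple of the duals. -/
abbrev dual (M : Mat_ C) : Mat_ C := ⟨M.ι, fun i => (M.X i)ᘁ⟩

open scoped Classical in
/-- Coevaluation: the coevaluations of the entries, in the diagonal positions. -/
def coev (M : Mat_ C) : unit ⟶ tensor M (dual M) := ofEnt fun _ p =>
  if h : p.1 = p.2 then η_ (M.X p.1) (M.X p.1)ᘁ ≫ M.X p.1 ◁ eqToHom (congrArg (dual M).X h) else 0

open scoped Classical in
/-- Evaluation: the evaluations of the entries, in the diagonal positions. -/
def ev (M : Mat_ C) : tensor (dual M) M ⟶ unit := ofEnt fun p _ =>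
  if h : p.1 = p.2 then eqToHom (congrArg (dual M).X h) ▷ M.X p.2 ≫ ε_ (M.X p.2) (M.X p.2)ᘁ else 0

theorem coev_self (M : Mat_ C) (x : PUnit) (i : M.ι) :
    ent (coev M) x (i, i) = η_ (M.X i) (M.X i)ᘁ := by
  simp [coev, ent_ofEnt]

theorem coev_ne (M : Mat_ C) (x : PUnit) {i j : M.ι} (h : i ≠ j) : ent (coev M) x (i, j) = 0 :=
  dif_neg h

theorem ev_self (M : Mat_ C) (x : PUnit) (i : M.ι) :
    ent (ev M) (i, i) x = ε_ (M.X i) (M.X i)ᘁ := by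
  simp [ev, ent_ofEnt]

theorem ev_ne (M : Mat_ C) (x : PUnit) {i j : M.ι} (h : i ≠ j) : ent (ev M) (i, j) x = 0 :=
  dif_neg h

theorem snake_left (M : Mat_ C) :
    tensorMap (𝟙 (dual M)) (coev M) ≫ (assocIso (dual M) M (dual M)).inv ≫
      tensorMap (ev M) (𝟙 (dual M)) = (rightIso (dual M)).hom ≫ (leftIso (dual M)).inv := by
  apply ent_ext
  rintro ⟨i, x⟩ ⟨y, k⟩
  have hR : ent ((rightIso (dual M)).hom ≫ (leftIso (dual M)).inv) (i, x) (y, k) =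
      (ρ_ (M.X i)ᘁ).hom ≫ ent (leftIso (dual M)).inv i (y, k) := diagHom_comp_apply _ _ _ _ _
  have hL : ∀ a b c, ent ((assocIso (dual M) M (dual M)).inv ≫ tensorMap (ev M) (𝟙 (dual M)))
      (a, (b, c)) (y, k) = (α_ (M.X a)ᘁ (M.X b) (M.X c)ᘁ).inv ≫
        (ent (ev M) (a, b) y ⊗ₘ ent (𝟙 (dual M)) c k) := fun a b c =>
    diagHom_comp_apply _ _ _ _ _
  rw [hR, ent_comp, Finset.sum_eq_single (i, (i, i))]
  · rw [tensorMap_apply, ent_id_self, coev_self, hL, ev_self]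
    by_cases h : i = k
    · subst h
      have h1 : ent (leftIso (dual M)).inv i (y, i) = (λ_ (M.X i)ᘁ).inv :=
        diagHom_self (M := dual M) (N := tensor unit (dual M)) (fun i => (PUnit.unit, i))
          (fun i => (λ_ (M.X i)ᘁ).inv) i
      rw [h1, ent_id_self, id_tensorHom, tensorHom_id]
      exact ExactPairing.coevaluation_evaluation (M.X i) (M.X i)ᘁ
    · have h1 : ent (leftIso (dual M)).inv i (y, k) = 0 :=
        diagHom_ne (M := dual M) (N := tensor unit (dual M)) (fun i => (PUnit.unit, i))
          (fun i => (λ_ (M.X i)ᘁ).inv) (fun hh => h (congrArg Prod.snd hh))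
      rw [h1, ent_id_ne _ h, MonoidalPreadditive.tensor_zero, Limits.comp_zero, Limits.comp_zero,
        Limits.comp_zero]
  · rintro ⟨a, ⟨b, c⟩⟩ _ hne
    rw [tensorMap_apply, hL]
    by_cases h1 : i = a
    · subst h1
      by_cases h2 : b = c
      · subst h2
        have h3 : i ≠ b := by
          rintro rfl
          exact hne rfl
        rw [ev_ne M _ h3, MonoidalPreadditive.zero_tensor, Limits.comp_zero, Limits.comp_zero]
      · rw [coev_ne M _ h2, MonoidalPreadditive.tensor_zero, Limits.zero_comp]
    · rw [ent_id_ne _ h1, MonoidalPreadditive.zero_tensor, Limits.zero_comp]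
  · intro h
    exact absurd (Finset.mem_univ _) h

theorem snake_right (M : Mat_ C) :
    tensorMap (coev M) (𝟙 M) ≫ (assocIso M (dual M) M).hom ≫
      tensorMap (𝟙 M) (ev M) = (leftIso M).hom ≫ (rightIso M).inv := by
  apply ent_ext
  rintro ⟨x, i⟩ ⟨k, y⟩
  have hR : ent ((leftIso M).hom ≫ (rightIso M).inv) (x, i) (k, y) =
      (λ_ (M.X i)).hom ≫ ent (rightIso M).inv i (k, y) := diagHom_comp_apply _ _ _ _ _
  have hL : ∀ a b c, ent ((assocIso M (dual M) M).hom ≫ tensorMap (𝟙 M) (ev M))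
      ((a, b), c) (k, y) = (α_ (M.X a) (M.X b)ᘁ (M.X c)).hom ≫
        (ent (𝟙 M) a k ⊗ₘ ent (ev M) (b, c) y) := fun a b c =>
    diagHom_comp_apply _ _ _ _ _
  rw [hR, ent_comp, Finset.sum_eq_single ((i, i), i)]
  · rw [tensorMap_apply, ent_id_self, coev_self, hL, ev_self]
    by_cases h : i = k
    · subst h
      have h1 : ent (rightIso M).inv i (i, y) = (ρ_ (M.X i)).inv :=
        diagHom_self (M := M) (N := tensor M unit) (fun i => (i, PUnit.unit))
          (fun i => (ρ_ (M.X i)).inv) i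
      rw [h1, ent_id_self, id_tensorHom, tensorHom_id]
      exact ExactPairing.evaluation_coevaluation (M.X i) (M.X i)ᘁ
    · have h1 : ent (rightIso M).inv i (k, y) = 0 :=
        diagHom_ne (M := M) (N := tensor M unit) (fun i => (i, PUnit.unit))
          (fun i => (ρ_ (M.X i)).inv) (fun hh => h (congrArg Prod.fst hh))
      rw [h1, ent_id_ne _ h, MonoidalPreadditive.zero_tensor, Limits.comp_zero, Limits.comp_zero,
        Limits.comp_zero]
  · rintro ⟨⟨a, b⟩, c⟩ _ hne
    rw [tensorMap_apply, hL]
    by_cases h1 : i = c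
    · subst h1
      by_cases h2 : a = b
      · subst h2
        have h3 : a ≠ i := by
          rintro rfl
          exact hne rfl
        rw [ev_ne _ _ h3, MonoidalPreadditive.tensor_zero, Limits.comp_zero, Limits.comp_zero]
      · rw [coev_ne _ _ h2, MonoidalPreadditive.zero_tensor, Limits.zero_comp]
    · rw [ent_id_ne _ h1, MonoidalPreadditive.tensor_zero, Limits.zero_comp]
  · intro h
    exact absurd (Finset.mem_univ _) h

instance exactPairing (M : Mat_ C) : ExactPairing M (dual M) where
  coevaluation' := coev M
  evaluation' := ev M
  coevaluation_evaluation' := snake_left M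
  evaluation_coevaluation' := snake_right M

instance : RightRigidCategory (Mat_ C) where
  rightDual M := { rightDual := dual M, exact := exactPairing M }

end Dual

end MatTensor

end Deligne

namespace Deligne

/-! ### Tensor structure on the idempotent completion -/

namespace KaroubiTensor

open Idempotents

universe v₂ u₂

variable {C : Type u₂} [Category.{v₂} C]

instance karoubiLinear {F : Type*} [Field F] [Preadditive C] [Linear F C] :
    Linear F (Karoubi C) where
  homModule P Q :=
    { smul := fun r f => ⟨r • f.f, by rw [Linear.smul_comp, Linear.comp_smul, f.comm]⟩
      one_smul := fun f => Karoubi.hom_ext _ _ (one_smul F f.f)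
      mul_smul := fun r s f => Karoubi.hom_ext _ _ (mul_smul r s f.f)
      smul_zero := fun r => Karoubi.hom_ext _ _ (smul_zero r)
      smul_add := fun r f g => Karoubi.hom_ext _ _ (smul_add r f.f g.f)
      add_smul := fun r s f => Karoubi.hom_ext _ _ (add_smul r s f.f)
      zero_smul := fun f => Karoubi.hom_ext _ _ (zero_smul F f.f) }
  smul_comp _ _ _ r f g := Karoubi.hom_ext _ _ (Linear.smul_comp _ _ _ r f.f g.f)
  comp_smul _ _ _ f r g := Karoubi.hom_ext _ _ (Linear.comp_smul _ _ _ f.f r g.f)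

variable [MonoidalCategory C]

/-- Tensor product of objects. -/
def tensor (P Q : Karoubi C) : Karoubi C where
  X := P.X ⊗ Q.X
  p := P.p ⊗ₘ Q.p
  idem := by rw [tensorHom_comp_tensorHom, P.idem, Q.idem]

/-- The unit object. -/
def unit : Karoubi C where
  X := 𝟙_ C
  p := 𝟙 _
  idem := Category.comp_id _

/-- Tensor product of morphisms. -/
def tensorMap {P Q P' Q' : Karoubi C} (f : P ⟶ Q) (g : P' ⟶ Q') : tensor P P' ⟶ tensor Q Q' where
  f := f.f ⊗ₘ g.f
  comm := by
    dsimp only [tensor]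
    rw [tensorHom_comp_tensorHom, tensorHom_comp_tensorHom, f.comm, g.comm]

/-- An isomorphism of the underlying objects which intertwines the idempotents. -/
def isoOf {P Q : Karoubi C} (e : P.X ≅ Q.X) (h : P.p ≫ e.hom = e.hom ≫ Q.p) : P ≅ Q where
  hom := ⟨P.p ≫ e.hom, by rw [Category.assoc, ← h, P.idem_assoc, P.idem_assoc]⟩
  inv := ⟨e.inv ≫ P.p, by
    rw [Category.assoc, P.idem, ← Category.assoc, ← cancel_epi e.hom, Category.assoc,
      ← Category.assoc e.hom, ← h, Category.assoc, Iso.hom_inv_id_assoc, P.idem]⟩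
  hom_inv_id := by
    apply Karoubi.hom_ext
    rw [Karoubi.comp_f]
    dsimp only
    rw [Category.assoc, Iso.hom_inv_id_assoc, P.idem, Karoubi.id_f]
  inv_hom_id := by
    apply Karoubi.hom_ext
    rw [Karoubi.comp_f]
    dsimp only
    rw [Category.assoc, P.idem_assoc, h, Iso.inv_hom_id_assoc, Karoubi.id_f]

/-- The associativity constraint. -/
def assocIso (P Q R : Karoubi C) : tensor (tensor P Q) R ≅ tensor P (tensor Q R) :=
  isoOf (P := tensor (tensor P Q) R) (Q := tensor P (tensor Q R)) (α_ P.X Q.X R.X)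
    (associator_naturality _ _ _)

/-- The left unit constraint. -/
def leftIso (P : Karoubi C) : tensor unit P ≅ P :=
  isoOf (P := tensor unit P) (λ_ P.X) (by
    dsimp only [tensor, unit]
    rw [id_tensorHom]
    exact leftUnitor_naturality _)

/-- The right unit constraint. -/
def rightIso (P : Karoubi C) : tensor P unit ≅ P :=
  isoOf (P := tensor P unit) (ρ_ P.X) (by
    dsimp only [tensor, unit]
    rw [tensorHom_id]
    exact rightUnitor_naturality _)

instance : MonoidalCategoryStruct (Karoubi C) where
  tensorObj := tensor
  tensorUnit := unit
  tensorHom f g := tensorMap f g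
  whiskerLeft U _ _ g := tensorMap (𝟙 U) g
  whiskerRight f U := tensorMap f (𝟙 U)
  associator U V W := assocIso U V W
  leftUnitor U := leftIso U
  rightUnitor U := rightIso U

theorem tensorMap_id (P Q : Karoubi C) : tensorMap (𝟙 P) (𝟙 Q) = 𝟙 (tensor P Q) := rfl

theorem tensorMap_comp {P Q R P' Q' R' : Karoubi C} (f : P ⟶ Q) (f' : P' ⟶ Q') (g : Q ⟶ R)
    (g' : Q' ⟶ R') : tensorMap f f' ≫ tensorMap g g' = tensorMap (f ≫ g) (f' ≫ g') :=
  Karoubi.hom_ext _ _ (tensorHom_comp_tensorHom _ _ _ _)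

theorem assoc_nat {U V U' V' U'' V'' : Karoubi C} (f₁ : U ⟶ V) (f₂ : U' ⟶ V') (f₃ : U'' ⟶ V'') :
    tensorMap (tensorMap f₁ f₂) f₃ ≫ (assocIso V V' V'').hom =
      (assocIso U U' U'').hom ≫ tensorMap f₁ (tensorMap f₂ f₃) := by
  apply Karoubi.hom_ext
  change ((f₁.f ⊗ₘ f₂.f) ⊗ₘ f₃.f) ≫ ((V.p ⊗ₘ V'.p) ⊗ₘ V''.p) ≫ (α_ V.X V'.X V''.X).hom =
    (((U.p ⊗ₘ U'.p) ⊗ₘ U''.p) ≫ (α_ U.X U'.X U''.X).hom) ≫ (f₁.f ⊗ₘ (f₂.f ⊗ₘ f₃.f))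
  rw [Category.assoc, ← associator_naturality]
  simp only [← Category.assoc, tensorHom_comp_tensorHom, Karoubi.comp_p, Karoubi.p_comp]

theorem left_nat {U V : Karoubi C} (f : U ⟶ V) :
    tensorMap (𝟙 unit) f ≫ (leftIso V).hom = (leftIso U).hom ≫ f := by
  apply Karoubi.hom_ext
  change (𝟙 (𝟙_ C) ⊗ₘ f.f) ≫ (𝟙 (𝟙_ C) ⊗ₘ V.p) ≫ (λ_ V.X).hom =
    ((𝟙 (𝟙_ C) ⊗ₘ U.p) ≫ (λ_ U.X).hom) ≫ f.f
  simp only [id_tensorHom]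
  rw [Category.assoc, ← leftUnitor_naturality, ← whiskerLeft_comp_assoc, ← whiskerLeft_comp_assoc,
    Karoubi.comp_p, Karoubi.p_comp]

theorem right_nat {U V : Karoubi C} (f : U ⟶ V) :
    tensorMap f (𝟙 unit) ≫ (rightIso V).hom = (rightIso U).hom ≫ f := by
  apply Karoubi.hom_ext
  change (f.f ⊗ₘ 𝟙 (𝟙_ C)) ≫ (V.p ⊗ₘ 𝟙 (𝟙_ C)) ≫ (ρ_ V.X).hom =
    ((U.p ⊗ₘ 𝟙 (𝟙_ C)) ≫ (ρ_ U.X).hom) ≫ f.f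
  simp only [tensorHom_id]
  rw [Category.assoc, ← rightUnitor_naturality, ← comp_whiskerRight_assoc,
    ← comp_whiskerRight_assoc, Karoubi.comp_p, Karoubi.p_comp]

theorem pentagon_eq (W X Y Z : Karoubi C) :
    tensorMap (assocIso W X Y).hom (𝟙 Z) ≫ (assocIso W (tensor X Y) Z).hom ≫
      tensorMap (𝟙 W) (assocIso X Y Z).hom =
    (assocIso (tensor W X) Y Z).hom ≫ (assocIso W X (tensor Y Z)).hom := by
  apply Karoubi.hom_ext
  change ((((W.p ⊗ₘ X.p) ⊗ₘ Y.p) ≫ (α_ W.X X.X Y.X).hom) ⊗ₘ Z.p) ≫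
    (((W.p ⊗ₘ (X.p ⊗ₘ Y.p)) ⊗ₘ Z.p) ≫ (α_ W.X (X.X ⊗ Y.X) Z.X).hom) ≫
    (W.p ⊗ₘ (((X.p ⊗ₘ Y.p) ⊗ₘ Z.p) ≫ (α_ X.X Y.X Z.X).hom)) =
    ((((W.p ⊗ₘ X.p) ⊗ₘ Y.p) ⊗ₘ Z.p) ≫ (α_ (W.X ⊗ X.X) Y.X Z.X).hom) ≫
    (((W.p ⊗ₘ X.p) ⊗ₘ (Y.p ⊗ₘ Z.p)) ≫ (α_ W.X X.X (Y.X ⊗ Z.X)).hom)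
  have h1 : ((((W.p ⊗ₘ X.p) ⊗ₘ Y.p) ≫ (α_ W.X X.X Y.X).hom) ⊗ₘ Z.p) =
      (((W.p ⊗ₘ X.p) ⊗ₘ Y.p) ⊗ₘ Z.p) ≫ ((α_ W.X X.X Y.X).hom ▷ Z.X) := by
    rw [← tensorHom_id, tensorHom_comp_tensorHom, Category.comp_id]
  have h2 : (W.p ⊗ₘ (((X.p ⊗ₘ Y.p) ⊗ₘ Z.p) ≫ (α_ X.X Y.X Z.X).hom)) =
      (W.p ⊗ₘ ((X.p ⊗ₘ Y.p) ⊗ₘ Z.p)) ≫ (W.X ◁ (α_ X.X Y.X Z.X).hom) := by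
    rw [← id_tensorHom, tensorHom_comp_tensorHom, Category.comp_id]
  have h3 : ((α_ W.X X.X Y.X).hom ▷ Z.X) ≫ ((W.p ⊗ₘ (X.p ⊗ₘ Y.p)) ⊗ₘ Z.p) =
      (((W.p ⊗ₘ X.p) ⊗ₘ Y.p) ⊗ₘ Z.p) ≫ ((α_ W.X X.X Y.X).hom ▷ Z.X) := by
    rw [← tensorHom_id, tensorHom_comp_tensorHom, tensorHom_comp_tensorHom,
      associator_naturality, Category.comp_id, Category.id_comp]
  rw [h1, h2]
  simp only [Category.assoc]
  rw [← associator_naturality_assoc, reassoc_of% h3, reassoc_of% h3, pentagon,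
    ← associator_naturality_assoc]
  simp only [← Category.assoc, tensorHom_comp_tensorHom, Karoubi.idem]

theorem triangle_eq (X Y : Karoubi C) :
    (assocIso X unit Y).hom ≫ tensorMap (𝟙 X) (leftIso Y).hom =
      tensorMap (rightIso X).hom (𝟙 Y) := by
  apply Karoubi.hom_ext
  change (((X.p ⊗ₘ 𝟙 (𝟙_ C)) ⊗ₘ Y.p) ≫ (α_ X.X (𝟙_ C) Y.X).hom) ≫
    (X.p ⊗ₘ ((𝟙 (𝟙_ C) ⊗ₘ Y.p) ≫ (λ_ Y.X).hom)) = (((X.p ⊗ₘ 𝟙 (𝟙_ C)) ≫ (ρ_ X.X).hom) ⊗ₘ Y.p)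
  have h1 : (X.p ⊗ₘ ((𝟙 (𝟙_ C) ⊗ₘ Y.p) ≫ (λ_ Y.X).hom)) =
      (X.p ⊗ₘ (𝟙 (𝟙_ C) ⊗ₘ Y.p)) ≫ (X.X ◁ (λ_ Y.X).hom) := by
    rw [← id_tensorHom X.X, tensorHom_comp_tensorHom, Category.comp_id]
  have h2 : (((X.p ⊗ₘ 𝟙 (𝟙_ C)) ≫ (ρ_ X.X).hom) ⊗ₘ Y.p) =
      ((X.p ⊗ₘ 𝟙 (𝟙_ C)) ⊗ₘ Y.p) ≫ ((ρ_ X.X).hom ▷ Y.X) := by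
    rw [← tensorHom_id _ Y.X, tensorHom_comp_tensorHom, Category.comp_id]
  rw [h1, h2, Category.assoc, ← associator_naturality_assoc, triangle]
  simp only [← Category.assoc, tensorHom_comp_tensorHom, Karoubi.idem, Category.comp_id]

instance : MonoidalCategory (Karoubi C) := .ofTensorHom
  (id_tensorHom_id := tensorMap_id)
  (id_tensorHom := fun _ _ _ _ => rfl)
  (tensorHom_id := fun _ _ => rfl)
  (tensorHom_comp_tensorHom := tensorMap_comp)
  (associator_naturality := assoc_nat)
  (leftUnitor_naturality := left_nat)
  (rightUnitor_naturality := right_nat)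
  (pentagon := pentagon_eq)
  (triangle := triangle_eq)

section Symmetric

variable [SymmetricCategory C]

/-- The braiding. -/
def swapIso (P Q : Karoubi C) : tensor P Q ≅ tensor Q P :=
  isoOf (P := tensor P Q) (Q := tensor Q P) (β_ P.X Q.X) (BraidedCategory.braiding_naturality _ _)

theorem swap_nat {U V U' V' : Karoubi C} (f : U ⟶ V) (f' : U' ⟶ V') :
    tensorMap f f' ≫ (swapIso V V').hom = (swapIso U U').hom ≫ tensorMap f' f := by
  apply Karoubi.hom_ext
  change (f.f ⊗ₘ f'.f) ≫ (V.p ⊗ₘ V'.p) ≫ (β_ V.X V'.X).hom =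
    ((U.p ⊗ₘ U'.p) ≫ (β_ U.X U'.X).hom) ≫ (f'.f ⊗ₘ f.f)
  rw [Category.assoc, ← BraidedCategory.braiding_naturality]
  simp only [← Category.assoc, tensorHom_comp_tensorHom, Karoubi.comp_p, Karoubi.p_comp]

theorem swap_swap (P Q : Karoubi C) : (swapIso P Q).hom ≫ (swapIso Q P).hom = 𝟙 (tensor P Q) := by
  apply Karoubi.hom_ext
  change ((P.p ⊗ₘ Q.p) ≫ (β_ P.X Q.X).hom) ≫ (Q.p ⊗ₘ P.p) ≫ (β_ Q.X P.X).hom = P.p ⊗ₘ Q.p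
  rw [Category.assoc, ← BraidedCategory.braiding_naturality_assoc, SymmetricCategory.symmetry,
    Category.comp_id, tensorHom_comp_tensorHom, P.idem, Q.idem]

theorem hexagon_eq (X Y Z : Karoubi C) :
    (assocIso X Y Z).hom ≫ (swapIso X (tensor Y Z)).hom ≫ (assocIso Y Z X).hom =
      tensorMap (swapIso X Y).hom (𝟙 Z) ≫ (assocIso Y X Z).hom ≫
        tensorMap (𝟙 Y) (swapIso X Z).hom := by
  apply Karoubi.hom_ext
  change (((X.p ⊗ₘ Y.p) ⊗ₘ Z.p) ≫ (α_ X.X Y.X Z.X).hom) ≫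
      ((X.p ⊗ₘ (Y.p ⊗ₘ Z.p)) ≫ (β_ X.X (Y.X ⊗ Z.X)).hom) ≫
      (((Y.p ⊗ₘ Z.p) ⊗ₘ X.p) ≫ (α_ Y.X Z.X X.X).hom) =
    (((X.p ⊗ₘ Y.p) ≫ (β_ X.X Y.X).hom) ⊗ₘ Z.p) ≫
      (((Y.p ⊗ₘ X.p) ⊗ₘ Z.p) ≫ (α_ Y.X X.X Z.X).hom) ≫
      (Y.p ⊗ₘ ((X.p ⊗ₘ Z.p) ≫ (β_ X.X Z.X).hom))
  have h1 : (((X.p ⊗ₘ Y.p) ≫ (β_ X.X Y.X).hom) ⊗ₘ Z.p) =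
      ((X.p ⊗ₘ Y.p) ⊗ₘ Z.p) ≫ ((β_ X.X Y.X).hom ▷ Z.X) := by
    rw [← tensorHom_id _ Z.X, tensorHom_comp_tensorHom, Category.comp_id]
  have h2 : (Y.p ⊗ₘ ((X.p ⊗ₘ Z.p) ≫ (β_ X.X Z.X).hom)) =
      (Y.p ⊗ₘ (X.p ⊗ₘ Z.p)) ≫ (Y.X ◁ (β_ X.X Z.X).hom) := by
    rw [← id_tensorHom Y.X, tensorHom_comp_tensorHom, Category.comp_id]
  have h3 : ((β_ X.X Y.X).hom ▷ Z.X) ≫ ((Y.p ⊗ₘ X.p) ⊗ₘ Z.p) =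
      ((X.p ⊗ₘ Y.p) ⊗ₘ Z.p) ≫ ((β_ X.X Y.X).hom ▷ Z.X) := by
    rw [← tensorHom_id, tensorHom_comp_tensorHom, tensorHom_comp_tensorHom,
      BraidedCategory.braiding_naturality, Category.comp_id, Category.id_comp]
  rw [h1, h2]
  simp only [Category.assoc]
  rw [← associator_naturality_assoc Y.p X.p Z.p, reassoc_of% h3, reassoc_of% h3,
    ← BraidedCategory.hexagon_forward,
    ← associator_naturality_assoc X.p Y.p Z.p,
    ← BraidedCategory.braiding_naturality_assoc X.p (Y.p ⊗ₘ Z.p),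
    ← associator_naturality_assoc X.p Y.p Z.p]

theorem hexagon_eq' (X Y Z : Karoubi C) :
    (assocIso X Y Z).inv ≫ (swapIso (tensor X Y) Z).hom ≫ (assocIso Z X Y).inv =
      tensorMap (𝟙 X) (swapIso Y Z).hom ≫ (assocIso X Z Y).inv ≫
        tensorMap (swapIso X Z).hom (𝟙 Y) := by
  have h1 := swap_swap (tensor X Y) Z
  have h2 : tensorMap (swapIso X Z).hom (𝟙 Y) ≫ tensorMap (swapIso Z X).hom (𝟙 Y) = 𝟙 _ := by
    rw [tensorMap_comp, swap_swap, Category.comp_id, tensorMap_id]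
  have h3 : tensorMap (𝟙 X) (swapIso Y Z).hom ≫ tensorMap (𝟙 X) (swapIso Z Y).hom = 𝟙 _ := by
    rw [tensorMap_comp, swap_swap, Category.comp_id, tensorMap_id]
  rw [← cancel_mono ((assocIso Z X Y).hom ≫ (swapIso Z (tensor X Y)).hom ≫ (assocIso X Y Z).hom)]
  conv_rhs => rw [hexagon_eq]
  simp only [Category.assoc, Iso.inv_hom_id_assoc]
  rw [reassoc_of% h1, reassoc_of% h2, Iso.inv_hom_id_assoc, h3, Iso.inv_hom_id]

instance : SymmetricCategory (Karoubi C) where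
  braiding U V := swapIso U V
  braiding_naturality_right U _ _ f := swap_nat (𝟙 U) f
  braiding_naturality_left f U := swap_nat f (𝟙 U)
  hexagon_forward := hexagon_eq
  hexagon_reverse := hexagon_eq'
  symmetry := swap_swap

end Symmetric

theorem snake_aux {X A : C} {q : A ⟶ A} (hq : q ≫ q = q) {η : 𝟙_ C ⟶ X ⊗ A} {ε : A ⊗ X ⟶ 𝟙_ C}
    (h : A ◁ η ≫ (α_ A X A).inv ≫ ε ▷ A = (ρ_ A).hom ≫ (λ_ A).inv) :
    (q ⊗ₘ (η ≫ X ◁ q)) ≫ (α_ A X A).inv ≫ ((q ▷ X ≫ ε) ⊗ₘ q) =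
      ((q ⊗ₘ 𝟙 (𝟙_ C)) ≫ (ρ_ A).hom) ≫ ((λ_ A).inv ≫ (𝟙 (𝟙_ C) ⊗ₘ q)) := by
  have e1 : (q ⊗ₘ (η ≫ X ◁ q)) = (q ⊗ₘ 𝟙 _) ≫ (𝟙 A ⊗ₘ η) ≫ (𝟙 A ⊗ₘ (𝟙 X ⊗ₘ q)) := by
    rw [tensorHom_comp_tensorHom, tensorHom_comp_tensorHom, Category.comp_id, Category.comp_id,
      Category.id_comp, id_tensorHom]
  have e2 : ((q ▷ X ≫ ε) ⊗ₘ q) = ((q ⊗ₘ 𝟙 X) ⊗ₘ q) ≫ (ε ⊗ₘ 𝟙 A) := by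
    rw [tensorHom_comp_tensorHom, Category.comp_id, tensorHom_id]
  have e3 : (𝟙 A ⊗ₘ η) ≫ (𝟙 A ⊗ₘ (𝟙 X ⊗ₘ q)) ≫ (α_ A X A).inv ≫ ((q ⊗ₘ 𝟙 X) ⊗ₘ q) =
      (q ⊗ₘ 𝟙 _) ≫ (𝟙 A ⊗ₘ η) ≫ (α_ A X A).inv ≫ ((𝟙 A ⊗ₘ 𝟙 X) ⊗ₘ q) := by
    rw [← associator_inv_naturality, ← associator_inv_naturality]
    simp only [← Category.assoc, tensorHom_comp_tensorHom, Category.comp_id, Category.id_comp, hq]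
  rw [e1, e2]
  simp only [Category.assoc]
  rw [reassoc_of% e3]
  simp only [← Category.assoc, tensorHom_comp_tensorHom, Category.comp_id, hq]
  simp only [Category.assoc, Category.id_comp, id_tensorHom_id]
  have e4 : (ε ⊗ₘ q) = (ε ▷ A) ≫ (𝟙 (𝟙_ C) ⊗ₘ q) := by
    rw [id_tensorHom, MonoidalCategory.tensorHom_def]
  rw [e4, ← reassoc_of% h, ← id_tensorHom]
  simp only [← Category.assoc, tensorHom_comp_tensorHom, Category.comp_id, Category.id_comp]

theorem snake_aux' {X A : C} {p : X ⟶ X} (hp : p ≫ p = p) {η : 𝟙_ C ⟶ X ⊗ A} {ε : A ⊗ X ⟶ 𝟙_ C}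
    (h : η ▷ X ≫ (α_ X A X).hom ≫ X ◁ ε = (λ_ X).hom ≫ (ρ_ X).inv) :
    ((η ≫ p ▷ A) ⊗ₘ p) ≫ (α_ X A X).hom ≫ (p ⊗ₘ (A ◁ p ≫ ε)) =
      ((𝟙 (𝟙_ C) ⊗ₘ p) ≫ (λ_ X).hom) ≫ ((ρ_ X).inv ≫ (p ⊗ₘ 𝟙 (𝟙_ C))) := by
  have e1 : ((η ≫ p ▷ A) ⊗ₘ p) = (𝟙 _ ⊗ₘ p) ≫ (η ⊗ₘ 𝟙 X) ≫ ((p ⊗ₘ 𝟙 A) ⊗ₘ 𝟙 X) := by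
    rw [tensorHom_comp_tensorHom, tensorHom_comp_tensorHom, Category.comp_id, Category.comp_id,
      Category.id_comp, tensorHom_id]
  have e2 : (p ⊗ₘ (A ◁ p ≫ ε)) = (p ⊗ₘ (𝟙 A ⊗ₘ p)) ≫ (𝟙 X ⊗ₘ ε) := by
    rw [tensorHom_comp_tensorHom, Category.comp_id, id_tensorHom]
  have e3 : (η ⊗ₘ 𝟙 X) ≫ ((p ⊗ₘ 𝟙 A) ⊗ₘ 𝟙 X) ≫ (α_ X A X).hom ≫ (p ⊗ₘ (𝟙 A ⊗ₘ p)) =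
      (𝟙 _ ⊗ₘ p) ≫ (η ⊗ₘ 𝟙 X) ≫ (α_ X A X).hom ≫ (p ⊗ₘ (𝟙 A ⊗ₘ 𝟙 X)) := by
    rw [← associator_naturality, ← associator_naturality]
    simp only [← Category.assoc, tensorHom_comp_tensorHom, Category.comp_id, Category.id_comp, hp]
  rw [e1, e2]
  simp only [Category.assoc]
  rw [reassoc_of% e3]
  simp only [← Category.assoc, tensorHom_comp_tensorHom, Category.comp_id, hp]
  simp only [Category.assoc, Category.id_comp, id_tensorHom_id]
  have e4 : (p ⊗ₘ ε) = (X ◁ ε) ≫ (p ⊗ₘ 𝟙 (𝟙_ C)) := by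
    rw [tensorHom_id, tensorHom_def']
  rw [e4, ← reassoc_of% h, ← tensorHom_id]
  simp only [← Category.assoc, tensorHom_comp_tensorHom, Category.comp_id, Category.id_comp]

section Dual

variable [RightRigidCategory C]

/-- The dual object: the dual of the underlying object with the dual (transposed) idempotent. -/
def dual (P : Karoubi C) : Karoubi C where
  X := (P.X)ᘁ
  p := (P.p)ᘁ
  idem := by rw [← comp_rightAdjointMate, P.idem]

/-- Coevaluation. -/
def coev (P : Karoubi C) : unit ⟶ tensor P (dual P) where
  f := η_ P.X (P.X)ᘁ ≫ (P.p ⊗ₘ (P.p)ᘁ)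
  comm := by
    dsimp only [unit, tensor]
    rw [Category.id_comp, Category.assoc]
    exact congrArg (_ ≫ ·) (tensor P (dual P)).idem

/-- Evaluation. -/
def ev (P : Karoubi C) : tensor (dual P) P ⟶ unit where
  f := ((P.p)ᘁ ⊗ₘ P.p) ≫ ε_ P.X (P.X)ᘁ
  comm := by
    dsimp only [unit, tensor]
    rw [Category.comp_id, ← Category.assoc]
    exact congrArg (· ≫ _) (tensor (dual P) P).idem

theorem coev_eq (P : Karoubi C) : η_ P.X (P.X)ᘁ ≫ (P.p ⊗ₘ (P.p)ᘁ) =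
    η_ P.X (P.X)ᘁ ≫ (P.p ▷ (P.X)ᘁ) := by
  rw [tensorHom_def', coevaluation_comp_rightAdjointMate_assoc, ← comp_whiskerRight, P.idem]

theorem coev_eq' (P : Karoubi C) : η_ P.X (P.X)ᘁ ≫ (P.p ⊗ₘ (P.p)ᘁ) =
    η_ P.X (P.X)ᘁ ≫ (P.X ◁ (P.p)ᘁ) := by
  rw [coev_eq, coevaluation_comp_rightAdjointMate]

theorem ev_eq (P : Karoubi C) : ((P.p)ᘁ ⊗ₘ P.p) ≫ ε_ P.X (P.X)ᘁ =
    ((P.X)ᘁ ◁ P.p) ≫ ε_ P.X (P.X)ᘁ := by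
  rw [tensorHom_def', Category.assoc, rightAdjointMate_comp_evaluation, ← whiskerLeft_comp_assoc,
    P.idem]

theorem ev_eq' (P : Karoubi C) : ((P.p)ᘁ ⊗ₘ P.p) ≫ ε_ P.X (P.X)ᘁ =
    ((P.p)ᘁ ▷ P.X) ≫ ε_ P.X (P.X)ᘁ := by
  rw [ev_eq, rightAdjointMate_comp_evaluation]

theorem snake_left (P : Karoubi C) :
    tensorMap (𝟙 (dual P)) (coev P) ≫ (assocIso (dual P) P (dual P)).inv ≫
      tensorMap (ev P) (𝟙 (dual P)) = (rightIso (dual P)).hom ≫ (leftIso (dual P)).inv := by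
  apply Karoubi.hom_ext
  change ((P.p)ᘁ ⊗ₘ (η_ P.X (P.X)ᘁ ≫ (P.p ⊗ₘ (P.p)ᘁ))) ≫
      ((α_ (P.X)ᘁ P.X (P.X)ᘁ).inv ≫ (((P.p)ᘁ ⊗ₘ P.p) ⊗ₘ (P.p)ᘁ)) ≫
      ((((P.p)ᘁ ⊗ₘ P.p) ≫ ε_ P.X (P.X)ᘁ) ⊗ₘ (P.p)ᘁ) =
    (((P.p)ᘁ ⊗ₘ 𝟙 (𝟙_ C)) ≫ (ρ_ (P.X)ᘁ).hom) ≫ ((λ_ (P.X)ᘁ).inv ≫ (𝟙 (𝟙_ C) ⊗ₘ (P.p)ᘁ))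
  have e : (((P.p)ᘁ ⊗ₘ P.p) ⊗ₘ (P.p)ᘁ) ≫ ((((P.p)ᘁ ⊗ₘ P.p) ≫ ε_ P.X (P.X)ᘁ) ⊗ₘ (P.p)ᘁ) =
      ((((P.p)ᘁ ⊗ₘ P.p) ≫ ε_ P.X (P.X)ᘁ) ⊗ₘ (P.p)ᘁ) := by
    rw [tensorHom_comp_tensorHom, ← Category.assoc, tensorHom_comp_tensorHom, P.idem,
      ← comp_rightAdjointMate, P.idem]
  rw [Category.assoc, e, coev_eq', ev_eq']
  exact snake_aux (dual P).idem (ExactPairing.coevaluation_evaluation P.X (P.X)ᘁ)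

theorem snake_right (P : Karoubi C) :
    tensorMap (coev P) (𝟙 P) ≫ (assocIso P (dual P) P).hom ≫
      tensorMap (𝟙 P) (ev P) = (leftIso P).hom ≫ (rightIso P).inv := by
  apply Karoubi.hom_ext
  change ((η_ P.X (P.X)ᘁ ≫ (P.p ⊗ₘ (P.p)ᘁ)) ⊗ₘ P.p) ≫
      (((P.p ⊗ₘ (P.p)ᘁ) ⊗ₘ P.p) ≫ (α_ P.X (P.X)ᘁ P.X).hom) ≫
      (P.p ⊗ₘ (((P.p)ᘁ ⊗ₘ P.p) ≫ ε_ P.X (P.X)ᘁ)) =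
    ((𝟙 (𝟙_ C) ⊗ₘ P.p) ≫ (λ_ P.X).hom) ≫ ((ρ_ P.X).inv ≫ (P.p ⊗ₘ 𝟙 (𝟙_ C)))
  have e : ((η_ P.X (P.X)ᘁ ≫ (P.p ⊗ₘ (P.p)ᘁ)) ⊗ₘ P.p) ≫ ((P.p ⊗ₘ (P.p)ᘁ) ⊗ₘ P.p) =
      ((η_ P.X (P.X)ᘁ ≫ (P.p ⊗ₘ (P.p)ᘁ)) ⊗ₘ P.p) := by
    rw [tensorHom_comp_tensorHom, Category.assoc, tensorHom_comp_tensorHom, P.idem,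
      ← comp_rightAdjointMate, P.idem]
  rw [Category.assoc, reassoc_of% e, coev_eq, ev_eq]
  exact snake_aux' P.idem (ExactPairing.evaluation_coevaluation P.X (P.X)ᘁ)

instance exactPairing (P : Karoubi C) : ExactPairing P (dual P) where
  coevaluation' := coev P
  evaluation' := ev P
  coevaluation_evaluation' := snake_left P
  evaluation_coevaluation' := snake_right P

instance : RightRigidCategory (Karoubi C) where
  rightDual P := { rightDual := dual P, exact := exactPairing P }

end Dual

end KaroubiTensor

end Deligne

namespace Deligne

/-! ### Ribbon categories and ambidextrous traces -/

/-- A twist on a braided category with right duals; with it the category is a ribbon category. -/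
class Twist (C : Type*) [Category* C] [MonoidalCategory C] [BraidedCategory C]
    [RightRigidCategory C] where
  twist : ∀ X : C, X ≅ X
  twist_naturality : ∀ {X Y : C} (f : X ⟶ Y), f ≫ (twist Y).hom = (twist X).hom ≫ f
  twist_tensor : ∀ X Y : C, (twist (X ⊗ Y)).hom =
    (β_ X Y).hom ≫ (β_ Y X).hom ≫ ((twist X).hom ⊗ₘ (twist Y).hom)
  twist_dual : ∀ X : C, (twist (Xᘁ)).hom = ((twist X).hom)ᘁ

/-- In a symmetric category with duals the identity morphisms are a twist. -/
abbrev Twist.ofSymmetric (C : Type*) [Category* C] [MonoidalCategory C] [SymmetricCategory C]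
    [RightRigidCategory C] : Twist C where
  twist X := Iso.refl X
  twist_naturality f := by simp
  twist_tensor X Y := by simp
  twist_dual X := by simp

section Trace

variable {C : Type*} [Category* C] [MonoidalCategory C] [BraidedCategory C]
  [RightRigidCategory C] [Twist C]

/-- The second coevaluation `𝟙 ⟶ V* ⊗ V`, namely `(id ⊗ θ) ∘ c ∘ coev`. -/
def coev' (V : C) : 𝟙_ C ⟶ Vᘁ ⊗ V :=
  η_ V Vᘁ ≫ (β_ V Vᘁ).hom ≫ Vᘁ ◁ (Twist.twist V).hom

/-- The second evaluation `V ⊗ V* ⟶ 𝟙`, namely `ev ∘ c ∘ (θ ⊗ id)`. -/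
def ev' (V : C) : V ⊗ Vᘁ ⟶ 𝟙_ C :=
  (Twist.twist V).hom ▷ Vᘁ ≫ (β_ V Vᘁ).hom ≫ ε_ V Vᘁ

/-- Left partial trace `(ev_V ⊗ id_W) ∘ (id_{V*} ⊗ f) ∘ (coev'_V ⊗ id_W)`. -/
def trL {V W : C} (f : V ⊗ W ⟶ V ⊗ W) : W ⟶ W :=
  (λ_ W).inv ≫ coev' V ▷ W ≫ (α_ Vᘁ V W).hom ≫ Vᘁ ◁ f ≫ (α_ Vᘁ V W).inv ≫
    ε_ V Vᘁ ▷ W ≫ (λ_ W).hom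

/-- Right partial trace `(id_V ⊗ ev'_W) ∘ (f ⊗ id_{W*}) ∘ (id_V ⊗ coev_W)`. -/
def trR {V W : C} (f : V ⊗ W ⟶ V ⊗ W) : V ⟶ V :=
  (ρ_ V).inv ≫ V ◁ η_ W Wᘁ ≫ (α_ V W Wᘁ).inv ≫ f ▷ Wᘁ ≫ (α_ V W Wᘁ).hom ≫
    V ◁ ev' W ≫ (ρ_ V).hom

/-- A linear functional `τ` on `End J` is an ambidextrous trace on `J` if it takes the same value
on the left and right partial traces of every endomorphism of `J ⊗ J`. -/
def IsAmbidextrousTrace {F : Type*} [Field F] [Preadditive C] [Linear F C] {J : C}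
    (τ : (J ⟶ J) →ₗ[F] F) : Prop :=
  ∀ h : J ⊗ J ⟶ J ⊗ J, τ (trL h) = τ (trR h)

end Trace

/-! ### Deligne's category and the object `M_n` -/

open Idempotents

/-- Deligne's category `Rep(S_t)`: the idempotent completion of the additive envelope of the
skeleton. -/
abbrev DeligneRep (F : Type*) [Field F] (t : F) : Type _ := Karoubi (Mat_ (Rep0 F t))

variable {F : Type*} [Field F] (t : F)

/-- The twist on Deligne's category is the identity. -/
instance : Twist (DeligneRep F t) := Twist.ofSymmetric _

/-- The object `[n]` of the skeleton. -/
abbrev brak (n : ℕ) : Rep0 F t := ⟨Fin n⟩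

/-- The antisymmetrizer `s_n = (1/n!) ∑ sgn(σ) σ`. -/
def antisymmetrizer (n : ℕ) : brak t n ⟶ brak t n :=
  ((n.factorial : F)⁻¹) • ∑ σ : Equiv.Perm (Fin n), ((Equiv.Perm.sign σ : ℤ) : F) • (Rep0.bij σ : brak t n ⟶ brak t n)

/-- The diagram `x_n`: the identity diagram with the edge between the last vertices removed. -/
def lastRemoved (n : ℕ) : brak t n ⟶ brak t n :=
  Rep0.diag (bijDiagramRemove (Equiv.refl (Fin n)) {i | i.val + 1 = n}) 1

theorem bij_comp_antisymmetrizer (n : ℕ) (σ : Equiv.Perm (Fin n)) :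
    (Rep0.bij σ : brak t n ⟶ brak t n) ≫ antisymmetrizer t n =
      ((Equiv.Perm.sign σ : ℤ) : F) • antisymmetrizer t n := by
  unfold antisymmetrizer
  rw [Linear.comp_smul, Preadditive.comp_sum, smul_comm]
  refine congrArg (fun z : brak t n ⟶ brak t n => ((n.factorial : F)⁻¹) • z) ?_
  rw [Finset.smul_sum]
  refine Fintype.sum_equiv (Equiv.mulRight σ) _ _ fun τ => ?_
  have h : (((Equiv.Perm.sign σ : ℤ) : F) *
      (((Equiv.Perm.sign τ * Equiv.Perm.sign σ : ℤˣ) : ℤ) : F)) =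
      ((Equiv.Perm.sign τ : ℤ) : F) := by
    rcases Int.units_eq_one_or (Equiv.Perm.sign σ) with h | h <;> simp [h]
  rw [Linear.comp_smul, Rep0.bij_comp_bij, smul_smul, Equiv.coe_mulRight, map_mul, h]
  rfl

variable [CharZero F]

theorem antisymmetrizer_idem (n : ℕ) :
    antisymmetrizer t n ≫ antisymmetrizer t n = antisymmetrizer t n := by
  conv_lhs => lhs; unfold antisymmetrizer
  rw [Linear.smul_comp, Preadditive.sum_comp]
  have h : ∀ σ : Equiv.Perm (Fin n), 
      (((Equiv.Perm.sign σ : ℤ) : F) • (Rep0.bij σ : brak t n ⟶ brak t n)) ≫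
      antisymmetrizer t n = antisymmetrizer t n := by
    intro σ
    rw [Linear.smul_comp, bij_comp_antisymmetrizer, smul_smul]
    rcases Int.units_eq_one_or (Equiv.Perm.sign σ) with h | h <;> simp [h]
  rw [Finset.sum_congr rfl fun σ _ => h σ, Finset.sum_const, Finset.card_univ, Fintype.card_perm,
    Fintype.card_fin, ← Nat.cast_smul_eq_nsmul F, smul_smul,
    inv_mul_cancel₀ (Nat.cast_ne_zero.2 (Nat.factorial_ne_zero n)), one_smul]

/-- The object `M_n = ([n], s_n)` of Deligne's category. -/
def M (n : ℕ) : DeligneRep F t where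
  X := (Mat_.embedding (Rep0 F t)).obj (brak t n)
  p := (Mat_.embedding (Rep0 F t)).map (antisymmetrizer t n)
  idem := by rw [← Functor.map_comp, antisymmetrizer_idem]

/-- The endomorphism of `M_n` given by `s_n`. -/
def sEnd (n : ℕ) : M t n ⟶ M t n where
  f := (Mat_.embedding (Rep0 F t)).map (antisymmetrizer t n)
  comm := by
    simp only [M]
    rw [← Functor.map_comp, ← Functor.map_comp, antisymmetrizer_idem, antisymmetrizer_idem]

/-- The endomorphism of `M_n` given by `s_n x_n s_n`. -/
def sxsEnd (n : ℕ) : M t n ⟶ M t n where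
  f := (Mat_.embedding (Rep0 F t)).map
    (antisymmetrizer t n ≫ lastRemoved t n ≫ antisymmetrizer t n)
  comm := by
    simp only [M]
    rw [← Functor.map_comp, ← Functor.map_comp, Category.assoc, Category.assoc,
      antisymmetrizer_idem, reassoc_of% (antisymmetrizer_idem t n)]

end Deligne

end

/-!
# An ambidextrous trace on the exterior powers in Deligne's category

All diagrams are studied through their compatible labellings. For a diagram `ρ` from `[n]` to `[n]`
let `signSum ρ` be the sum of `sgn σ` over the permutations `σ` whose diagram is coarser than `ρ`,
and let `signTrace` be its linear extension to `End [n]`. It is unchanged by composition with `s_n`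
on either side, and it equals `1` on the identity and on `x_n`, since a permutation which fixes all
points but one is trivial. Hence its restriction `ambiTrace` to `End M_n` takes the value `1` on
`s_n` and on `s_n x_n s_n`.

*The trace property.* The functional is a substitute for the categorical trace divided by its value
on `s_n`, in a form which makes sense for all `t`: for a finite set `T` with `d` elements,
`∑_σ sgn σ · #{u : [n] → T | ρ is compatible with (u ∘ σ, u)} = d (d - 1) ⋯ (d - n + 1) · signSum ρ`
(`sum_sign_compat`). Indeed the terms of a non-injective `u` cancel in pairs, and an injective `u`
can be cancelled from the condition. Now let `h = (s_n ⊗ s_n) π` with a diagram `π`. The values of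
the functional at the two partial traces of `h` are polynomials in the parameter `t` with
coefficients not depending on `t`. When `t` is a natural number `d`, multiplying either by
`d (d - 1) ⋯ (d - n + 1)` gives the signed number of labellings of `π` closed up on both sides. So
the polynomials agree at all natural numbers `d ≥ n` and are equal (`sum_sign_closes_eq`).

To apply this in `Rep(S_t)`, the partial traces there are reduced to those of the skeleton: by
`KaroubiTensor.ptL_f` the idempotents in the duality morphisms are absorbed by `h`, and by
`MatTensor.ent_ptL` matrices of size one are handled entrywise. `Rep0.ptL_diag` computes the
partial trace of a diagram.

*The basis.* If interchanging two top or two bottom vertices fixes `ρ`, then `s_n ρ s_n` equals its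
negative and vanishes. Otherwise `ρ` is the diagram of a permutation with at most one edge removed
(`exists_eq_bijDiagramRemove`), so that `s_n ρ s_n` is `s_n` or `s_n x_n s_n` up to sign. These two
are independent: the identity diagram occurs in the first and not in the second, and
`signTrace` does not vanish on the second.
-/

noncomputable section

namespace Deligne

/-! ### Signed sums over compatible permutations -/

section SignSum

open scoped Classical in
/-- The signed number of permutations `σ` whose diagram is coarser than `ρ`. -/
def signSum {n : ℕ} (ρ : Setoid (Fin n ⊕ Fin n)) : ℤ :=
  ∑ σ : Equiv.Perm (Fin n), if Compat ρ σ id then (Equiv.Perm.sign σ : ℤ) else 0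

theorem Compat.comp {U V T T' : Type} {π : Setoid (U ⊕ V)} {u : U → T} {v : V → T}
    (h : Compat π u v) (f : T → T') : Compat π (f ∘ u) (f ∘ v) := by
  intro x y hxy
  have := congrArg f (h hxy)
  rcases x with x | x <;> rcases y with y | y <;> exact this

theorem compat_comp_iff {U V T T' : Type} {π : Setoid (U ⊕ V)} {u : U → T} {v : V → T}
    {f : T → T'} (hf : f.Injective) : Compat π (f ∘ u) (f ∘ v) ↔ Compat π u v := by
  refine ⟨fun h x y hxy => hf ?_, fun h => h.comp f⟩
  have := h hxy
  rcases x with x | x <;> rcases y with y | y <;> exact this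

open scoped Classical in
/-- For a labelling `u` which is not injective, the terms of `σ` and `swap i j * σ` cancel when
`u i = u j`; for an injective one, `u` can be cancelled from the compatibility condition. -/
theorem sum_sign_compat_labelling {n : ℕ} (ρ : Setoid (Fin n ⊕ Fin n)) {T : Type}
    (u : Fin n → T) :
    (∑ σ : Equiv.Perm (Fin n), if Compat ρ (u ∘ σ) u then (Equiv.Perm.sign σ : ℤ) else 0) =
      if u.Injective then signSum ρ else 0 := by
  split_ifs with hu
  · refine Finset.sum_congr rfl fun σ _ => ?_
    rw [← compat_comp_iff hu (u := σ) (v := id), Function.comp_id]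
  · obtain ⟨i, j, hij, hne⟩ := Function.not_injective_iff.1 hu
    have hs : u ∘ Equiv.swap i j = u := by
      funext a
      rcases eq_or_ne a i with rfl | hai
      · simp [hij]
      rcases eq_or_ne a j with rfl | haj
      · simp [hij]
      · simp [Equiv.swap_apply_of_ne_of_ne hai haj]
    refine Finset.sum_ninvolution (fun σ => Equiv.swap i j * σ) ?_ ?_ ?_ ?_
    · intro σ
      rw [Equiv.Perm.coe_mul, ← Function.comp_assoc, hs, Equiv.Perm.sign_mul,
        Equiv.Perm.sign_swap hne]
      split_ifs <;> simp
    · intro σ _ h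
      exact hne (Equiv.swap_eq_one_iff.1 (mul_eq_right.1 h))
    · simp
    · intro σ
      simp [← mul_assoc]

open scoped Classical in
theorem sum_sign_compat {n : ℕ} (ρ : Setoid (Fin n ⊕ Fin n)) (T : Type) [Fintype T] :
    (∑ u : Fin n → T, ∑ σ : Equiv.Perm (Fin n),
      if Compat ρ (u ∘ σ) u then (Equiv.Perm.sign σ : ℤ) else 0) =
      ((Fintype.card T).descFactorial n : ℤ) * signSum ρ := by
  have hc : Fintype.card {u : Fin n → T // u.Injective} = (Fintype.card T).descFactorial n := by
    rw [Fintype.card_congr (Equiv.subtypeInjectiveEquivEmbedding (Fin n) T),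
      Fintype.card_embedding_eq, Fintype.card_fin]
  rw [Finset.sum_congr rfl fun u _ => sum_sign_compat_labelling ρ u, ← Finset.sum_filter,
    Finset.sum_const, ← Fintype.card_subtype, hc, nsmul_eq_mul]

theorem compat_bij_iff_eq {n : ℕ} (σ τ : Equiv.Perm (Fin n)) :
    Compat (bijDiagram σ) τ id ↔ σ = τ := by
  rw [compat_bij, Function.id_comp, DFunLike.coe_fn_eq, eq_comm]

theorem signSum_bij {n : ℕ} (σ : Equiv.Perm (Fin n)) :
    signSum (bijDiagram σ) = Equiv.Perm.sign σ := by
  simp [signSum, compat_bij_iff_eq]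

theorem signSum_comap_left {n : ℕ} (σ : Equiv.Perm (Fin n)) (ρ : Setoid (Fin n ⊕ Fin n)) :
    signSum (ρ.comap (Sum.map σ id)) = Equiv.Perm.sign σ * signSum ρ := by
  classical
  rw [signSum, signSum, Finset.mul_sum]
  refine Fintype.sum_equiv (Equiv.mulRight σ⁻¹) _ _ fun τ => ?_
  rw [Equiv.coe_mulRight, compat_comap_left, Equiv.Perm.coe_mul, Equiv.Perm.inv_def]
  rcases Int.units_eq_one_or (Equiv.Perm.sign σ) with h | h <;> simp [h]

theorem signSum_comap_right {n : ℕ} (σ : Equiv.Perm (Fin n)) (ρ : Setoid (Fin n ⊕ Fin n)) :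
    signSum (ρ.comap (Sum.map id σ.symm)) = Equiv.Perm.sign σ * signSum ρ := by
  classical
  rw [signSum, signSum, Finset.mul_sum]
  refine Fintype.sum_equiv (Equiv.mulLeft σ⁻¹) _ _ fun τ => ?_
  rw [Equiv.coe_mulLeft, compat_comap_right, ← compat_comp_iff σ.injective (v := id),
    Equiv.Perm.coe_mul, ← Function.comp_assoc, ← Equiv.Perm.coe_mul, mul_inv_cancel,
    Equiv.Perm.coe_one, Function.id_comp, Function.id_comp, Function.comp_id]
  rcases Int.units_eq_one_or (Equiv.Perm.sign σ) with h | h <;> simp [h]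

theorem compat_bijDiagramRemove {U V T : Type} (e : U ≃ V) (I : Set U) (u : U → T) (v : V → T) :
    Compat (bijDiagramRemove e I) u v ↔ ∀ i, i ∉ I → u i = v (e i) := by
  classical
  rw [bijDiagramRemove, compat_ker]
  constructor
  · intro h i hi
    exact h (Sum.inl i) (Sum.inr (e i)) (by simp [hi])
  · intro h x y hxy
    rcases x with x | x <;> rcases y with y | y <;> simp only [Sum.elim_inl, Sum.elim_inr] at hxy ⊢
    · split_ifs at hxy with hx hy hy
      · rw [Sum.inl_injective hxy]
      · rw [h _ hx, h _ hy, Sum.inr_injective hxy]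
    · split_ifs at hxy with hx
      rw [h _ hx, Sum.inr_injective hxy]
    · split_ifs at hxy with hx
      rw [h _ hx, Sum.inr_injective hxy]
    · rw [Sum.inr_injective hxy]

/-- A permutation is determined by its values off one point. -/
theorem signSum_bijDiagramRemove {n : ℕ} {I : Set (Fin n)} (hI : I.Subsingleton) :
    signSum (bijDiagramRemove (Equiv.refl (Fin n)) I) = 1 := by
  classical
  have : ∀ σ : Equiv.Perm (Fin n),
      Compat (bijDiagramRemove (Equiv.refl (Fin n)) I) σ id ↔ σ = 1 := by
    intro σ
    rw [compat_bijDiagramRemove]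
    constructor
    · intro h
      by_contra hne
      obtain ⟨i, hi⟩ : ∃ i, σ i ≠ i := by
        by_contra! hc
        exact hne (Equiv.ext hc)
      have hiI : i ∈ I := by_contra fun hc => hi (h i hc)
      have h2 : σ i ∈ I := by_contra fun hc => hi (σ.injective (h (σ i) hc))
      exact hi (hI h2 hiI)
    · rintro rfl i _
      rfl
  simp [signSum, this]

/-! ### Closing one side of a diagram -/

/-- Joining each top vertex of `π` in `V` to the corresponding bottom vertex yields the diagram `ρ`
together with `k` closed blocks. This is expressed by counting compatible labellings, which
determines `ρ` and `k`. -/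
def ClosesLeft {V W : Type} (π : Setoid ((V ⊕ W) ⊕ (V ⊕ W))) (ρ : Setoid (W ⊕ W)) (k : ℕ) :
    Prop :=
  ∀ (T : Type) [Finite T] (w w' : W → T),
    Nat.card {v : V → T // Compat π (Sum.elim v w) (Sum.elim v w')} =
      open scoped Classical in if Compat ρ w w' then Nat.card T ^ k else 0

/-- Joining each top vertex of `π` in `W` to the corresponding bottom vertex yields the diagram `ρ`
together with `k` closed blocks. -/
def ClosesRight {V W : Type} (π : Setoid ((V ⊕ W) ⊕ (V ⊕ W))) (ρ : Setoid (V ⊕ V)) (k : ℕ) :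
    Prop :=
  ∀ (T : Type) [Finite T] (v v' : V → T),
    Nat.card {w : W → T // Compat π (Sum.elim v w) (Sum.elim v' w)} =
      open scoped Classical in if Compat ρ v v' then Nat.card T ^ k else 0

open scoped Classical in
/-- The number of pairs of labellings of `[n]` which are compatible with `π` when the top labels are
permuted by `σ` and `τ`. -/
def pairCount {n : ℕ} (π : Setoid ((Fin n ⊕ Fin n) ⊕ (Fin n ⊕ Fin n))) (T : Type) [Fintype T]
    (σ τ : Equiv.Perm (Fin n)) : ℤ :=
  ∑ v : Fin n → T, ∑ w : Fin n → T,
    if Compat π (Sum.elim (v ∘ σ) (w ∘ τ)) (Sum.elim v w) then 1 else 0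

theorem compat_comap_sumCongr {n : ℕ} (π : Setoid ((Fin n ⊕ Fin n) ⊕ (Fin n ⊕ Fin n))) {T : Type}
    (σ τ : Equiv.Perm (Fin n)) (v w : Fin n → T) (x : Fin n ⊕ Fin n → T) :
    Compat (π.comap (Sum.map (σ.sumCongr τ) id)) (Sum.elim v w) x ↔
      Compat π (Sum.elim (v ∘ ⇑σ⁻¹) (w ∘ ⇑τ⁻¹)) x := by
  rw [compat_comap_left]
  have : Sum.elim v w ∘ (σ.sumCongr τ).symm = Sum.elim (v ∘ ⇑σ⁻¹) (w ∘ ⇑τ⁻¹) := by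
    funext a
    rcases a with a | a <;> rfl
  rw [this]

variable {n : ℕ} {π : Setoid ((Fin n ⊕ Fin n) ⊕ (Fin n ⊕ Fin n))} {ρ : Setoid (Fin n ⊕ Fin n)}
  {k : ℕ} {σ τ : Equiv.Perm (Fin n)}

theorem ClosesLeft.descFactorial_mul (T : Type) [Fintype T]
    (h : ClosesLeft (π.comap (Sum.map (σ.sumCongr τ) id)) ρ k) :
    ((Fintype.card T).descFactorial n : ℤ) * ((Fintype.card T : ℤ) ^ k * signSum ρ) =
      ∑ α : Equiv.Perm (Fin n), (Equiv.Perm.sign α : ℤ) * pairCount π T σ⁻¹ (α * τ⁻¹) := by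
  classical
  rw [mul_left_comm, ← sum_sign_compat, Finset.mul_sum]
  refine (Finset.sum_congr rfl fun u _ => Finset.mul_sum _ _ _).trans ?_
  rw [Finset.sum_comm]
  refine Finset.sum_congr rfl fun α _ => ?_
  rw [pairCount, Finset.sum_comm, Finset.mul_sum]
  refine Finset.sum_congr rfl fun w _ => ?_
  have := h T (w ∘ α) w
  rw [Nat.card_eq_fintype_card, Fintype.card_subtype, Finset.card_filter,
    Nat.card_eq_fintype_card] at this
  have h2 := congrArg (Nat.cast : ℕ → ℤ) this
  push_cast at h2
  simp only [compat_comap_sumCongr, Function.comp_assoc, ← Equiv.Perm.coe_mul] at h2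
  rw [h2]
  split_ifs <;> ring

theorem ClosesRight.descFactorial_mul (T : Type) [Fintype T]
    (h : ClosesRight (π.comap (Sum.map (σ.sumCongr τ) id)) ρ k) :
    ((Fintype.card T).descFactorial n : ℤ) * ((Fintype.card T : ℤ) ^ k * signSum ρ) =
      ∑ α : Equiv.Perm (Fin n), (Equiv.Perm.sign α : ℤ) * pairCount π T (α * σ⁻¹) τ⁻¹ := by
  classical
  rw [mul_left_comm, ← sum_sign_compat, Finset.mul_sum]
  refine (Finset.sum_congr rfl fun u _ => Finset.mul_sum _ _ _).trans ?_
  rw [Finset.sum_comm]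
  refine Finset.sum_congr rfl fun α _ => ?_
  rw [pairCount, Finset.mul_sum]
  refine Finset.sum_congr rfl fun v _ => ?_
  have := h T (v ∘ α) v
  rw [Nat.card_eq_fintype_card, Fintype.card_subtype, Finset.card_filter,
    Nat.card_eq_fintype_card] at this
  have h2 := congrArg (Nat.cast : ℕ → ℤ) this
  push_cast at h2
  simp only [compat_comap_sumCongr, Function.comp_assoc, ← Equiv.Perm.coe_mul] at h2
  rw [h2]
  split_ifs <;> ring

/-- In the sum over `τ`, the permutation `α` of the factor which stays open is absorbed, so that
each `α` contributes the same amount. -/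
theorem sum_sign_mul_right (f : Equiv.Perm (Fin n) → ℤ) :
    (∑ τ : Equiv.Perm (Fin n), (Equiv.Perm.sign τ : ℤ) *
      ∑ α : Equiv.Perm (Fin n), (Equiv.Perm.sign α : ℤ) * f (α * τ⁻¹)) =
      n.factorial * ∑ τ : Equiv.Perm (Fin n), (Equiv.Perm.sign τ : ℤ) * f τ := by
  simp only [Finset.mul_sum]
  rw [Finset.sum_comm]
  rw [Finset.sum_congr rfl (g := fun _ => ∑ τ : Equiv.Perm (Fin n), (Equiv.Perm.sign τ : ℤ) * f τ)]
  · rw [Finset.sum_const, Finset.card_univ, Fintype.card_perm, Fintype.card_fin, nsmul_eq_mul,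
      Finset.mul_sum]
  · intro α _
    refine Fintype.sum_equiv ((Equiv.inv _).trans (Equiv.mulLeft α)) _ _ fun τ => ?_
    rw [Equiv.trans_apply, Equiv.coe_mulLeft, Equiv.inv_apply, Equiv.Perm.sign_mul,
      Equiv.Perm.sign_inv]
    push_cast
    ring

/-- Both closures of the antisymmetrized diagram have the same weighted signed sum. For a natural
number `d` both sides, multiplied by the falling factorial of `d`, count labellings of
the diagram closed on both sides; so the two polynomials agree at all `d ≥ n`. -/
theorem sum_sign_closes_eq {R : Type*} [CommRing R]
    (π : Setoid ((Fin n ⊕ Fin n) ⊕ (Fin n ⊕ Fin n)))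
    (ρ ρ' : Equiv.Perm (Fin n) → Equiv.Perm (Fin n) → Setoid (Fin n ⊕ Fin n))
    (k k' : Equiv.Perm (Fin n) → Equiv.Perm (Fin n) → ℕ)
    (h : ∀ σ τ, ClosesLeft (π.comap (Sum.map (σ.sumCongr τ) id)) (ρ σ τ) (k σ τ))
    (h' : ∀ σ τ, ClosesRight (π.comap (Sum.map (σ.sumCongr τ) id)) (ρ' σ τ) (k' σ τ)) (t : R) :
    (∑ σ : Equiv.Perm (Fin n), ∑ τ : Equiv.Perm (Fin n),
      ((Equiv.Perm.sign σ : ℤ) : R) * ((Equiv.Perm.sign τ : ℤ) : R) *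
        (t ^ k σ τ * (signSum (ρ σ τ) : R))) =
    ∑ σ : Equiv.Perm (Fin n), ∑ τ : Equiv.Perm (Fin n),
      ((Equiv.Perm.sign σ : ℤ) : R) * ((Equiv.Perm.sign τ : ℤ) : R) *
        (t ^ k' σ τ * (signSum (ρ' σ τ) : R)) := by
  let P : (Equiv.Perm (Fin n) → Equiv.Perm (Fin n) → ℕ) →
      (Equiv.Perm (Fin n) → Equiv.Perm (Fin n) → Setoid (Fin n ⊕ Fin n)) → Polynomial ℤ :=
    fun k ρ => ∑ σ : Equiv.Perm (Fin n), ∑ τ : Equiv.Perm (Fin n),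
      Polynomial.C (Equiv.Perm.sign σ : ℤ) * Polynomial.C (Equiv.Perm.sign τ : ℤ) *
        (Polynomial.X ^ k σ τ * Polynomial.C (signSum (ρ σ τ)))
  have hP : P k ρ = P k' ρ' := by
    refine Polynomial.eq_of_infinite_eval_eq _ _ ?_
    refine Set.Infinite.mono (s := Nat.cast '' Set.Ici n) ?_
      ((Set.Ici_infinite n).image Nat.cast_injective.injOn)
    rintro _ ⟨d, hd, rfl⟩
    have hd0 : (d.descFactorial n : ℤ) ≠ 0 := by
      exact_mod_cast (Nat.descFactorial_pos.2 hd).ne'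
    refine mul_left_cancel₀ hd0 ?_
    simp only [P, Polynomial.eval_finsetSum, Polynomial.eval_mul, Polynomial.eval_C,
      Polynomial.eval_pow, Polynomial.eval_X]
    have hL : ∀ σ τ, (d.descFactorial n : ℤ) * ((Equiv.Perm.sign σ : ℤ) * (Equiv.Perm.sign τ : ℤ) *
        ((d : ℤ) ^ k σ τ * signSum (ρ σ τ))) = (Equiv.Perm.sign σ : ℤ) * ((Equiv.Perm.sign τ : ℤ) *
        ∑ α : Equiv.Perm (Fin n), (Equiv.Perm.sign α : ℤ) *
          pairCount π (Fin d) σ⁻¹ (α * τ⁻¹)) := by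
      intro σ τ
      rw [← (h σ τ).descFactorial_mul (Fin d), Fintype.card_fin]
      ring
    have hR : ∀ σ τ, (d.descFactorial n : ℤ) * ((Equiv.Perm.sign σ : ℤ) * (Equiv.Perm.sign τ : ℤ) *
        ((d : ℤ) ^ k' σ τ * signSum (ρ' σ τ))) = (Equiv.Perm.sign τ : ℤ) *
        ((Equiv.Perm.sign σ : ℤ) * ∑ α : Equiv.Perm (Fin n), (Equiv.Perm.sign α : ℤ) *
          pairCount π (Fin d) (α * σ⁻¹) τ⁻¹) := by
      intro σ τ
      rw [← (h' σ τ).descFactorial_mul (Fin d), Fintype.card_fin]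
      ring
    rw [Finset.mul_sum, Finset.mul_sum]
    simp only [Finset.mul_sum Finset.univ _ (d.descFactorial n : ℤ), hL, hR]
    conv_rhs => rw [Finset.sum_comm]
    rw [Finset.sum_congr rfl fun σ _ => (Finset.mul_sum _ _ _).symm]
    conv_rhs => rw [Finset.sum_congr rfl fun τ _ => (Finset.mul_sum _ _ _).symm]
    have hinv : ∀ f : Equiv.Perm (Fin n) → ℤ,
        ∑ σ : Equiv.Perm (Fin n), (Equiv.Perm.sign σ : ℤ) * f σ⁻¹ =
          ∑ σ : Equiv.Perm (Fin n), (Equiv.Perm.sign σ : ℤ) * f σ := fun f =>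
      Fintype.sum_equiv (Equiv.inv _) _ _ fun σ => by simp
    simp only [sum_sign_mul_right (pairCount π (Fin d) _)]
    rw [Finset.sum_congr rfl fun τ (_ : τ ∈ Finset.univ) =>
      congrArg _ (sum_sign_mul_right fun σ => pairCount π (Fin d) σ τ⁻¹)]
    rw [hinv fun σ => n.factorial * ∑ τ : Equiv.Perm (Fin n), (Equiv.Perm.sign τ : ℤ) *
        pairCount π (Fin d) σ τ,
      hinv fun τ => n.factorial * ∑ σ : Equiv.Perm (Fin n), (Equiv.Perm.sign σ : ℤ) *
        pairCount π (Fin d) σ τ]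
    simp only [Finset.mul_sum]
    rw [Finset.sum_comm]
    refine Finset.sum_congr rfl fun τ _ => Finset.sum_congr rfl fun σ _ => ?_
    ring
  have := congrArg (Polynomial.aeval t) hP
  simpa [P] using this

end SignSum

/-! ### Partial traces in a symmetric category with duals -/

section Partial

variable {C : Type*} [Category* C] [MonoidalCategory C] [SymmetricCategory C]
  [RightRigidCategory C]

/-- The left partial trace for the trivial twist. -/
def ptL {V W : C} (f : V ⊗ W ⟶ V ⊗ W) : W ⟶ W :=
  (λ_ W).inv ≫ (η_ V Vᘁ ≫ (β_ V Vᘁ).hom) ▷ W ≫ (α_ Vᘁ V W).hom ≫ Vᘁ ◁ f ≫ (α_ Vᘁ V W).inv ≫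
    ε_ V Vᘁ ▷ W ≫ (λ_ W).hom

/-- The right partial trace for the trivial twist. -/
def ptR {V W : C} (f : V ⊗ W ⟶ V ⊗ W) : V ⟶ V :=
  (ρ_ V).inv ≫ V ◁ η_ W Wᘁ ≫ (α_ V W Wᘁ).inv ≫ f ▷ Wᘁ ≫ (α_ V W Wᘁ).hom ≫
    V ◁ ((β_ W Wᘁ).hom ≫ ε_ W Wᘁ) ≫ (ρ_ V).hom

variable {V W : C}

/-- Idempotents on the strands of the left partial trace can be slid along the loop and absorbed
by an endomorphism which is invariant under them. -/
theorem ptL_of_idem {p : V ⟶ V} {q : W ⟶ W} (hp : p ≫ p = p) (hq : q ≫ q = q)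
    {f : V ⊗ W ⟶ V ⊗ W} (h1 : (p ⊗ₘ q) ≫ f = f) (h2 : f ≫ (p ⊗ₘ q) = f) :
    ((λ_ W).inv ≫ (𝟙 (𝟙_ C) ⊗ₘ q)) ≫
    (((η_ V Vᘁ ≫ (p ⊗ₘ pᘁ)) ≫ (p ⊗ₘ pᘁ) ≫ (β_ V Vᘁ).hom) ⊗ₘ q) ≫
    (((pᘁ ⊗ₘ p) ⊗ₘ q) ≫ (α_ Vᘁ V W).hom) ≫
    (pᘁ ⊗ₘ f) ≫
    ((α_ Vᘁ V W).inv ≫ ((pᘁ ⊗ₘ p) ⊗ₘ q)) ≫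
    (((pᘁ ⊗ₘ p) ≫ ε_ V Vᘁ) ⊗ₘ q) ≫
    ((𝟙 (𝟙_ C) ⊗ₘ q) ≫ (λ_ W).hom) = ptL f := by
  have hp' : pᘁ ≫ pᘁ = pᘁ := by rw [← comp_rightAdjointMate, hp]
  have h3 : (p ⊗ₘ 𝟙 W) ≫ f = f := by
    rw [← h1, tensorHom_comp_tensorHom_assoc, hp, Category.id_comp]
  have hη : η_ V Vᘁ ≫ (p ⊗ₘ pᘁ) = η_ V Vᘁ ≫ (p ⊗ₘ 𝟙 _) := by
    rw [tensorHom_def', coevaluation_comp_rightAdjointMate_assoc, ← comp_whiskerRight, hp,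
      tensorHom_id]
  have e1 : ((λ_ W).inv ≫ (𝟙 (𝟙_ C) ⊗ₘ q)) ≫
      (((η_ V Vᘁ ≫ (p ⊗ₘ pᘁ)) ≫ (p ⊗ₘ pᘁ) ≫ (β_ V Vᘁ).hom) ⊗ₘ q) ≫
      (((pᘁ ⊗ₘ p) ⊗ₘ q) ≫ (α_ Vᘁ V W).hom) =
      ((λ_ W).inv ≫ ((η_ V Vᘁ ≫ (β_ V Vᘁ).hom) ⊗ₘ 𝟙 W) ≫ (α_ Vᘁ V W).hom) ≫
        (pᘁ ⊗ₘ (p ⊗ₘ q)) := by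
    simp only [Category.assoc]
    rw [← associator_naturality]
    simp only [Category.assoc, tensorHom_comp_tensorHom_assoc, Category.id_comp,
      ← BraidedCategory.braiding_naturality, hp, hp', hq]
  have e2 : ((α_ Vᘁ V W).inv ≫ ((pᘁ ⊗ₘ p) ⊗ₘ q)) ≫
      (((pᘁ ⊗ₘ p) ≫ ε_ V Vᘁ) ⊗ₘ q) ≫ ((𝟙 (𝟙_ C) ⊗ₘ q) ≫ (λ_ W).hom) =
      (pᘁ ⊗ₘ (p ⊗ₘ q)) ≫ (α_ Vᘁ V W).inv ≫ (ε_ V Vᘁ ⊗ₘ 𝟙 W) ≫ (λ_ W).hom := by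
    rw [associator_inv_naturality_assoc]
    simp only [Category.assoc, tensorHom_comp_tensorHom_assoc, Category.comp_id, hp, hp', hq]
  have e3 : ((λ_ W).inv ≫ ((η_ V Vᘁ ≫ (β_ V Vᘁ).hom) ⊗ₘ 𝟙 W) ≫ (α_ Vᘁ V W).hom) ≫
      (pᘁ ⊗ₘ (p ⊗ₘ 𝟙 W)) =
      ((λ_ W).inv ≫ ((η_ V Vᘁ ≫ (β_ V Vᘁ).hom) ⊗ₘ 𝟙 W) ≫ (α_ Vᘁ V W).hom) ≫
      (𝟙 _ ⊗ₘ (p ⊗ₘ 𝟙 W)) := by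
    simp only [Category.assoc]
    rw [← associator_naturality, ← associator_naturality]
    simp only [Category.assoc, tensorHom_comp_tensorHom_assoc, Category.id_comp,
      ← BraidedCategory.braiding_naturality]
    rw [reassoc_of% hη]
  have e4 : (pᘁ ⊗ₘ (p ⊗ₘ q)) ≫ (pᘁ ⊗ₘ f) ≫ (pᘁ ⊗ₘ (p ⊗ₘ q)) =
      (pᘁ ⊗ₘ (p ⊗ₘ 𝟙 W)) ≫ (𝟙 _ ⊗ₘ f) := by
    simp only [tensorHom_comp_tensorHom, h1, h2, h3, hp', Category.comp_id]
  have e5 : (𝟙 Vᘁ ⊗ₘ (p ⊗ₘ 𝟙 W)) ≫ (𝟙 _ ⊗ₘ f) = 𝟙 _ ⊗ₘ f := by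
    rw [tensorHom_comp_tensorHom, h3, Category.comp_id]
  rw [e2]
  simp only [Category.assoc]
  rw [reassoc_of% e1, reassoc_of% e4, reassoc_of% e3, reassoc_of% e5]
  simp only [ptL, id_tensorHom, tensorHom_id]

/-- The analogue of `ptL_of_idem` for the right partial trace. -/
theorem ptR_of_idem {p : V ⟶ V} {q : W ⟶ W} (hp : p ≫ p = p) (hq : q ≫ q = q)
    {f : V ⊗ W ⟶ V ⊗ W} (h1 : (p ⊗ₘ q) ≫ f = f) (h2 : f ≫ (p ⊗ₘ q) = f) :
    ((ρ_ V).inv ≫ (p ⊗ₘ 𝟙 (𝟙_ C))) ≫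
    (p ⊗ₘ (η_ W Wᘁ ≫ (q ⊗ₘ qᘁ))) ≫
    ((α_ V W Wᘁ).inv ≫ ((p ⊗ₘ q) ⊗ₘ qᘁ)) ≫
    (f ⊗ₘ qᘁ) ≫
    (((p ⊗ₘ q) ⊗ₘ qᘁ) ≫ (α_ V W Wᘁ).hom) ≫
    (p ⊗ₘ (((q ⊗ₘ qᘁ) ≫ (β_ W Wᘁ).hom) ≫ (qᘁ ⊗ₘ q) ≫ ε_ W Wᘁ)) ≫
    ((p ⊗ₘ 𝟙 (𝟙_ C)) ≫ (ρ_ V).hom) = ptR f := by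
  have hq' : qᘁ ≫ qᘁ = qᘁ := by rw [← comp_rightAdjointMate, hq]
  have h3 : (𝟙 V ⊗ₘ q) ≫ f = f := by
    rw [← h1, tensorHom_comp_tensorHom_assoc, hq, Category.id_comp]
  have hη : η_ W Wᘁ ≫ (q ⊗ₘ qᘁ) = η_ W Wᘁ ≫ (q ⊗ₘ 𝟙 _) := by
    rw [tensorHom_def', coevaluation_comp_rightAdjointMate_assoc, ← comp_whiskerRight, hq,
      tensorHom_id]
  have e1 : ((ρ_ V).inv ≫ (p ⊗ₘ 𝟙 (𝟙_ C))) ≫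
      (p ⊗ₘ (η_ W Wᘁ ≫ (q ⊗ₘ qᘁ))) ≫ ((α_ V W Wᘁ).inv ≫ ((p ⊗ₘ q) ⊗ₘ qᘁ)) =
      ((ρ_ V).inv ≫ (𝟙 V ⊗ₘ η_ W Wᘁ) ≫ (α_ V W Wᘁ).inv) ≫ ((p ⊗ₘ q) ⊗ₘ qᘁ) := by
    simp only [Category.assoc]
    rw [← associator_inv_naturality]
    simp only [Category.assoc, tensorHom_comp_tensorHom_assoc, Category.id_comp,
      tensorHom_comp_tensorHom, hp, hq', hq]
  have e2 : (((p ⊗ₘ q) ⊗ₘ qᘁ) ≫ (α_ V W Wᘁ).hom) ≫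
      (p ⊗ₘ (((q ⊗ₘ qᘁ) ≫ (β_ W Wᘁ).hom) ≫ (qᘁ ⊗ₘ q) ≫ ε_ W Wᘁ)) ≫
      ((p ⊗ₘ 𝟙 (𝟙_ C)) ≫ (ρ_ V).hom) =
      ((p ⊗ₘ q) ⊗ₘ qᘁ) ≫ (α_ V W Wᘁ).hom ≫ (𝟙 V ⊗ₘ ((β_ W Wᘁ).hom ≫ ε_ W Wᘁ)) ≫
        (ρ_ V).hom := by
    rw [associator_naturality_assoc, associator_naturality]
    simp only [Category.assoc, tensorHom_comp_tensorHom_assoc, Category.comp_id,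
      BraidedCategory.braiding_naturality_assoc, hp, hq', hq]
  have e3 : ((ρ_ V).inv ≫ (𝟙 V ⊗ₘ η_ W Wᘁ) ≫ (α_ V W Wᘁ).inv) ≫ ((𝟙 V ⊗ₘ q) ⊗ₘ qᘁ) =
      ((ρ_ V).inv ≫ (𝟙 V ⊗ₘ η_ W Wᘁ) ≫ (α_ V W Wᘁ).inv) ≫ ((𝟙 V ⊗ₘ q) ⊗ₘ 𝟙 _) := by
    simp only [Category.assoc]
    rw [← associator_inv_naturality, ← associator_inv_naturality]
    simp only [tensorHom_comp_tensorHom_assoc, Category.id_comp, hη]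
  have e4 : ((p ⊗ₘ q) ⊗ₘ qᘁ) ≫ (f ⊗ₘ qᘁ) ≫ ((p ⊗ₘ q) ⊗ₘ qᘁ) =
      ((𝟙 V ⊗ₘ q) ⊗ₘ qᘁ) ≫ (f ⊗ₘ 𝟙 _) := by
    simp only [tensorHom_comp_tensorHom, h1, h2, h3, hq', Category.comp_id]
  have e5 : ((𝟙 V ⊗ₘ q) ⊗ₘ 𝟙 Wᘁ) ≫ (f ⊗ₘ 𝟙 _) = f ⊗ₘ 𝟙 _ := by
    rw [tensorHom_comp_tensorHom, h3, Category.comp_id]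
  rw [e2]
  simp only [Category.assoc]
  rw [reassoc_of% e1, reassoc_of% e4, reassoc_of% e3, reassoc_of% e5]
  simp only [ptR, id_tensorHom, tensorHom_id]

end Partial

/-! ### Partial traces in the idempotent completion and the additive envelope -/

namespace KaroubiTensor

open Idempotents

variable {C : Type*} [Category* C] [MonoidalCategory C] [SymmetricCategory C]
  [RightRigidCategory C]

theorem ptL_f {P Q : Karoubi C} (h : P ⊗ Q ⟶ P ⊗ Q) :
    (ptL h).f = ptL (V := P.X) (W := Q.X) h.f :=
  ptL_of_idem P.idem Q.idem (Karoubi.p_comp h) (Karoubi.comp_p h)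

theorem ptR_f {P Q : Karoubi C} (h : P ⊗ Q ⟶ P ⊗ Q) :
    (ptR h).f = ptR (V := P.X) (W := Q.X) h.f :=
  ptR_of_idem P.idem Q.idem (Karoubi.p_comp h) (Karoubi.comp_p h)

end KaroubiTensor

namespace MatTensor

variable {C : Type*} [Category* C] [Preadditive C]

theorem ent_comp_eq {M N K : Mat_ C} {f : M ⟶ N} {g : N ⟶ K} {i : M.ι} {k : K.ι} (j : N.ι)
    (hj : ∀ j', j' = j) {a : M.X i ⟶ N.X j} {b : N.X j ⟶ K.X k} (hf : ent f i j = a)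
    (hg : ent g j k = b) : ent (f ≫ g) i k = a ≫ b := by
  rw [ent_comp, Finset.sum_eq_single j (fun j' _ h => absurd (hj j') h)
    (fun h => absurd (Finset.mem_univ j) h), hf, hg]

/-- The one-term tuple. -/
abbrev single (V : C) : Mat_ C := ⟨PUnit, fun _ => V⟩

variable [MonoidalCategory C] [MonoidalPreadditive C]

theorem ent_whiskerRight {M N K : Mat_ C} (f : M ⟶ N) (i : M.ι) (j : N.ι) (k : K.ι) :
    ent (f ▷ K) (i, k) (j, k) = ent f i j ▷ K.X k := by
  refine (tensorMap_apply _ _ _ _ _ _).trans ?_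
  rw [ent_id_self, tensorHom_id]

theorem ent_whiskerLeft {M N K : Mat_ C} (f : M ⟶ N) (i : M.ι) (j : N.ι) (k : K.ι) :
    ent (K ◁ f) (k, i) (k, j) = K.X k ◁ ent f i j := by
  refine (tensorMap_apply _ _ _ _ _ _).trans ?_
  rw [ent_id_self, id_tensorHom]

theorem ent_associator_hom {M N K : Mat_ C} (i : M.ι) (j : N.ι) (k : K.ι) :
    ent (α_ M N K).hom ((i, j), k) (i, (j, k)) = (α_ (M.X i) (N.X j) (K.X k)).hom :=
  diagHom_self (M := tensor (tensor M N) K) (N := tensor M (tensor N K))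
    (fun p => (p.1.1, (p.1.2, p.2))) (fun p => (α_ (M.X p.1.1) (N.X p.1.2) (K.X p.2)).hom)
    ((i, j), k)

theorem ent_associator_inv {M N K : Mat_ C} (i : M.ι) (j : N.ι) (k : K.ι) :
    ent (α_ M N K).inv (i, (j, k)) ((i, j), k) = (α_ (M.X i) (N.X j) (K.X k)).inv :=
  diagHom_self (M := tensor M (tensor N K)) (N := tensor (tensor M N) K)
    (fun p => ((p.1, p.2.1), p.2.2)) (fun p => (α_ (M.X p.1) (N.X p.2.1) (K.X p.2.2)).inv)
    (i, (j, k))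

theorem ent_leftUnitor_hom {M : Mat_ C} (i : M.ι) :
    ent (λ_ M).hom (PUnit.unit, i) i = (λ_ (M.X i)).hom :=
  diagHom_self (M := tensor unit M) (fun p => p.2) (fun p => (λ_ (M.X p.2)).hom) (PUnit.unit, i)

theorem ent_leftUnitor_inv {M : Mat_ C} (i : M.ι) :
    ent (λ_ M).inv i (PUnit.unit, i) = (λ_ (M.X i)).inv :=
  diagHom_self (N := tensor unit M) (fun i => (PUnit.unit, i)) (fun i => (λ_ (M.X i)).inv) i

theorem ent_rightUnitor_hom {M : Mat_ C} (i : M.ι) :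
    ent (ρ_ M).hom (i, PUnit.unit) i = (ρ_ (M.X i)).hom :=
  diagHom_self (M := tensor M unit) (fun p => p.1) (fun p => (ρ_ (M.X p.1)).hom) (i, PUnit.unit)

theorem ent_rightUnitor_inv {M : Mat_ C} (i : M.ι) :
    ent (ρ_ M).inv i (i, PUnit.unit) = (ρ_ (M.X i)).inv :=
  diagHom_self (N := tensor M unit) (fun i => (i, PUnit.unit)) (fun i => (ρ_ (M.X i)).inv) i

variable [SymmetricCategory C]

theorem ent_braiding_hom {M N : Mat_ C} (i : M.ι) (j : N.ι) :
    ent (β_ M N).hom (i, j) (j, i) = (β_ (M.X i) (N.X j)).hom :=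
  diagHom_self (M := tensor M N) (N := tensor N M) (fun p => (p.2, p.1))
    (fun p => (β_ (M.X p.1) (N.X p.2)).hom) (i, j)

variable [RightRigidCategory C]

theorem ent_ptL {V W : C} (f : single V ⊗ single W ⟶ single V ⊗ single W) :
    ent (ptL f) PUnit.unit PUnit.unit =
      ptL (V := V) (W := W) (ent f (PUnit.unit, PUnit.unit) (PUnit.unit, PUnit.unit)) := by
  unfold ptL
  refine ent_comp_eq (PUnit.unit, PUnit.unit) (fun _ => rfl) (ent_leftUnitor_inv _) ?_
  refine ent_comp_eq ((PUnit.unit, PUnit.unit), PUnit.unit) (fun _ => rfl) ?_ ?_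
  · refine (ent_whiskerRight _ _ _ _).trans (congrArg (· ▷ W) ?_)
    exact ent_comp_eq (PUnit.unit, PUnit.unit) (fun _ => rfl) (coev_self (single V) _ _)
      (ent_braiding_hom _ _)
  refine ent_comp_eq (PUnit.unit, (PUnit.unit, PUnit.unit)) (fun _ => rfl)
    (ent_associator_hom _ _ _) ?_
  refine ent_comp_eq (PUnit.unit, (PUnit.unit, PUnit.unit)) (fun _ => rfl)
    (ent_whiskerLeft _ _ _ _) ?_
  refine ent_comp_eq ((PUnit.unit, PUnit.unit), PUnit.unit) (fun _ => rfl)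
    (ent_associator_inv _ _ _) ?_
  refine ent_comp_eq (PUnit.unit, PUnit.unit) (fun _ => rfl) ?_ (ent_leftUnitor_hom _)
  exact (ent_whiskerRight _ _ _ _).trans (congrArg (· ▷ W) (ev_self (single V) _ _))

theorem ent_ptR {V W : C} (f : single V ⊗ single W ⟶ single V ⊗ single W) :
    ent (ptR f) PUnit.unit PUnit.unit =
      ptR (V := V) (W := W) (ent f (PUnit.unit, PUnit.unit) (PUnit.unit, PUnit.unit)) := by
  unfold ptR
  refine ent_comp_eq (PUnit.unit, PUnit.unit) (fun _ => rfl) (ent_rightUnitor_inv _) ?_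
  refine ent_comp_eq (PUnit.unit, (PUnit.unit, PUnit.unit)) (fun _ => rfl)
    ((ent_whiskerLeft _ _ _ _).trans (congrArg (V ◁ ·) (coev_self (single W) _ _))) ?_
  refine ent_comp_eq ((PUnit.unit, PUnit.unit), PUnit.unit) (fun _ => rfl)
    (ent_associator_inv _ _ _) ?_
  refine ent_comp_eq ((PUnit.unit, PUnit.unit), PUnit.unit) (fun _ => rfl)
    (ent_whiskerRight _ _ _ _) ?_
  refine ent_comp_eq (PUnit.unit, (PUnit.unit, PUnit.unit)) (fun _ => rfl)
    (ent_associator_hom _ _ _) ?_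
  refine ent_comp_eq (PUnit.unit, PUnit.unit) (fun _ => rfl) ?_ (ent_rightUnitor_hom _)
  refine (ent_whiskerLeft _ _ _ _).trans (congrArg (V ◁ ·) ?_)
  exact ent_comp_eq (PUnit.unit, PUnit.unit) (fun _ => rfl) (ent_braiding_hom _ _)
    (ev_self (single W) _ _)

end MatTensor

/-! ### Partial traces of diagrams -/

/-- The analogue of `card_compat` for three diagrams stacked on each other. -/
theorem card_compat_comp {U V W X : Type} [Finite U] [Finite V] [Finite W] [Finite X]
    (π : Setoid (U ⊕ V)) (μ : Setoid (V ⊕ W)) (ν : Setoid (W ⊕ X)) {T : Type} [Finite T]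
    (u : U → T) (x : X → T) :
    Nat.card {p : (V → T) × (W → T) // Compat π u p.1 ∧ Compat μ p.1 p.2 ∧ Compat ν p.2 x} =
      open scoped Classical in if Compat (concat π (concat μ ν)) u x then
        Nat.card T ^ (loops μ ν + loops π (concat μ ν)) else 0 := by
  classical
  have := Fintype.ofFinite T
  have := Fintype.ofFinite V
  have := Fintype.ofFinite W
  have hs : ∀ v : V → T, (∑ w : W → T,
      (if Compat π u v ∧ Compat μ v w ∧ Compat ν w x then 1 else 0)) =
      Nat.card T ^ loops μ ν * (if Compat π u v ∧ Compat (concat μ ν) v x then 1 else 0) := by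
    intro v
    have := card_compat μ ν v x
    rw [Nat.card_eq_fintype_card, Fintype.card_subtype, Finset.card_filter] at this
    by_cases hx : Compat π u v
    · simp only [hx, true_and, this]
      simp
    · simp [hx]
  rw [Nat.card_eq_fintype_card, Fintype.card_subtype, Finset.card_filter, Fintype.sum_prod_type,
    Finset.sum_congr rfl fun v _ => hs v, ← Finset.mul_sum, ← Finset.card_filter,
    ← Fintype.card_subtype, ← Nat.card_eq_fintype_card, card_compat, pow_add]
  simp

namespace Rep0

variable {F : Type*} [Field F] {t : F}

theorem diag_comp_comp {U V W X : Rep0 F t} (π : Setoid (U.carrier ⊕ V.carrier))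
    (μ : Setoid (V.carrier ⊕ W.carrier)) (ν : Setoid (W.carrier ⊕ X.carrier)) (a : F) :
    (diag π 1 : U ⟶ V) ≫ (diag μ a : V ⟶ W) ≫ (diag ν 1 : W ⟶ X) =
      diag (concat π (concat μ ν)) (a * t ^ (loops μ ν + loops π (concat μ ν))) := by
  rw [diag_comp, diag_comp, pow_add]
  congr 1
  ring

/-- The left partial trace of a diagram is its left closure, each closed block giving a factor `t`.
The morphisms before and after `π` are the diagrams `A` and `B` which duplicate the labels of `V`. -/
theorem ptL_diag {V W : Rep0 F t}
    (π : Setoid ((V.carrier ⊕ W.carrier) ⊕ (V.carrier ⊕ W.carrier))) :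
    ∃ (ρ : Setoid (W.carrier ⊕ W.carrier)) (k : ℕ), ClosesLeft π ρ k ∧
      ∀ a, ptL (V := V) (W := W) (diag π a) = diag ρ (a * t ^ k) := by
  obtain ⟨A, hA, hA'⟩ : ∃ A : Setoid (W.carrier ⊕ (V.carrier ⊕ (V.carrier ⊕ W.carrier))),
      (λ_ W).inv ≫ (η_ V Vᘁ ≫ (β_ V Vᘁ).hom) ▷ W ≫ (α_ Vᘁ V W).hom = diag A 1 ∧
      ∀ (T : Type) (w : W.carrier → T) (x : V.carrier ⊕ (V.carrier ⊕ W.carrier) → T),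
        Compat A w x ↔ ∃ v, x = Sum.elim v (Sum.elim v w) := by
    refine ⟨((juxt ((cupDiagram V.carrier).comap (Sum.map id (Equiv.sumComm _ _).symm))
      (bijDiagram (Equiv.refl W.carrier))).comap (Sum.map id (Equiv.sumAssoc _ _ _).symm)).comap
      (Sum.map (Equiv.emptySum Empty W.carrier).symm id), ?_, ?_⟩
    · change bij (U := W) (V := tensor unit W) (Equiv.emptySum Empty W.carrier).symm ≫
        tensorMap (U := unit) (V := tensor V V) (diag (V := tensor V V) (cupDiagram V.carrier) 1 ≫
            bij (U := tensor V V) (V := tensor V V) (Equiv.sumComm V.carrier V.carrier))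
          (bij (U := W) (V := W) (Equiv.refl W.carrier)) ≫
        bij (U := tensor (tensor V V) W) (V := tensor V (tensor V W))
          (Equiv.sumAssoc V.carrier V.carrier W.carrier) = _
      rw [diag_comp_bij, bij.eq_1 (Equiv.refl _), tensorMap_diag, diag_comp_bij, bij_comp_diag,
        mul_one]
    · intro T w x
      rw [compat_comap_left, compat_comap_right, compat_juxt, compat_comap_right, compat_cup,
        compat_bij]
      constructor
      · rintro ⟨h1, h2⟩
        refine ⟨x ∘ Sum.inl, ?_⟩
        funext a
        rcases a with a | a | a
        · rfl
        · exact congrFun h1 a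
        · exact (congrFun h2 a).symm
      · rintro ⟨v, rfl⟩
        exact ⟨rfl, rfl⟩
  obtain ⟨B, hB, hB'⟩ : ∃ B : Setoid ((V.carrier ⊕ (V.carrier ⊕ W.carrier)) ⊕ W.carrier),
      (α_ Vᘁ V W).inv ≫ ε_ V Vᘁ ▷ W ≫ (λ_ W).hom = diag B 1 ∧
      ∀ (T : Type) (w : W.carrier → T) (x : V.carrier ⊕ (V.carrier ⊕ W.carrier) → T),
        Compat B x w ↔ ∃ v, x = Sum.elim v (Sum.elim v w) := by
    refine ⟨((juxt (capDiagram V.carrier) (bijDiagram (Equiv.refl W.carrier))).comap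
      (Sum.map id (Equiv.emptySum _ _).symm)).comap (Sum.map (Equiv.sumAssoc _ _ _).symm id),
      ?_, ?_⟩
    · change bij (U := tensor V (tensor V W)) (V := tensor (tensor V V) W)
          (Equiv.sumAssoc V.carrier V.carrier W.carrier).symm ≫
        tensorMap (U := tensor V V) (V := unit) (diag (U := tensor V V) (capDiagram V.carrier) 1)
          (bij (U := W) (V := W) (Equiv.refl W.carrier)) ≫
        bij (U := tensor unit W) (V := W) (Equiv.emptySum Empty W.carrier) = _
      rw [bij.eq_1 (Equiv.refl _), tensorMap_diag, diag_comp_bij, bij_comp_diag, mul_one]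
    · intro T w x
      rw [compat_comap_left, compat_comap_right, compat_juxt, compat_cap, compat_bij]
      constructor
      · rintro ⟨h1, h2⟩
        refine ⟨x ∘ Sum.inl, ?_⟩
        funext a
        rcases a with a | a | a
        · rfl
        · exact (congrFun h1 a).symm
        · exact congrFun h2 a
      · rintro ⟨v, rfl⟩
        exact ⟨rfl, rfl⟩
  refine ⟨concat A (concat (juxt (bijDiagram (Equiv.refl _)) π) B), loops (juxt (bijDiagram (Equiv.refl _)) π) B +
    loops A (concat (juxt (bijDiagram (Equiv.refl _)) π) B), ?_, fun a => ?_⟩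
  rotate_left
  · have : ptL (V := V) (W := W) (diag π a) = ((λ_ W).inv ≫ (η_ V Vᘁ ≫ (β_ V Vᘁ).hom) ▷ W ≫
        (α_ Vᘁ V W).hom) ≫ Vᘁ ◁ diag π a ≫ (α_ Vᘁ V W).inv ≫ ε_ V Vᘁ ▷ W ≫ (λ_ W).hom := by
      simp only [ptL, Category.assoc]
    rw [this, hA, hB]
    have h2 : Vᘁ ◁ (diag π a : tensor V W ⟶ tensor V W) =
        diag (U := tensor V (tensor V W)) (V := tensor V (tensor V W)) (juxt (bijDiagram (Equiv.refl V.carrier)) π) a := by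
      refine (tensorMap_diag (U := V) (V := V) (U' := tensor V W)
        (V' := tensor V W) _ _ _ _).trans ?_
      exact congrArg _ (one_mul a)
    exact (congrArg (fun z : tensor V (tensor V W) ⟶ tensor V (tensor V W) =>
      (diag A 1 : W ⟶ tensor V (tensor V W)) ≫ z ≫ (diag B 1 : tensor V (tensor V W) ⟶ W)) h2).trans
      (diag_comp_comp (U := W) (V := tensor V (tensor V W)) (W := tensor V (tensor V W)) (X := W)
        _ _ _ _)
  · intro T _ w w'
    rw [← card_compat_comp]
    refine Nat.card_congr (Equiv.ofBijective
      (fun v => ⟨(Sum.elim v.1 (Sum.elim v.1 w), Sum.elim v.1 (Sum.elim v.1 w')),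
        (hA' T w _).2 ⟨v.1, rfl⟩, (compat_juxt _ _ _ _).2 ⟨(compat_bij _ _ _).2 rfl, v.2⟩,
        (hB' T w' _).2 ⟨v.1, rfl⟩⟩) ⟨?_, ?_⟩)
    · intro v v' h
      exact Subtype.ext (funext fun a =>
        congrFun (congrArg Prod.fst (congrArg Subtype.val h)) (Sum.inl a))
    · rintro ⟨⟨x, y⟩, h1, h2, h3⟩
      obtain ⟨v, rfl⟩ := (hA' T w _).1 h1
      obtain ⟨v', rfl⟩ := (hB' T w' _).1 h3
      rw [compat_juxt, compat_bij] at h2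
      obtain rfl : v = v' := h2.1
      exact ⟨⟨v, h2.2⟩, rfl⟩

/-- The right partial trace of a diagram is its right closure, each closed block giving a
factor `t`. -/
theorem ptR_diag {V W : Rep0 F t}
    (π : Setoid ((V.carrier ⊕ W.carrier) ⊕ (V.carrier ⊕ W.carrier))) :
    ∃ (ρ : Setoid (V.carrier ⊕ V.carrier)) (k : ℕ), ClosesRight π ρ k ∧
      ∀ a, ptR (V := V) (W := W) (diag π a) = diag ρ (a * t ^ k) := by
  obtain ⟨A, hA, hA'⟩ : ∃ A : Setoid (V.carrier ⊕ ((V.carrier ⊕ W.carrier) ⊕ W.carrier)),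
      (ρ_ V).inv ≫ V ◁ η_ W Wᘁ ≫ (α_ V W Wᘁ).inv = diag A 1 ∧
      ∀ (T : Type) (v : V.carrier → T) (x : (V.carrier ⊕ W.carrier) ⊕ W.carrier → T),
        Compat A v x ↔ ∃ w, x = Sum.elim (Sum.elim v w) w := by
    refine ⟨((juxt (bijDiagram (Equiv.refl V.carrier)) (cupDiagram W.carrier)).comap
      (Sum.map id (Equiv.sumAssoc _ _ _).symm.symm)).comap
      (Sum.map (Equiv.sumEmpty V.carrier Empty).symm id), ?_, ?_⟩
    · change bij (U := V) (V := tensor V unit) (Equiv.sumEmpty V.carrier Empty).symm ≫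
        tensorMap (U' := unit) (V' := tensor W W) (bij (U := V) (V := V) (Equiv.refl V.carrier))
          (diag (V := tensor W W) (cupDiagram W.carrier) 1) ≫
        bij (U := tensor V (tensor W W)) (V := tensor (tensor V W) W)
          (Equiv.sumAssoc V.carrier W.carrier W.carrier).symm = _
      rw [bij.eq_1 (Equiv.refl _), tensorMap_diag, diag_comp_bij, bij_comp_diag, mul_one]
    · intro T v x
      rw [compat_comap_left, compat_comap_right, compat_juxt, compat_cup, compat_bij]
      constructor
      · rintro ⟨h1, h2⟩
        refine ⟨x ∘ Sum.inr, ?_⟩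
        funext a
        rcases a with (a | a) | a
        · exact (congrFun h1 a).symm
        · exact congrFun h2 a
        · rfl
      · rintro ⟨w, rfl⟩
        exact ⟨rfl, rfl⟩
  obtain ⟨B, hB, hB'⟩ : ∃ B : Setoid (((V.carrier ⊕ W.carrier) ⊕ W.carrier) ⊕ V.carrier),
      (α_ V W Wᘁ).hom ≫ V ◁ ((β_ W Wᘁ).hom ≫ ε_ W Wᘁ) ≫ (ρ_ V).hom = diag B 1 ∧
      ∀ (T : Type) (v : V.carrier → T) (x : (V.carrier ⊕ W.carrier) ⊕ W.carrier → T),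
        Compat B x v ↔ ∃ w, x = Sum.elim (Sum.elim v w) w := by
    refine ⟨((juxt (bijDiagram (Equiv.refl V.carrier)) ((capDiagram W.carrier).comap
      (Sum.map (Equiv.sumComm _ _) id))).comap
      (Sum.map id (Equiv.sumEmpty _ _).symm)).comap (Sum.map (Equiv.sumAssoc _ _ _) id), ?_, ?_⟩
    · change bij (U := tensor (tensor V W) W) (V := tensor V (tensor W W))
          (Equiv.sumAssoc V.carrier W.carrier W.carrier) ≫
        tensorMap (U' := tensor W W) (V' := unit) (bij (U := V) (V := V) (Equiv.refl V.carrier))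
          (bij (U := tensor W W) (V := tensor W W) (Equiv.sumComm W.carrier W.carrier) ≫
            diag (U := tensor W W) (capDiagram W.carrier) 1) ≫
        bij (U := tensor V unit) (V := V) (Equiv.sumEmpty V.carrier Empty) = _
      rw [bij_comp_diag, bij.eq_1 (Equiv.refl _), tensorMap_diag, diag_comp_bij, bij_comp_diag,
        mul_one]
    · intro T v x
      rw [compat_comap_left, compat_comap_right, compat_juxt, compat_comap_left, compat_cap,
        compat_bij]
      constructor
      · rintro ⟨h1, h2⟩
        refine ⟨x ∘ Sum.inr, ?_⟩
        funext a
        rcases a with (a | a) | a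
        · exact congrFun h1 a
        · exact (congrFun h2 a).symm
        · rfl
      · rintro ⟨w, rfl⟩
        exact ⟨rfl, rfl⟩
  refine ⟨concat A (concat (juxt π (bijDiagram (Equiv.refl _))) B), loops (juxt π (bijDiagram (Equiv.refl _))) B +
    loops A (concat (juxt π (bijDiagram (Equiv.refl _))) B), ?_, fun a => ?_⟩
  rotate_left
  · have : ptR (V := V) (W := W) (diag π a) = ((ρ_ V).inv ≫ V ◁ η_ W Wᘁ ≫ (α_ V W Wᘁ).inv) ≫
        diag π a ▷ Wᘁ ≫ (α_ V W Wᘁ).hom ≫ V ◁ ((β_ W Wᘁ).hom ≫ ε_ W Wᘁ) ≫ (ρ_ V).hom := by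
      simp only [ptR, Category.assoc]
    rw [this, hA, hB]
    have h2 : (diag π a : tensor V W ⟶ tensor V W) ▷ Wᘁ =
        diag (U := tensor (tensor V W) W) (V := tensor (tensor V W) W) (juxt π (bijDiagram (Equiv.refl W.carrier))) a := by
      refine (tensorMap_diag (U := tensor V W) (V := tensor V W)
        (U' := W) (V' := W) _ _ _ _).trans ?_
      exact congrArg _ (mul_one a)
    exact (congrArg (fun z : tensor (tensor V W) W ⟶ tensor (tensor V W) W =>
      (diag A 1 : V ⟶ tensor (tensor V W) W) ≫ z ≫ (diag B 1 : tensor (tensor V W) W ⟶ V)) h2).trans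
      (diag_comp_comp (U := V) (V := tensor (tensor V W) W) (W := tensor (tensor V W) W) (X := V)
        _ _ _ _)
  · intro T _ v v'
    rw [← card_compat_comp]
    refine Nat.card_congr (Equiv.ofBijective
      (fun w => ⟨(Sum.elim (Sum.elim v w.1) w.1, Sum.elim (Sum.elim v' w.1) w.1),
        (hA' T v _).2 ⟨w.1, rfl⟩, (compat_juxt _ _ _ _).2 ⟨w.2, (compat_bij _ _ _).2 rfl⟩,
        (hB' T v' _).2 ⟨w.1, rfl⟩⟩) ⟨?_, ?_⟩)
    · intro w w' h
      exact Subtype.ext (funext fun a =>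
        congrFun (congrArg Prod.fst (congrArg Subtype.val h)) (Sum.inr a))
    · rintro ⟨⟨x, y⟩, h1, h2, h3⟩
      obtain ⟨w, rfl⟩ := (hA' T v _).1 h1
      obtain ⟨w', rfl⟩ := (hB' T v' _).1 h3
      rw [compat_juxt, compat_bij] at h2
      obtain rfl : w = w' := h2.2
      exact ⟨⟨w, h2.1⟩, rfl⟩

end Rep0

/-! ### The signed trace on the endomorphisms of `[n]` -/

section SignTrace

variable {F : Type*} [Field F] (t : F)

theorem Rep0.smul_diag {U V : Rep0 F t} (r : F) (π : Setoid (U.carrier ⊕ V.carrier)) (a : F) :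
    r • (Rep0.diag π a : U ⟶ V) = Rep0.diag π (r * a) :=
  Finsupp.smul_single r π a

/-- The linear functional on `End [n]` which sends a diagram to the signed number of permutations
whose diagram is coarser. -/
def signTrace (n : ℕ) : (brak t n ⟶ brak t n) →ₗ[F] F :=
  Finsupp.linearCombination F fun ρ : Setoid (Fin n ⊕ Fin n) => (signSum ρ : F)

theorem signTrace_diag {n : ℕ} (ρ : Setoid (Fin n ⊕ Fin n)) (a : F) :
    signTrace t n (Rep0.diag ρ a) = a * signSum ρ :=
  (Finsupp.linearCombination_single F a ρ).trans (smul_eq_mul _ _)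

theorem antisymmetrizer_eq_sum (n : ℕ) : antisymmetrizer t n =
    ∑ σ : Equiv.Perm (Fin n), Rep0.diag (U := brak t n) (V := brak t n) (bijDiagram σ)
      ((n.factorial : F)⁻¹ * ((Equiv.Perm.sign σ : ℤ) : F)) := by
  rw [antisymmetrizer, Finset.smul_sum]
  refine Finset.sum_congr rfl fun σ _ => ?_
  rw [Rep0.bij, Rep0.smul_diag, Rep0.smul_diag, mul_one]

theorem antisymmetrizer_comp_bij (n : ℕ) (σ : Equiv.Perm (Fin n)) :
    antisymmetrizer t n ≫ (Rep0.bij σ : brak t n ⟶ brak t n) =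
      ((Equiv.Perm.sign σ : ℤ) : F) • antisymmetrizer t n := by
  unfold antisymmetrizer
  rw [Linear.smul_comp, Preadditive.sum_comp, smul_comm]
  refine congrArg (fun z : brak t n ⟶ brak t n => ((n.factorial : F)⁻¹) • z) ?_
  rw [Finset.smul_sum]
  refine Fintype.sum_equiv (Equiv.mulLeft σ) _ _ fun τ => ?_
  have h : (((Equiv.Perm.sign σ : ℤ) : F) *
      (((Equiv.Perm.sign σ * Equiv.Perm.sign τ : ℤˣ) : ℤ) : F)) =
      ((Equiv.Perm.sign τ : ℤ) : F) := by
    rcases Int.units_eq_one_or (Equiv.Perm.sign σ) with h | h <;> simp [h]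
  rw [Linear.smul_comp, Rep0.bij_comp_bij, smul_smul, Equiv.coe_mulLeft, map_mul, h]
  rfl

theorem sign_mul_self_cast {n : ℕ} (σ : Equiv.Perm (Fin n)) :
    ((Equiv.Perm.sign σ : ℤ) : F) * ((Equiv.Perm.sign σ : ℤ) : F) = 1 := by
  rcases Int.units_eq_one_or (Equiv.Perm.sign σ) with h | h <;> simp [h]

variable [CharZero F]

theorem inv_factorial_mul_sum_one (n : ℕ) :
    ∑ _σ : Equiv.Perm (Fin n), (n.factorial : F)⁻¹ = 1 := by
  rw [Finset.sum_const, Finset.card_univ, Fintype.card_perm, Fintype.card_fin, nsmul_eq_mul,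
    mul_inv_cancel₀ (Nat.cast_ne_zero.2 n.factorial_ne_zero)]

theorem signTrace_antisymmetrizer_comp (n : ℕ) (f : brak t n ⟶ brak t n) :
    signTrace t n (antisymmetrizer t n ≫ f) = signTrace t n f := by
  induction f using Rep0.hom_induction with
  | zero => rw [Limits.comp_zero]
  | add f g hf hg => rw [Preadditive.comp_add, map_add, map_add, hf, hg]
  | single ρ a =>
    rw [antisymmetrizer_eq_sum, Preadditive.sum_comp, map_sum, signTrace_diag,
      ← one_mul (a * _), ← inv_factorial_mul_sum_one n, Finset.sum_mul]
    refine Finset.sum_congr rfl fun σ _ => ?_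
    rw [Rep0.diag_comp, (bij_concat σ ρ).1, (bij_concat σ ρ).2, signTrace_diag,
      signSum_comap_left, pow_zero]
    push_cast
    linear_combination (n.factorial : F)⁻¹ * a * signSum ρ * sign_mul_self_cast (F := F) σ

theorem signTrace_comp_antisymmetrizer (n : ℕ) (f : brak t n ⟶ brak t n) :
    signTrace t n (f ≫ antisymmetrizer t n) = signTrace t n f := by
  induction f using Rep0.hom_induction with
  | zero => rw [Limits.zero_comp]
  | add f g hf hg => rw [Preadditive.add_comp, map_add, map_add, hf, hg]
  | single ρ a =>
    rw [antisymmetrizer_eq_sum, Preadditive.comp_sum, map_sum, signTrace_diag,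
      ← one_mul (a * _), ← inv_factorial_mul_sum_one n, Finset.sum_mul]
    refine Finset.sum_congr rfl fun σ _ => ?_
    rw [Rep0.diag_comp, (concat_bij ρ σ).1, (concat_bij ρ σ).2, signTrace_diag,
      signSum_comap_right, pow_zero]
    push_cast
    linear_combination (n.factorial : F)⁻¹ * a * signSum ρ * sign_mul_self_cast (F := F) σ

theorem signTrace_antisymmetrizer (n : ℕ) : signTrace t n (antisymmetrizer t n) = 1 := by
  rw [← Category.comp_id (antisymmetrizer t n), signTrace_antisymmetrizer_comp, ← Rep0.bij_refl,
    Rep0.bij, signTrace_diag]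
  have := signSum_bij (Equiv.refl (Fin n))
  rw [this]
  simp

theorem last_subsingleton (n : ℕ) : {i : Fin n | i.val + 1 = n}.Subsingleton := by
  intro i hi j hj
  rw [Set.mem_ofPred_eq] at hi hj
  omega

theorem signTrace_sandwich_lastRemoved (n : ℕ) :
    signTrace t n (antisymmetrizer t n ≫ lastRemoved t n ≫ antisymmetrizer t n) = 1 := by
  rw [signTrace_antisymmetrizer_comp, signTrace_comp_antisymmetrizer, lastRemoved, signTrace_diag,
    signSum_bijDiagramRemove (last_subsingleton n)]
  simp

theorem antisymmetrizer_tensor_comp_diag (n : ℕ)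
    (π : Setoid ((Fin n ⊕ Fin n) ⊕ (Fin n ⊕ Fin n))) (a : F) :
    (antisymmetrizer t n ⊗ₘ antisymmetrizer t n) ≫
        (Rep0.diag π a : brak t n ⊗ brak t n ⟶ brak t n ⊗ brak t n) =
      ∑ σ : Equiv.Perm (Fin n), ∑ τ : Equiv.Perm (Fin n),
        (Rep0.diag (π.comap (Sum.map (σ.sumCongr τ) id))
          ((n.factorial : F)⁻¹ * (n.factorial : F)⁻¹ * a *
            (((Equiv.Perm.sign σ : ℤ) : F) * ((Equiv.Perm.sign τ : ℤ) : F))) :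
          brak t n ⊗ brak t n ⟶ brak t n ⊗ brak t n) := by
  rw [antisymmetrizer_eq_sum, sum_tensor, Preadditive.sum_comp]
  refine Finset.sum_congr rfl fun σ _ => ?_
  rw [tensor_sum, Preadditive.sum_comp]
  refine Finset.sum_congr rfl fun τ _ => ?_
  refine (congrArg (· ≫ _) (Rep0.tensorMap_diag (U := brak t n) (V := brak t n) (U' := brak t n)
    (V' := brak t n) (bijDiagram σ) (bijDiagram τ) _ _)).trans ?_
  refine (Rep0.diag_comp (U := Rep0.tensor (brak t n) (brak t n))
    (V := Rep0.tensor (brak t n) (brak t n)) (W := Rep0.tensor (brak t n) (brak t n))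
    _ _ _ _).trans ?_
  rw [juxt_bij, (bij_concat (σ.sumCongr τ) π).1, (bij_concat (σ.sumCongr τ) π).2]
  refine congrArg (Rep0.diag _) ?_
  ring

section Additive

variable {C : Type*} [Category* C] [Preadditive C] [MonoidalCategory C] [MonoidalPreadditive C]
  [SymmetricCategory C] [RightRigidCategory C] {V W : C}

/-- The left partial trace as a homomorphism of groups. -/
def ptLHom : (V ⊗ W ⟶ V ⊗ W) →+ (W ⟶ W) :=
  AddMonoidHom.mk' ptL fun f g => by
    simp [ptL, Preadditive.add_comp, Preadditive.comp_add]

/-- The right partial trace as a homomorphism of groups. -/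
def ptRHom : (V ⊗ W ⟶ V ⊗ W) →+ (V ⟶ V) :=
  AddMonoidHom.mk' ptR fun f g => by
    simp [ptR, Preadditive.add_comp, Preadditive.comp_add]

end Additive

theorem signTrace_ptL_eq_ptR (n : ℕ) (g : brak t n ⊗ brak t n ⟶ brak t n ⊗ brak t n) :
    signTrace t n (ptL ((antisymmetrizer t n ⊗ₘ antisymmetrizer t n) ≫ g)) =
      signTrace t n (ptR ((antisymmetrizer t n ⊗ₘ antisymmetrizer t n) ≫ g)) := by
  change signTrace t n (ptLHom _) = signTrace t n (ptRHom _)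
  induction g using Rep0.hom_induction with
  | zero => simp only [Limits.comp_zero, map_zero]
  | add f g hf hg => simp only [Preadditive.comp_add, map_add, hf, hg]
  | single π a =>
    rw [antisymmetrizer_tensor_comp_diag]
    simp only [map_sum]
    have hL := fun σ τ : Equiv.Perm (Fin n) => Rep0.ptL_diag (V := brak t n) (W := brak t n)
      (π.comap (Sum.map (σ.sumCongr τ) id))
    have hR := fun σ τ : Equiv.Perm (Fin n) => Rep0.ptR_diag (V := brak t n) (W := brak t n)
      (π.comap (Sum.map (σ.sumCongr τ) id))
    choose ρ k hk hL using hL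
    choose ρ' k' hk' hR using hR
    have key := sum_sign_closes_eq π ρ ρ' k k' hk hk' t
    have eL : ∀ (σ τ : Equiv.Perm (Fin n)) (c : F), signTrace t n (ptLHom (V := brak t n)
        (W := brak t n) (Rep0.diag (π.comap (Sum.map (σ.sumCongr τ) id)) c)) =
        c * (t ^ k σ τ * signSum (ρ σ τ)) := by
      intro σ τ c
      refine (congrArg (signTrace t n) (hL σ τ c)).trans ?_
      rw [signTrace_diag, mul_assoc]
    have eR : ∀ (σ τ : Equiv.Perm (Fin n)) (c : F), signTrace t n (ptRHom (V := brak t n)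
        (W := brak t n) (Rep0.diag (π.comap (Sum.map (σ.sumCongr τ) id)) c)) =
        c * (t ^ k' σ τ * signSum (ρ' σ τ)) := by
      intro σ τ c
      refine (congrArg (signTrace t n) (hR σ τ c)).trans ?_
      rw [signTrace_diag, mul_assoc]
    simp only [eL, eR, mul_assoc, ← Finset.mul_sum] at key ⊢
    rw [key]

end SignTrace

/-! ### Diagrams not killed by antisymmetrization -/

section Basis

theorem comap_eq_self_of_related {X : Type} {ρ : Setoid X} {φ : X → X} (h : ∀ x, ρ (φ x) x) :
    ρ.comap φ = ρ := by
  ext x y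
  rw [Setoid.comap_rel]
  exact ⟨fun hxy => ρ.trans (ρ.symm (h x)) (ρ.trans hxy (h y)),
    fun hxy => ρ.trans (h x) (ρ.trans hxy (ρ.symm (h y)))⟩

theorem comap_swap_of_related {U V : Type} [DecidableEq U] {ρ : Setoid (U ⊕ V)} {i j : U}
    (h : ρ (Sum.inl i) (Sum.inl j)) : ρ.comap (Sum.map (Equiv.swap i j) id) = ρ := by
  refine comap_eq_self_of_related ?_
  rintro (x | x)
  · rw [Sum.map_inl]
    rcases eq_or_ne x i with rfl | hi
    · rw [Equiv.swap_apply_left]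
      exact ρ.symm h
    rcases eq_or_ne x j with rfl | hj
    · rw [Equiv.swap_apply_right]
      exact h
    · rw [Equiv.swap_apply_of_ne_of_ne hi hj]
  · exact ρ.refl _

theorem comap_swap_of_isolated {U V : Type} [DecidableEq U] {ρ : Setoid (U ⊕ V)} {i j : U}
    (hi : ∀ y, ρ (Sum.inl i) y → y = Sum.inl i) (hj : ∀ y, ρ (Sum.inl j) y → y = Sum.inl j) :
    ρ.comap (Sum.map (Equiv.swap i j) id) = ρ := by
  have hinj : Function.Injective (Sum.map (Equiv.swap i j) (id : V → V)) :=
    Function.Injective.sumMap (Equiv.swap i j).injective Function.injective_id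
  have key : ∀ x : U ⊕ V, ((∀ y, ρ x y → y = x) ∧
      ∀ y, ρ (Sum.map (Equiv.swap i j) id x) y → y = Sum.map (Equiv.swap i j) id x) ∨
      Sum.map (Equiv.swap i j) id x = x := by
    rintro (x | x)
    · rcases eq_or_ne x i with rfl | hxi
      · left
        rw [Sum.map_inl, Equiv.swap_apply_left]
        exact ⟨hi, hj⟩
      rcases eq_or_ne x j with rfl | hxj
      · left
        rw [Sum.map_inl, Equiv.swap_apply_right]
        exact ⟨hj, hi⟩
      · right
        rw [Sum.map_inl, Equiv.swap_apply_of_ne_of_ne hxi hxj]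
    · exact Or.inr rfl
  ext x y
  rw [Setoid.comap_rel]
  rcases key x with ⟨h1, h2⟩ | hx
  · constructor
    · intro h
      rw [hinj (h2 _ h)]
    · intro h
      rw [h1 _ h]
  rcases key y with ⟨h1, h2⟩ | hy
  · constructor
    · intro h
      rw [hinj (h2 _ (ρ.symm h))]
    · intro h
      rw [h1 _ (ρ.symm h)]
  · rw [hx, hy]

theorem comap_symm_swap_right {U V : Type} [DecidableEq V] {ρ : Setoid (U ⊕ V)} {i j : V}
    (h : ρ (Sum.inr i) (Sum.inr j)) : ρ.comap (Sum.map id (Equiv.swap i j).symm) = ρ := by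
  rw [Equiv.symm_swap]
  refine comap_eq_self_of_related ?_
  rintro (x | x)
  · exact ρ.refl _
  · rw [Sum.map_inr]
    rcases eq_or_ne x i with rfl | hi
    · rw [Equiv.swap_apply_left]
      exact ρ.symm h
    rcases eq_or_ne x j with rfl | hj
    · rw [Equiv.swap_apply_right]
      exact h
    · rw [Equiv.swap_apply_of_ne_of_ne hi hj]

/-- A diagram whose blocks contain at most one top and at most one bottom vertex, and which has at
most one isolated top vertex, is the diagram of a permutation with at most one edge removed. -/
theorem exists_eq_bijDiagramRemove {n : ℕ} {ρ : Setoid (Fin n ⊕ Fin n)}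
    (htop : ∀ i j, ρ (Sum.inl i) (Sum.inl j) → i = j)
    (hbot : ∀ i j, ρ (Sum.inr i) (Sum.inr j) → i = j)
    (hiso : ∀ i j, (∀ y, ρ (Sum.inl i) y → y = Sum.inl i) →
      (∀ y, ρ (Sum.inl j) y → y = Sum.inl j) → i = j) :
    ∃ (σ : Equiv.Perm (Fin n)) (I : Set (Fin n)), I.Subsingleton ∧ ρ = bijDiagramRemove σ I := by
  classical
  let I : Set (Fin n) := {i | ∀ b, ¬ ρ (Sum.inl i) (Sum.inr b)}
  have hI : ∀ i ∈ I, ∀ y, ρ (Sum.inl i) y → y = Sum.inl i := by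
    rintro i hi (y | y) h
    · rw [htop _ _ h]
    · exact absurd h (hi y)
  have hex : ∀ i, ∃ b, i ∉ I → ρ (Sum.inl i) (Sum.inr b) := by
    intro i
    by_cases hi : i ∈ I
    · exact ⟨i, fun h => absurd hi h⟩
    · obtain ⟨b, hb⟩ : ∃ b, ρ (Sum.inl i) (Sum.inr b) := by
        by_contra! hc
        exact hi hc
      exact ⟨b, fun _ => hb⟩
  choose g hg using hex
  have hinj : Set.InjOn g Iᶜ := by
    intro i hi j hj hij
    refine htop _ _ (ρ.trans (hg i hi) ?_)
    rw [hij]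
    exact ρ.symm (hg j hj)
  let σ : Equiv.Perm (Fin n) := (Equiv.Set.imageOfInjOn g Iᶜ hinj).extendSubtype
  have hσ : ∀ i, i ∉ I → ρ (Sum.inl i) (Sum.inr (σ i)) := by
    intro i hi
    have : σ i = g i := Equiv.extendSubtype_apply_of_mem _ i hi
    rw [this]
    exact hg i hi
  refine ⟨σ, I, fun i hi j hj => hiso i j (hI i hi) (hI j hj), eq_of_le_iff fun T u v => ?_⟩
  rw [compat_bijDiagramRemove]
  constructor
  · intro h i hi
    exact h (hσ i hi)
  · intro h x y hxy
    have hcross : ∀ i b, ρ (Sum.inl i) (Sum.inr b) → u i = v b := by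
      intro i b hib
      have hi : i ∉ I := fun hi => hi b hib
      rw [h i hi, hbot _ _ (ρ.trans (ρ.symm (hσ i hi)) hib)]
    rcases x with x | x <;> rcases y with y | y
    · rw [htop _ _ hxy]
    · exact hcross _ _ hxy
    · exact (hcross _ _ (ρ.symm hxy)).symm
    · rw [hbot _ _ hxy]

variable {F : Type*} [Field F] (t : F) [CharZero F]

/-- The diagram is invariant under a transposition, on which the antisymmetrizer takes the
value `-1`. -/
theorem antisymmetrizer_comp_diag_eq_zero {n : ℕ} {ρ : Setoid (Fin n ⊕ Fin n)} {i j : Fin n}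
    (hij : i ≠ j) (h : ρ.comap (Sum.map (Equiv.swap i j) id) = ρ) :
    antisymmetrizer t n ≫ (Rep0.diag ρ 1 : brak t n ⟶ brak t n) = 0 := by
  have e : (Rep0.bij (Equiv.swap i j) : brak t n ⟶ brak t n) ≫
      (Rep0.diag ρ 1 : brak t n ⟶ brak t n) = Rep0.diag ρ 1 := by
    refine (Rep0.bij_comp_diag (U := brak t n) (V := brak t n) (W := brak t n) _ ρ 1).trans ?_
    rw [h]
  have h2 : antisymmetrizer t n ≫ (Rep0.diag ρ 1 : brak t n ⟶ brak t n) =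
      -(antisymmetrizer t n ≫ Rep0.diag ρ 1) := by
    conv_lhs => rw [← e, ← Category.assoc, antisymmetrizer_comp_bij, Linear.smul_comp]
    simp [Equiv.Perm.sign_swap hij]
  have h3 : (2 : F) • (antisymmetrizer t n ≫ (Rep0.diag ρ 1 : brak t n ⟶ brak t n)) = 0 := by
    rw [two_smul]
    nth_rewrite 1 [h2]
    rw [neg_add_cancel]
  exact (smul_eq_zero.1 h3).resolve_left two_ne_zero

theorem diag_comp_antisymmetrizer_eq_zero {n : ℕ} {ρ : Setoid (Fin n ⊕ Fin n)} {i j : Fin n}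
    (hij : i ≠ j) (h : ρ.comap (Sum.map id (Equiv.swap i j).symm) = ρ) :
    (Rep0.diag ρ 1 : brak t n ⟶ brak t n) ≫ antisymmetrizer t n = 0 := by
  have e : (Rep0.diag ρ 1 : brak t n ⟶ brak t n) ≫
      (Rep0.bij (Equiv.swap i j) : brak t n ⟶ brak t n) = Rep0.diag ρ 1 := by
    refine (Rep0.diag_comp_bij (U := brak t n) (V := brak t n) (W := brak t n) ρ _ 1).trans ?_
    rw [h]
  have h2 : (Rep0.diag ρ 1 : brak t n ⟶ brak t n) ≫ antisymmetrizer t n =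
      -(Rep0.diag ρ 1 ≫ antisymmetrizer t n) := by
    conv_lhs => rw [← e, Category.assoc, bij_comp_antisymmetrizer, Linear.comp_smul]
    simp [Equiv.Perm.sign_swap hij]
  have h3 : (2 : F) • ((Rep0.diag ρ 1 : brak t n ⟶ brak t n) ≫ antisymmetrizer t n) = 0 := by
    rw [two_smul]
    nth_rewrite 1 [h2]
    rw [neg_add_cancel]
  exact (smul_eq_zero.1 h3).resolve_left two_ne_zero

/-- Removing any one edge of the identity diagram gives the same antisymmetrization. -/
theorem sandwich_removeOne {n : ℕ} (i : Fin n) :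
    antisymmetrizer t n ≫
        (Rep0.diag (bijDiagramRemove (Equiv.refl (Fin n)) {i}) 1 : brak t n ⟶ brak t n) ≫
        antisymmetrizer t n =
      antisymmetrizer t n ≫ lastRemoved t n ≫ antisymmetrizer t n := by
  have hn : 0 < n := i.pos
  let l : Fin n := ⟨n - 1, by omega⟩
  let τ := Equiv.swap i l
  have hl : ∀ j : Fin n, j.val + 1 = n ↔ j = l := by
    intro j
    rw [Fin.ext_iff]
    change _ ↔ j.val = n - 1
    omega
  have e : (Rep0.diag (bijDiagramRemove (Equiv.refl (Fin n)) {i}) 1 : brak t n ⟶ brak t n) =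
      (Rep0.bij τ : brak t n ⟶ brak t n) ≫ lastRemoved t n ≫ Rep0.bij τ := by
    rw [lastRemoved, Rep0.diag_comp_bij, Rep0.bij_comp_diag]
    congr 1
    refine eq_of_le_iff fun T u v => ?_
    rw [compat_comap_left, compat_comap_right, compat_bijDiagramRemove, compat_bijDiagramRemove]
    constructor
    · intro h j hj
      rw [Set.mem_ofPred_eq, hl] at hj
      refine h _ fun hc => hj ?_
      rw [Set.mem_singleton_iff, Equiv.symm_apply_eq] at hc
      rw [hc]
      exact Equiv.swap_apply_left _ _
    · intro h j hj
      have := h (τ j) (by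
        rw [Set.mem_ofPred_eq, hl]
        intro hc
        apply hj
        exact τ.injective (hc.trans (Equiv.swap_apply_left i l).symm))
      simpa [τ] using this
  rw [e, Category.assoc, Category.assoc, bij_comp_antisymmetrizer, ← Category.assoc,
    antisymmetrizer_comp_bij, Linear.smul_comp, Linear.comp_smul, Linear.comp_smul, smul_smul,
    sign_mul_self_cast, one_smul]

theorem sandwich_diag_mem_span {n : ℕ} (ρ : Setoid (Fin n ⊕ Fin n)) :
    antisymmetrizer t n ≫ (Rep0.diag ρ 1 : brak t n ⟶ brak t n) ≫ antisymmetrizer t n ∈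
      Submodule.span F {antisymmetrizer t n,
        antisymmetrizer t n ≫ lastRemoved t n ≫ antisymmetrizer t n} := by
  classical
  by_cases h1 : ∃ i j : Fin n, i ≠ j ∧ ρ.comap (Sum.map (Equiv.swap i j) id) = ρ
  · obtain ⟨i, j, hij, h⟩ := h1
    rw [reassoc_of% (antisymmetrizer_comp_diag_eq_zero t hij h), Limits.zero_comp]
    exact zero_mem _
  by_cases h2 : ∃ i j : Fin n, i ≠ j ∧ ρ.comap (Sum.map id (Equiv.swap i j).symm) = ρ
  · obtain ⟨i, j, hij, h⟩ := h2
    rw [diag_comp_antisymmetrizer_eq_zero t hij h, Limits.comp_zero]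
    exact zero_mem _
  obtain ⟨σ, I, hI, rfl⟩ := exists_eq_bijDiagramRemove (ρ := ρ)
    (fun i j h => by_contra fun hij => h1 ⟨i, j, hij, comap_swap_of_related h⟩)
    (fun i j h => by_contra fun hij => h2 ⟨i, j, hij, comap_symm_swap_right h⟩)
    (fun i j hi hj => by_contra fun hij => h1 ⟨i, j, hij, comap_swap_of_isolated hi hj⟩)
  have e : (Rep0.diag (bijDiagramRemove σ I) 1 : brak t n ⟶ brak t n) =
      (Rep0.diag (bijDiagramRemove (Equiv.refl (Fin n)) I) 1 : brak t n ⟶ brak t n) ≫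
        (Rep0.bij σ : brak t n ⟶ brak t n) := by
    rw [Rep0.diag_comp_bij]
    congr 1
    refine eq_of_le_iff fun T u v => ?_
    rw [compat_comap_right, compat_bijDiagramRemove, compat_bijDiagramRemove]
    rfl
  rw [e, Category.assoc, bij_comp_antisymmetrizer, Linear.comp_smul, Linear.comp_smul]
  refine Submodule.smul_mem _ _ (Submodule.subset_span ?_)
  rcases hI.eq_empty_or_singleton with rfl | ⟨i, rfl⟩
  · left
    have : (Rep0.diag (bijDiagramRemove (Equiv.refl (Fin n)) ∅) 1 : brak t n ⟶ brak t n) =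
        𝟙 (brak t n) := by
      rw [← Rep0.bij_refl, Rep0.bij]
      congr 1
      refine eq_of_le_iff fun T u v => ?_
      rw [compat_bijDiagramRemove, compat_bij, funext_iff]
      simp
    rw [this, Category.id_comp, antisymmetrizer_idem]
  · right
    exact sandwich_removeOne t i

theorem sandwich_mem_span {n : ℕ} (f : brak t n ⟶ brak t n) :
    antisymmetrizer t n ≫ f ≫ antisymmetrizer t n ∈
      Submodule.span F {antisymmetrizer t n,
        antisymmetrizer t n ≫ lastRemoved t n ≫ antisymmetrizer t n} := by
  induction f using Rep0.hom_induction with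
  | zero =>
    rw [Limits.zero_comp, Limits.comp_zero]
    exact zero_mem _
  | add f g hf hg =>
    rw [Preadditive.add_comp, Preadditive.comp_add]
    exact add_mem hf hg
  | single ρ a =>
    have : (Rep0.diag ρ a : brak t n ⟶ brak t n) = a • Rep0.diag ρ 1 := by
      rw [Rep0.smul_diag, mul_one]
    rw [this, Linear.smul_comp, Linear.comp_smul]
    exact Submodule.smul_mem _ _ (sandwich_diag_mem_span t ρ)

/-! ### Linear independence -/

/-- The coefficient of a diagram in an endomorphism of `[n]`. -/
def coeffDiag {n : ℕ} (ρ : Setoid (Fin n ⊕ Fin n)) : (brak t n ⟶ brak t n) →ₗ[F] F :=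
  Finsupp.lapply ρ

open scoped Classical in
theorem coeffDiag_diag {n : ℕ} (ρ π : Setoid (Fin n ⊕ Fin n)) (a : F) :
    coeffDiag t ρ (Rep0.diag π a) = if π = ρ then a else 0 :=
  Finsupp.single_apply

theorem coeffDiag_antisymmetrizer (n : ℕ) :
    coeffDiag t (bijDiagram (1 : Equiv.Perm (Fin n))) (antisymmetrizer t n) =
      (n.factorial : F)⁻¹ := by
  classical
  have h : ∀ σ : Equiv.Perm (Fin n), bijDiagram σ = bijDiagram (1 : Equiv.Perm (Fin n)) ↔ σ = 1 := by
    intro σ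
    refine ⟨fun h => ?_, fun h => by rw [h]⟩
    rw [← compat_bij_iff_eq, h, compat_bij_iff_eq]
  rw [antisymmetrizer_eq_sum, map_sum]
  simp only [coeffDiag_diag, h]
  simp

/-- All diagrams in `s_n x_n s_n` have an isolated top vertex, so the identity diagram does not
occur. -/
theorem coeffDiag_sandwich_lastRemoved {n : ℕ} (hn : 0 < n) :
    coeffDiag t (bijDiagram (1 : Equiv.Perm (Fin n)))
      (antisymmetrizer t n ≫ lastRemoved t n ≫ antisymmetrizer t n) = 0 := by
  classical
  let l : Fin n := ⟨n - 1, by omega⟩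
  rw [antisymmetrizer_eq_sum, Preadditive.sum_comp, map_sum]
  refine Finset.sum_eq_zero fun σ _ => ?_
  rw [Preadditive.comp_sum, Preadditive.comp_sum, map_sum]
  refine Finset.sum_eq_zero fun τ _ => ?_
  rw [lastRemoved, Rep0.diag_comp, Rep0.diag_comp, (concat_bij _ τ).2, (bij_concat σ _).2,
    coeffDiag_diag, if_neg]
  intro h
  -- Label the top vertex attached to the missing edge by `true`, all other vertices by `false`.
  have hc : Compat (bijDiagram (1 : Equiv.Perm (Fin n))) (fun i => decide (σ i = l))
      (fun _ => false) := by
    rw [← h, compat_comap_left, compat_comap_right, compat_bijDiagramRemove]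
    intro i hi
    have : i ≠ l := by
      rintro rfl
      exact hi (Nat.succ_pred_eq_of_pos hn)
    simpa using this
  rw [compat_bij] at hc
  simpa using congrFun hc (σ.symm l)

theorem linearIndependent_antisymmetrizer {n : ℕ} (hn : 0 < n) :
    LinearIndependent F ![antisymmetrizer t n,
      antisymmetrizer t n ≫ lastRemoved t n ≫ antisymmetrizer t n] := by
  rw [LinearIndependent.pair_iff]
  intro a b h
  have h1 := congrArg (coeffDiag t (bijDiagram (1 : Equiv.Perm (Fin n)))) h
  rw [map_add, map_smul, map_smul, coeffDiag_antisymmetrizer,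
    coeffDiag_sandwich_lastRemoved t hn, map_zero, smul_zero, add_zero, smul_eq_mul] at h1
  have ha : a = 0 := (mul_eq_zero.1 h1).resolve_right
    (inv_ne_zero (Nat.cast_ne_zero.2 n.factorial_ne_zero))
  have h2 := congrArg (signTrace t n) h
  rw [map_add, map_smul, map_smul, signTrace_antisymmetrizer, signTrace_sandwich_lastRemoved,
    map_zero, ha, zero_smul, zero_add, smul_eq_mul, mul_one] at h2
  exact ⟨ha, h2⟩

/-! ### Endomorphisms of `M_n` -/

/-- The endomorphism of `[n]` underlying an endomorphism of `M_n`. -/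
def underlying (n : ℕ) : (M t n ⟶ M t n) →ₗ[F] (brak t n ⟶ brak t n) where
  toFun f := MatTensor.ent f.f PUnit.unit PUnit.unit
  map_add' _ _ := rfl
  map_smul' _ _ := rfl

theorem underlying_injective (n : ℕ) : Function.Injective (underlying t n) := by
  intro f g h
  refine Idempotents.Karoubi.hom_ext _ _ (MatTensor.ent_ext ?_)
  rintro ⟨⟩ ⟨⟩
  exact h

theorem underlying_sEnd (n : ℕ) : underlying t n (sEnd t n) = antisymmetrizer t n := rfl

theorem underlying_sxsEnd (n : ℕ) : underlying t n (sxsEnd t n) =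
    antisymmetrizer t n ≫ lastRemoved t n ≫ antisymmetrizer t n := rfl

theorem underlying_eq_sandwich (n : ℕ) (f : M t n ⟶ M t n) : underlying t n f =
    antisymmetrizer t n ≫ underlying t n f ≫ antisymmetrizer t n := by
  refine (congrArg (fun g => MatTensor.ent g PUnit.unit PUnit.unit) f.comm.symm).trans ?_
  exact MatTensor.ent_comp_eq PUnit.unit (fun _ => rfl) rfl
    (MatTensor.ent_comp_eq PUnit.unit (fun _ => rfl) rfl rfl)

theorem span_sEnd_sxsEnd (n : ℕ) :
    ⊤ ≤ Submodule.span F (Set.range ![sEnd t n, sxsEnd t n]) := by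
  intro f _
  have h := sandwich_mem_span t (underlying t n f)
  rw [← underlying_eq_sandwich, Submodule.mem_span_pair] at h
  obtain ⟨a, b, h⟩ := h
  rw [Matrix.range_cons_cons_empty, Submodule.mem_span_pair]
  refine ⟨a, b, underlying_injective t n ?_⟩
  rw [map_add, map_smul, map_smul, underlying_sEnd, underlying_sxsEnd, h]

theorem linearIndependent_sEnd_sxsEnd {n : ℕ} (hn : 0 < n) :
    LinearIndependent F ![sEnd t n, sxsEnd t n] := by
  refine LinearIndependent.of_comp (underlying t n) ?_
  have : underlying t n ∘ ![sEnd t n, sxsEnd t n] = ![antisymmetrizer t n,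
      antisymmetrizer t n ≫ lastRemoved t n ≫ antisymmetrizer t n] := by
    funext i
    fin_cases i <;> rfl
  rw [this]
  exact linearIndependent_antisymmetrizer t hn

/-- The functional on `End M_n` which takes the value `1` on both basis vectors. -/
def ambiTrace (n : ℕ) : (M t n ⟶ M t n) →ₗ[F] F := signTrace t n ∘ₗ underlying t n

theorem trL_eq_ptL {V W : DeligneRep F t} (h : V ⊗ W ⟶ V ⊗ W) : trL h = ptL h := by
  have : coev' V = η_ V Vᘁ ≫ (β_ V Vᘁ).hom := by
    change η_ V Vᘁ ≫ (β_ V Vᘁ).hom ≫ Vᘁ ◁ 𝟙 V = _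
    simp
  rw [trL, this, ptL]

theorem trR_eq_ptR {V W : DeligneRep F t} (h : V ⊗ W ⟶ V ⊗ W) : trR h = ptR h := by
  have : ev' W = (β_ W Wᘁ).hom ≫ ε_ W Wᘁ := by
    change 𝟙 W ▷ Wᘁ ≫ (β_ W Wᘁ).hom ≫ ε_ W Wᘁ = _
    simp
  rw [trR, this, ptR]

theorem isAmbidextrousTrace_ambiTrace (n : ℕ) : IsAmbidextrousTrace (ambiTrace t n) := by
  intro h
  let g : brak t n ⊗ brak t n ⟶ brak t n ⊗ brak t n :=
    MatTensor.ent h.f (PUnit.unit, PUnit.unit) (PUnit.unit, PUnit.unit)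
  have hg : g = (antisymmetrizer t n ⊗ₘ antisymmetrizer t n) ≫ g := by
    refine (congrArg (fun k => MatTensor.ent k (PUnit.unit, PUnit.unit) (PUnit.unit, PUnit.unit))
      (Idempotents.Karoubi.p_comp h).symm).trans ?_
    exact MatTensor.ent_comp_eq (PUnit.unit, PUnit.unit) (fun _ => rfl) rfl rfl
  have hL : underlying t n (ptL h) = ptL g :=
    (congrArg (fun k => MatTensor.ent k PUnit.unit PUnit.unit) (KaroubiTensor.ptL_f h)).trans
      (MatTensor.ent_ptL h.f)
  have hR : underlying t n (ptR h) = ptR g :=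
    (congrArg (fun k => MatTensor.ent k PUnit.unit PUnit.unit) (KaroubiTensor.ptR_f h)).trans
      (MatTensor.ent_ptR h.f)
  rw [trL_eq_ptL, trR_eq_ptR, ambiTrace, LinearMap.comp_apply, LinearMap.comp_apply, hL, hR, hg]
  exact signTrace_ptL_eq_ptR t n g

end Basis

end Deligne

end

theorem theorem5p6 {F : Type*} [Field F] [CharZero F] (t : F) (n : ℕ) (hn : 0 < n) :
    ∃ b : Module.Basis (Fin 2) F (Deligne.M t n ⟶ Deligne.M t n),
      b 0 = Deligne.sEnd t n ∧ b 1 = Deligne.sxsEnd t n ∧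
      ∃ tr : (Deligne.M t n ⟶ Deligne.M t n) →ₗ[F] F,
        tr (Deligne.sEnd t n) = 1 ∧ tr (Deligne.sxsEnd t n) = 1 ∧
        tr ≠ 0 ∧ Deligne.IsAmbidextrousTrace tr := by
  have h1 : Deligne.ambiTrace t n (Deligne.sEnd t n) = 1 :=
    Deligne.signTrace_antisymmetrizer t n
  refine ⟨Module.Basis.mk (Deligne.linearIndependent_sEnd_sxsEnd t hn)
    (Deligne.span_sEnd_sxsEnd t n), ?_, ?_, Deligne.ambiTrace t n, h1,
    Deligne.signTrace_sandwich_lastRemoved t n, ?_, Deligne.isAmbidextrousTrace_ambiTrace t n⟩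
  · rw [Module.Basis.mk_apply]
    rfl
  · rw [Module.Basis.mk_apply]
    rfl
  · intro h
    rw [h, LinearMap.zero_apply] at h1
    exact zero_ne_one h1
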